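/- Let $\Bbbk$ be a field. All algebras are associative and unital over $\Bbbk$, $\otimes=\otimes_\Bbbk$, and gradings are by $\mathbb N_0$. Let $H$ be a Hopf algebra with invertible antipode, and let $A$ be a right $H$-comodule algebra with coaction $\Delta_A\colon A\to A\otimes H$ and coinvariants $B=\{a\in A\mid\Delta_A(a)=a\otimes 1\}$. Assume that $A$ is a quantum principal bundle: the map $\chi\colon A\otimes_BA\to A\otimes H$, $a\otimes_B a'\mapsto (a\otimes 1)\Delta_A(a')$, is bijective, and $A$ is faithfully flat as a right $B$-module. Write $\tau(h)=\chi^{-1}(1\otimes h)=h^{\langle1\rangle}\otimes_Bh^{\langle2\rangle}$ (a finite sum, understood) for the translation map. A differential calculus on an algebra $C$ is a differential graded algebra $(\Omega^\bullet(C),\wedge,\mathrm d)$ with $\Omega^0(C)=C$ and $\Omega^k(C)=\mathrm{span}_\Bbbk\{c^0\,\mathrm dc^1\wedge\dots\wedge\mathrm dc^k\mid c^0,\dots,c^k\in C\}$ for all $k\ge1$. Tensor products of such calculi carry the multiplication $(\omega\otimes\theta)(\omega'\otimes\theta')=(-1)^{|\theta||\omega'|}\,\omega\wedge\omega'\otimes\theta\wedge\theta'$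 and the differential $\mathrm d(\omega\otimes\theta)=\mathrm d\omega\otimes\theta+(-1)^{|\omega|}\omega\otimes\mathrm d\theta$. Let $\Omega^\bullet(H)$ be a complete calculus on $H$, i.e. a differential calculus such that the comultiplication of $H$ extends to a morphism of differential graded algebras $\Omega^\bullet(H)\to\Omega^\bullet(H)\otimes\Omega^\bullet(H)$. Let $\Omega^\bullet(A)$ be a complete calculus on $A$, i.e. a differential calculus such that $\Delta_A$ extends to a morphism of differential graded algebras $\Delta_A^\bullet\colon\Omega^\bullet(A)\to\Omega^\bullet(A)\otimes\Omega^\bullet(H)$. Let $\Omega^\bullet(B)=\{\omega\in\Omega^\bullet(A)\mid\Delta_A^\bullet(\omega)=\omega\otimes1\}$ be the base forms. Then the following hold. 1. $\Omega^\bullet(B)\subseteq\Omega^\bullet(A)$ is a graded Hopf--Galois extension, that is, $$\chi^\bullet\colon\Omega^\bullet(A)\otimes_{\Omega^\bullet(B)}\Omega^\bullet(A)\to\Omega^\bullet(A)\otimes\Omega^\bullet(H),\qquad \omega\otimes\eta\mapsto(\omega\otimes1)\,\Delta_A^\bullet(\eta),$$ is a bijection, and for every $n$ it maps the degree $n$ part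 of its domain (spanned by the $\omega\otimes\eta$ with $\omega,\eta$ homogeneous and $|\omega|+|\eta|=n$) onto the degree $n$ part of its codomain. 2. There is a unique linear map $\tau^\bullet\colon\Omega^\bullet(H)\to\Omega^\bullet(A)\otimes_{\Omega^\bullet(B)}\Omega^\bullet(A)$ such that $\tau^\bullet(g)=g^{\langle1\rangle}\otimes_{\Omega^\bullet(B)}g^{\langle2\rangle}$ and $$\tau^\bullet(\theta\wedge\mathrm dg)=(-1)^{|\theta|}\,\mathrm d(g^{\langle1\rangle})\wedge\tau^\bullet(\theta)\wedge g^{\langle2\rangle}+g^{\langle1\rangle}\wedge\tau^\bullet(\theta)\wedge\mathrm d(g^{\langle2\rangle})$$ for all $g\in H$, all homogeneous $\theta\in\Omega^\bullet(H)$ and every representative in $A\otimes A$ of $\tau(g)$. Here forms on $A$ act from the left on the first tensor factor and from the right on the second. The map $\tau^\bullet$ preserves degrees. 3. The inverse of $\chi^\bullet$ is the linear map determined by $\omega\otimes\theta\mapsto\omega\wedge\tau^\bullet(\theta)$. -/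

import Mathlib

open scoped TensorProduct

universe u v

noncomputable section

namespace QPB

/-! ### Tensor products balanced over a noncommutative subalgebra -/

section Balanced

variable {k : Type*} [Field k] {R : Type*} [Ring R] [Algebra k R] (S : Subalgebra k R)

/-- The span of the relations `(r s) ⊗ m = r ⊗ (s m)` in `R ⊗ₖ M`, for a left `S`-module `M`. -/
def balancedRelations (M : Type*) [AddCommGroup M] [Module k M] [Module S M] :
    Submodule k (R ⊗[k] M) :=
  Submodule.span k {x | ∃ (r : R) (s : S) (m : M), x = (r * (s : R)) ⊗ₜ[k] m - r ⊗ₜ[k] (s • m)}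

theorem balancedRelations_le {M : Type*} [AddCommGroup M] [Module k M] [Module S M]
    {p : Submodule k (R ⊗[k] M)}
    (h : ∀ (r : R) (s : S) (m : M), (r * (s : R)) ⊗ₜ[k] m - r ⊗ₜ[k] (s • m) ∈ p) :
    balancedRelations S M ≤ p :=
  Submodule.span_le.2 (by rintro _ ⟨r, s, m, rfl⟩; exact h r s m)

/-- The balanced tensor product `R ⊗_S M` of `R`, seen as a right `S`-module, with a left
`S`-module `M`. -/
abbrev BalancedTensor (M : Type*) [AddCommGroup M] [Module k M] [Module S M] : Type _ :=
  (R ⊗[k] M) ⧸ balancedRelations S M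

namespace BalancedTensor

variable {S} {M N : Type*} [AddCommGroup M] [Module k M] [Module S M]
  [AddCommGroup N] [Module k N] [Module S N]

/-- The class `r ⊗_S m` of a pure tensor. -/
def tmul (r : R) (m : M) : BalancedTensor S M :=
  (balancedRelations S M).mkQ (r ⊗ₜ[k] m)

theorem tmul_smul (r : R) (s : S) (m : M) :
    tmul (S := S) (r * (s : R)) m = tmul r (s • m) := by
  unfold tmul
  rw [← sub_eq_zero, ← map_sub]
  simp only [Submodule.mkQ_apply, Submodule.Quotient.mk_eq_zero]
  exact Submodule.subset_span ⟨r, s, m, rfl⟩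

/-- The map `id ⊗_S f : R ⊗_S M → R ⊗_S N` induced by a left `S`-linear map `f : M → N`. -/
def map [IsScalarTower k S M] [IsScalarTower k S N] (f : M →ₗ[S] N) :
    BalancedTensor S M →ₗ[k] BalancedTensor S N :=
  Submodule.mapQ _ _ (LinearMap.lTensor R (f.restrictScalars k)) (by
    refine balancedRelations_le S fun r s m => ?_
    refine Submodule.subset_span ⟨r, s, f m, ?_⟩
    simp)

/-- The left action of `ω` on `R ⊗_S M`, that is `r ⊗ m ↦ (ω r) ⊗ m`. -/
def lmul (ω : R) : BalancedTensor S M →ₗ[k] BalancedTensor S M :=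
  Submodule.mapQ _ _ (LinearMap.rTensor M (LinearMap.mulLeft k ω)) (by
    refine balancedRelations_le S fun r s m => ?_
    refine Submodule.subset_span ⟨ω * r, s, m, ?_⟩
    simp [mul_assoc])

/-- The right action of `ω` on `R ⊗_S R`, that is `r ⊗ r' ↦ r ⊗ (r' ω)`. -/
def rmul (ω : R) : BalancedTensor S R →ₗ[k] BalancedTensor S R :=
  Submodule.mapQ _ _ (LinearMap.lTensor R (LinearMap.mulRight k ω)) (by
    refine balancedRelations_le S fun r s m => ?_
    refine Submodule.subset_span ⟨r, s, m * ω, ?_⟩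
    simp [Subalgebra.smul_def, mul_assoc])

end BalancedTensor

/-- `R` is faithfully flat as a right `S`-module: the functor `R ⊗_S ·` on left `S`-modules
preserves and reflects exact sequences. -/
def IsRightFaithfullyFlat {k : Type u} [Field k] {R : Type v} [Ring R] [Algebra k R]
    (S : Subalgebra k R) : Prop :=
  ∀ (M N P : Type v) [AddCommGroup M] [AddCommGroup N] [AddCommGroup P]
    [Module k M] [Module k N] [Module k P] [Module S M] [Module S N] [Module S P]
    [IsScalarTower k S M] [IsScalarTower k S N] [IsScalarTower k S P]
    (f : M →ₗ[S] N) (g : N →ₗ[S] P),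
    Function.Exact f g ↔ Function.Exact (BalancedTensor.map f) (BalancedTensor.map g)

/-- For algebra maps `δ, ι : R → T` (a coaction `δ`, and `ι r = r ⊗ 1`), the canonical map
`R ⊗_S R → T`, `r ⊗ r' ↦ ι r * δ r'`, where `S = {r | δ r = ι r}`. -/
def canonicalMap {T : Type*} [Ring T] [Algebra k T] (δ ι : R →ₐ[k] T) :
    BalancedTensor (AlgHom.equalizer δ ι) R →ₗ[k] T :=
  Submodule.liftQ _
    (LinearMap.mul' k T ∘ₗ TensorProduct.map ι.toLinearMap δ.toLinearMap) (by
      refine balancedRelations_le _ ?_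
      rintro r ⟨s, hs⟩ m
      have hs' : δ s = ι s := hs
      simp [Subalgebra.smul_def, hs', mul_assoc])

theorem canonicalMap_tmul {T : Type*} [Ring T] [Algebra k T] (δ ι : R →ₐ[k] T) (r r' : R) :
    canonicalMap δ ι (BalancedTensor.tmul r r') = ι r * δ r' := by
  simp [canonicalMap, BalancedTensor.tmul]

end Balanced

/-! ### Comodule algebras and Hopf--Galois extensions -/

section HopfGalois

variable {k : Type*} [Field k] {H : Type*} [Ring H] [HopfAlgebra k H]
  {A : Type*} [Ring A] [Algebra k A]

/-- The algebra map `δ : A → A ⊗ H` is a right `H`-coaction, so that `A` is a right `H`-comodule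
algebra. -/
structure IsComoduleAlgebra (δ : A →ₐ[k] A ⊗[k] H) : Prop where
  coassoc : ∀ a : A,
    TensorProduct.assoc k A H H (δ.toLinearMap.rTensor H (δ a)) =
      (Coalgebra.comul (R := k) (A := H)).lTensor A (δ a)
  counit : ∀ a : A,
    TensorProduct.rid k A ((Coalgebra.counit (R := k) (A := H)).lTensor A (δ a)) = a

/-- The subalgebra `B = {a | δ a = a ⊗ 1}` of coinvariants. -/
abbrev coinvariants (δ : A →ₐ[k] A ⊗[k] H) : Subalgebra k A :=
  AlgHom.equalizer δ Algebra.TensorProduct.includeLeft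

/-- The canonical map `χ : A ⊗_B A → A ⊗ H`, `a ⊗ a' ↦ (a ⊗ 1) δ(a')`. -/
abbrev galoisMap (δ : A →ₐ[k] A ⊗[k] H) :
    BalancedTensor (coinvariants δ) A →ₗ[k] A ⊗[k] H :=
  canonicalMap δ Algebra.TensorProduct.includeLeft

/-- A quantum principal bundle: a right `H`-comodule algebra `A` such that the canonical map is
bijective and `A` is faithfully flat as a right module over the coinvariants. -/
structure IsQuantumPrincipalBundle (δ : A →ₐ[k] A ⊗[k] H) : Prop where
  comoduleAlgebra : IsComoduleAlgebra δ
  bijective : Function.Bijective (galoisMap δ)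
  faithfullyFlat : IsRightFaithfullyFlat (coinvariants δ)

/-- The translation map `τ(h) = χ⁻¹(1 ⊗ h)`. -/
def translationMap {δ : A →ₐ[k] A ⊗[k] H} (hδ : IsQuantumPrincipalBundle δ) (h : H) :
    BalancedTensor (coinvariants δ) A :=
  (LinearEquiv.ofBijective (galoisMap δ) hδ.bijective).symm (1 ⊗ₜ[k] h)

end HopfGalois

/-! ### Differential calculi -/

section Calculi

/-- A differential calculus on the algebra `A`: a differential graded algebra
`Ω = ⨁ n, 𝒜 n` together with an identification `incl : A ≃ 𝒜 0`, generated by degree zero. -/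
structure DifferentialCalculus (k : Type*) [Field k] (A : Type*) [Ring A] [Algebra k A]
    {Ω : Type*} [Ring Ω] [Algebra k Ω] (𝒜 : ℕ → Submodule k Ω) [GradedAlgebra 𝒜] where
  incl : A →ₐ[k] Ω
  incl_injective : Function.Injective incl
  range_incl : LinearMap.range incl.toLinearMap = 𝒜 0
  d : Ω →ₗ[k] Ω
  d_mem : ∀ (n : ℕ) (ω : Ω), ω ∈ 𝒜 n → d ω ∈ 𝒜 (n + 1)
  d_d : ∀ ω : Ω, d (d ω) = 0
  leibniz : ∀ (n : ℕ) (ω η : Ω), ω ∈ 𝒜 n →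
    d (ω * η) = d ω * η + (-1 : k) ^ n • (ω * d η)
  generated : ∀ n : ℕ, 0 < n → 𝒜 n = Submodule.span k
    {ω | ∃ (a₀ : A) (a : Fin n → A),
      ω = incl a₀ * (List.ofFn fun i => d (incl (a i))).prod}

variable {k : Type*} [Field k] {A : Type*} [Ring A] [Algebra k A]
  {H : Type*} [Ring H] [HopfAlgebra k H]
  {ΩA : Type*} [Ring ΩA] [Algebra k ΩA] {𝒜 : ℕ → Submodule k ΩA} [GradedAlgebra 𝒜]
  {ΩH : Type*} [Ring ΩH] [Algebra k ΩH] {ℋ : ℕ → Submodule k ΩH} [GradedAlgebra ℋ]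

/-- The grading involution `ω ↦ (-1)^|ω| ω`. -/
def gradingInvolution (𝒜 : ℕ → Submodule k ΩA) [GradedAlgebra 𝒜] : ΩA →ₗ[k] ΩA :=
  DirectSum.toModule k ℕ ΩA (fun n => (-1 : k) ^ n • (𝒜 n).subtype) ∘ₗ
    (DirectSum.decomposeLinearEquiv 𝒜).toLinearMap

theorem gradingInvolution_apply {n : ℕ} {ω : ΩA} (hω : ω ∈ 𝒜 n) :
    gradingInvolution 𝒜 ω = (-1 : k) ^ n • ω := by
  lift ω to 𝒜 n using hω
  simp [gradingInvolution]

/-- The differential `d(ω ⊗ θ) = dω ⊗ θ + (-1)^|ω| ω ⊗ dθ` of the tensor product of differential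
graded algebras. -/
def tensorD (CA : DifferentialCalculus k A 𝒜) (CH : DifferentialCalculus k H ℋ) :
    (𝒜 ᵍ⊗[k] ℋ) →ₗ[k] (𝒜 ᵍ⊗[k] ℋ) :=
  (GradedTensorProduct.of k 𝒜 ℋ).toLinearMap ∘ₗ
    (TensorProduct.map CA.d LinearMap.id + TensorProduct.map (gradingInvolution 𝒜) CH.d) ∘ₗ
    (GradedTensorProduct.of k 𝒜 ℋ).symm.toLinearMap

theorem tensorD_tmul (CA : DifferentialCalculus k A 𝒜) (CH : DifferentialCalculus k H ℋ)
    {n : ℕ} {ω : ΩA} (hω : ω ∈ 𝒜 n) (θ : ΩH) :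
    tensorD CA CH (GradedTensorProduct.tmul k ω θ) =
      GradedTensorProduct.tmul k (CA.d ω) θ +
        (-1 : k) ^ n • GradedTensorProduct.tmul k ω (CH.d θ) := by
  simp only [tensorD, GradedTensorProduct.tmul, LinearMap.comp_apply, LinearEquiv.coe_coe,
    GradedTensorProduct.of_symm_of, LinearMap.add_apply, TensorProduct.map_tmul, LinearMap.id_apply,
    gradingInvolution_apply hω, map_add, ← TensorProduct.smul_tmul', map_smul]

/-- The degree `n` part of the tensor product of graded algebras. -/
def tensorDegree (𝒜 : ℕ → Submodule k ΩA) [GradedAlgebra 𝒜] (ℋ : ℕ → Submodule k ΩH)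
    [GradedAlgebra ℋ] (n : ℕ) : Submodule k (𝒜 ᵍ⊗[k] ℋ) :=
  Submodule.span k {x | ∃ (r s : ℕ) (ω : ΩA) (θ : ΩH),
    r + s = n ∧ ω ∈ 𝒜 r ∧ θ ∈ ℋ s ∧ x = GradedTensorProduct.tmul k ω θ}

/-- `Δ : Ω(A) → Ω(A) ⊗ Ω(H)` is a morphism of differential graded algebras which extends
`δ : A → A ⊗ H`. The codomain carries the graded tensor product algebra structure. -/
structure IsDGAExtension (CA : DifferentialCalculus k A 𝒜) (CH : DifferentialCalculus k H ℋ)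
    (δ : A →ₐ[k] A ⊗[k] H) (Δ : ΩA →ₐ[k] 𝒜 ᵍ⊗[k] ℋ) : Prop where
  map_degree : ∀ (n : ℕ) (ω : ΩA), ω ∈ 𝒜 n → Δ ω ∈ tensorDegree 𝒜 ℋ n
  map_d : ∀ ω : ΩA, Δ (CA.d ω) = tensorD CA CH (Δ ω)
  map_incl : ∀ a : A, Δ (CA.incl a) =
    GradedTensorProduct.of k 𝒜 ℋ
      (TensorProduct.map CA.incl.toLinearMap CH.incl.toLinearMap (δ a))

/-- A calculus on the Hopf algebra `H` is complete if the comultiplication extends to a morphism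
of differential graded algebras `Ω(H) → Ω(H) ⊗ Ω(H)`. -/
def IsComplete (CH : DifferentialCalculus k H ℋ) : Prop :=
  ∃ Δ : ΩH →ₐ[k] ℋ ᵍ⊗[k] ℋ, IsDGAExtension CH CH (Bialgebra.comulAlgHom k H) Δ

/-- The base forms `Ω(B) = {ω | Δ ω = ω ⊗ 1}`. -/
abbrev baseForms (Δ : ΩA →ₐ[k] 𝒜 ᵍ⊗[k] ℋ) : Subalgebra k ΩA :=
  AlgHom.equalizer Δ (GradedTensorProduct.includeLeft 𝒜 ℋ)

/-- The graded canonical map `χ : Ω(A) ⊗_{Ω(B)} Ω(A) → Ω(A) ⊗ Ω(H)`,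
`ω ⊗ η ↦ (ω ⊗ 1) Δ(η)`. -/
abbrev gradedGaloisMap (Δ : ΩA →ₐ[k] 𝒜 ᵍ⊗[k] ℋ) :
    BalancedTensor (baseForms Δ) ΩA →ₗ[k] 𝒜 ᵍ⊗[k] ℋ :=
  canonicalMap Δ (GradedTensorProduct.includeLeft 𝒜 ℋ)

/-- The degree `n` part of `Ω(A) ⊗_{Ω(B)} Ω(A)`. -/
def balancedDegree (Δ : ΩA →ₐ[k] 𝒜 ᵍ⊗[k] ℋ) (n : ℕ) :
    Submodule k (BalancedTensor (baseForms Δ) ΩA) :=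
  Submodule.span k {x | ∃ (r s : ℕ) (ω η : ΩA),
    r + s = n ∧ ω ∈ 𝒜 r ∧ η ∈ 𝒜 s ∧ x = BalancedTensor.tmul ω η}

/-- `τ' : Ω(H) → Ω(A) ⊗_{Ω(B)} Ω(A)` is the extension of the translation map `τ` to forms.
Writing `τ(g) = ∑ i, a i ⊗_B a' i`, it is given
* on degree zero by `τ'(g) = ∑ i, a i ⊗ a' i`, and
* by the inside-out rule
  `τ'(θ ∧ dg) = ∑ i, ((-1)^|θ| d(a i) τ'(θ) a' i + a i τ'(θ) d(a' i))`,
so that for `θ = h dg¹ ∧ ⋯ ∧ dgⁿ` the factors coming from `τ(h)` are innermost, the ones from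
`τ(gⁿ)` are outermost, and the differentials are distributed over the legs with the signs above.
The conditions are required for all representatives of `τ(g)`. -/
structure IsExtendedTranslationMap {δ : A →ₐ[k] A ⊗[k] H} (hδ : IsQuantumPrincipalBundle δ)
    (CA : DifferentialCalculus k A 𝒜) (CH : DifferentialCalculus k H ℋ)
    (Δ : ΩA →ₐ[k] 𝒜 ᵍ⊗[k] ℋ)
    (τ' : ΩH →ₗ[k] BalancedTensor (baseForms Δ) ΩA) : Prop where
  zero_form : ∀ (g : H) (m : ℕ) (a a' : Fin m → A),
    translationMap hδ g = ∑ i, BalancedTensor.tmul (a i) (a' i) →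
      τ' (CH.incl g) = ∑ i, BalancedTensor.tmul (CA.incl (a i)) (CA.incl (a' i))
  mul_d : ∀ (n : ℕ) (θ : ΩH), θ ∈ ℋ n → ∀ (g : H) (m : ℕ) (a a' : Fin m → A),
    translationMap hδ g = ∑ i, BalancedTensor.tmul (a i) (a' i) →
      τ' (θ * CH.d (CH.incl g)) = ∑ i,
        ((-1 : k) ^ n • BalancedTensor.lmul (CA.d (CA.incl (a i)))
            (BalancedTensor.rmul (CA.incl (a' i)) (τ' θ)) +
          BalancedTensor.lmul (CA.incl (a i))
            (BalancedTensor.rmul (CA.d (CA.incl (a' i))) (τ' θ)))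

end Calculi

end QPB

end

/-! Surjectivity of `χ^•` is the easy half and gives the inside-out rule. If `z` maps to `1 ⊗ θ`
with `|θ| = n`, the Leibniz rule shows that `(-1)ⁿ da ∧ z ∧ a' + a ∧ z ∧ da'` is sent to an
expression depending only on `χ(a ⊗ a')`. Inserting `τ(g)`, where `χ` has the value `1 ⊗ g`, and
using `d1 = 0`, the image is `1 ⊗ θ ∧ dg` (`gradedGaloisMap_sum_insideOut`). Since `Ω(H)` is
generated by `H` and exact one-forms, every `1 ⊗ θ` is reached, and left `Ω(A)`-linearity does the
rest. Once `χ^•` is also injective, `τ^•(θ) = (χ^•)⁻¹(1 ⊗ θ)` satisfies the required rules for all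
representatives, and everything else in the theorem follows formally.

Injectivity is the substantial half and rests on descent. For a relative Hopf module `M`, the map `A
⊗_B M → M ⊗ H`, `a ⊗ m ↦ a m₀ ⊗ m₁`, is injective (`hopfModuleMap_injective`); this uses `τ` and the
inverse antipode. With faithful flatness over `B`, it yields two descent principles:
`mem_range_of_hopfModuleMap` places coinvariant elements in the range of a `B`-linear map, and
`mem_span_smul_ker` writes elements as `A`-combinations of a kernel. The form algebra `Ω(A)` is a
relative Hopf module under the degree zero part `Ω(A) → Ω(A) ⊗ H` of its coaction. Three facts
result.

(a) Horizontal forms, those with `Δ(ω) ∈ Ω(A) ⊗ H`, are spanned by `A · Ω(B)`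
(`horizontal_le_span`).

(b) For each left invariant `n`-form `θ` on `H` there is an `n`-form on `A` whose coaction has
vertical part (component of degree `n` in `Ω(H)`) equal to `1 ⊗ θ` (`leftInvariant_mem_range`).
Choose such forms linearly, as `φ(θ)`. Subtracting leading vertical parts then shows that `Ω(A)` is
spanned by products `m φ(θ)` with `m` horizontal (`mem_span_horizontal_mul`).

(c) Base forms commute with `τ(h)` inside `Ω(A) ⊗_{Ω(B)} Ω(A)` (`lmul_translationForms`).

By (a)-(c), the elements `ω τ(h) φ(θ)` span `Ω(A) ⊗_{Ω(B)} Ω(A)`. This gives a surjection from `⨁ₙ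
Ω(A) ⊗ H ⊗ Λⁿ`, where `Λⁿ` denotes left invariant `n`-forms. Its composite with `χ^•` is triangular
for the vertical degree, and its diagonal is `Ω(A)` tensored with the injective multiplication `H ⊗
Λⁿ → Ω(H)` (`invariantMul_injective`). The composite is therefore injective, hence so is `χ^•`
(`gradedGaloisMap_injective_of_section`). -/

noncomputable section
namespace QPB

/-! ### Identities for the antipode and its inverse. -/

section Antipode

open HopfAlgebra Coalgebra

variable {k : Type*} [Field k] {H : Type*} [Ring H] [HopfAlgebra k H]

/-- The inverse of a bijective antipode. -/
def antipodeInv (hS : Function.Bijective (antipode k (A := H))) : H →ₗ[k] H :=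
  (LinearEquiv.ofBijective (antipode k (A := H)) hS).symm.toLinearMap

theorem antipode_antipodeInv (hS : Function.Bijective (antipode k (A := H))) (h : H) :
    antipode k (antipodeInv hS h) = h :=
  (LinearEquiv.ofBijective (antipode k (A := H)) hS).apply_symm_apply h

/-- `∑ S⁻¹(h₂) h₁ = ε(h)`. -/
theorem mul_antipodeInv_comm_comul (hS : Function.Bijective (antipode k (A := H))) (h : H) :
    LinearMap.mul' k H ((antipodeInv hS).rTensor H (TensorProduct.comm k H H (comul (R := k) h))) =
      algebraMap k H (counit h) := by
  -- `S` reverses products, so applying it turns the claim into the antipode axiom `S(h₁) h₂ =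
  -- ε(h)`.
  apply hS.1
  have key : antipode k (A := H) ∘ₗ LinearMap.mul' k H ∘ₗ (antipodeInv hS).rTensor H ∘ₗ
      (TensorProduct.comm k H H).toLinearMap =
      LinearMap.mul' k H ∘ₗ (antipode k (A := H)).rTensor H := by
    ext x y
    simp [antipode_mul_antidistrib, antipode_antipodeInv]
  have := LinearMap.congr_fun key (comul (R := k) h)
  simp only [LinearMap.comp_apply, LinearEquiv.coe_coe] at this
  rw [this, mul_antipode_rTensor_comul_apply, Algebra.algebraMap_eq_smul_one, map_smul,
    antipode_one]

/-- `∑ h₂ S⁻¹(h₁) = ε(h)`. -/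
theorem mul_comm_antipodeInv_comul (hS : Function.Bijective (antipode k (A := H))) (h : H) :
    LinearMap.mul' k H (TensorProduct.comm k H H ((antipodeInv hS).rTensor H (comul (R := k) h))) =
      algebraMap k H (counit h) := by
  apply hS.1
  have key : antipode k (A := H) ∘ₗ LinearMap.mul' k H ∘ₗ
      (TensorProduct.comm k H H).toLinearMap ∘ₗ (antipodeInv hS).rTensor H =
      LinearMap.mul' k H ∘ₗ (antipode k (A := H)).lTensor H := by
    ext x y
    simp [antipode_mul_antidistrib, antipode_antipodeInv]
  have := LinearMap.congr_fun key (comul (R := k) h)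
  simp only [LinearMap.comp_apply, LinearEquiv.coe_coe] at this
  rw [this, mul_antipode_lTensor_comul_apply, Algebra.algebraMap_eq_smul_one, map_smul,
    antipode_one]

/-- The antipode is an anti-homomorphism of coalgebras. -/
theorem comul_antipode (h : H) :
    comul (R := k) (antipode k h) =
      TensorProduct.comm k H H (TensorProduct.map (antipode k) (antipode k) (comul (R := k) h)) := by
  have key : (comul (R := k) (A := H)) ∘ₗ antipode k =
      (TensorProduct.comm k H H).toLinearMap ∘ₗ
        TensorProduct.map (antipode k) (antipode k) ∘ₗ comul := by
    apply WithConv.toConv_injective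
    -- In the convolution algebra of maps `H → H ⊗ H`, the left side is a left inverse of the
    -- comultiplication and the right side a right inverse.
    apply left_inv_eq_right_inv (a := WithConv.toConv (comul (R := k) (A := H)))
    · ext a
      simp [(ℛ k a).convMul_apply, ← Bialgebra.comul_mul, ← map_sum,
        sum_antipode_mul_eq_algebraMap_counit]
    · ext a
      let S : H →ₗ[k] H := antipode k
      let F : H →ₗ[k] H ⊗[k] H :=
        (TensorProduct.comm k H H).toLinearMap ∘ₗ TensorProduct.map S S ∘ₗ comul
      let Q : (H ⊗[k] H) ⊗[k] H →ₗ[k] H ⊗[k] H :=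
        LinearMap.mul' k (H ⊗[k] H) ∘ₗ F.lTensor (H ⊗[k] H)
      have hQ : ∀ l r : H, Q ((TensorProduct.assoc k H H H).symm (l ⊗ₜ comul r)) =
          (l * S r) ⊗ₜ 1 := by
        intro l r
        let R : (H ⊗[k] H) ⊗[k] H →ₗ[k] H ⊗[k] H :=
          (TensorProduct.comm k H H).toLinearMap ∘ₗ
            TensorProduct.map (LinearMap.mul' k H ∘ₗ S.lTensor H) (LinearMap.mulLeft k l ∘ₗ S)
        have h1 : ∀ W : H ⊗[k] H, Q ((TensorProduct.assoc k H H H).symm (l ⊗ₜ W)) =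
            R ((TensorProduct.assoc k H H H).symm ((comul (R := k)).lTensor H W)) := by
          intro W
          induction W with
          | zero => simp
          | add x y hx hy => simp only [TensorProduct.tmul_add, map_add, hx, hy]
          | tmul b r =>
            simp only [Q, F, R, LinearMap.comp_apply, TensorProduct.assoc_symm_tmul,
              LinearMap.lTensor_tmul, LinearEquiv.coe_coe]
            induction (comul (R := k) r) with
            | zero => simp
            | add x y hx hy => simp only [TensorProduct.tmul_add, map_add, hx, hy]
            | tmul c d => simp
        rw [h1, coassoc_symm_apply]
        have h2 : R ∘ₗ (comul (R := k)).rTensor H = (TensorProduct.mk k H H).flip 1 ∘ₗ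
            LinearMap.mulLeft k l ∘ₗ S ∘ₗ (TensorProduct.lid k H).toLinearMap ∘ₗ
              (counit (R := k)).rTensor H := by
          ext x y
          simp [R, S, Algebra.algebraMap_eq_smul_one, TensorProduct.tmul_smul,
            TensorProduct.smul_tmul']
        rw [← LinearMap.comp_apply, h2]
        simp [S]
      have h3 : Q ((comul (R := k)).rTensor H (comul a)) = algebraMap k H (counit a) ⊗ₜ 1 := by
        rw [← coassoc_symm_apply]
        conv_lhs => rw [← (ℛ k a).eq]
        simp only [map_sum, LinearMap.lTensor_tmul, hQ, ← TensorProduct.sum_tmul]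
        rw [sum_mul_antipode_eq_algebraMap_counit]
      rw [← (ℛ k a).eq] at h3
      simpa [(ℛ k a).convMul_apply, Q, F, S, Algebra.TensorProduct.algebraMap_apply] using h3
  exact LinearMap.congr_fun key h

end Antipode

/-! ### Relative Hopf modules and the twist `m ⊗ h ↦ m₀ ⊗ h m₁`. -/

section HopfModules

variable {k : Type*} [Field k] {H : Type*} [Ring H] [HopfAlgebra k H]
  {A : Type*} [Ring A] [Algebra k A]

variable (k A H) in
/-- The action `(a ⊗ g) • (m ⊗ h) = a m ⊗ g h` of `A ⊗ H` on `M ⊗ H`. -/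
def hopfAct (M : Type*) [AddCommGroup M] [Module k M] [Module A M] [IsScalarTower k A M] :
    A ⊗[k] H →ₗ[k] M ⊗[k] H →ₗ[k] M ⊗[k] H :=
  TensorProduct.map₂ (Algebra.lsmul k k M).toLinearMap (LinearMap.mul k H)

section Act

variable {M : Type*} [AddCommGroup M] [Module k M] [Module A M] [IsScalarTower k A M]

@[simp]
theorem hopfAct_tmul (a : A) (g : H) (m : M) (h : H) :
    hopfAct k H A M (a ⊗ₜ g) (m ⊗ₜ h) = (a • m) ⊗ₜ (g * h) := by
  simp [hopfAct]

theorem hopfAct_mul (x y : A ⊗[k] H) (z : M ⊗[k] H) :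
    hopfAct k H A M (x * y) z = hopfAct k H A M x (hopfAct k H A M y z) := by
  induction x with
  | zero => simp
  | add x x' hx hx' => simp only [add_mul, map_add, LinearMap.add_apply, hx, hx']
  | tmul a g =>
    induction y with
    | zero => simp
    | add y y' hy hy' => simp only [mul_add, map_add, LinearMap.add_apply, hy, hy']
    | tmul a' g' =>
      induction z with
      | zero => simp
      | add z z' hz hz' => simp only [map_add, hz, hz']
      | tmul m h => simp [mul_smul, mul_assoc]

end Act

/-- A relative Hopf module: a left `A`-module with a compatible right `H`-coaction. -/
structure IsHopfModule (δ : A →ₐ[k] A ⊗[k] H) {M : Type*} [AddCommGroup M] [Module k M]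
    [Module A M] [IsScalarTower k A M] (ρ : M →ₗ[k] M ⊗[k] H) : Prop where
  map_smul : ∀ (a : A) (m : M), ρ (a • m) = hopfAct k H A M (δ a) (ρ m)
  coassoc : ∀ m : M, TensorProduct.assoc k M H H (ρ.rTensor H (ρ m)) =
    (Coalgebra.comul (R := k) (A := H)).lTensor M (ρ m)
  counit : ∀ m : M,
    TensorProduct.rid k M ((Coalgebra.counit (R := k) (A := H)).lTensor M (ρ m)) = m

variable {δ : A →ₐ[k] A ⊗[k] H}
  {M : Type*} [AddCommGroup M] [Module k M] [Module A M] [IsScalarTower k A M]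

theorem coinvariants_apply (b : coinvariants δ) : δ b = (b : A) ⊗ₜ 1 := b.2

/-- The map `A ⊗_B M → M ⊗ H`, `a ⊗ m ↦ (a ⊗ 1) ρ(m)`. -/
def hopfModuleMap {ρ : M →ₗ[k] M ⊗[k] H} (hρ : IsHopfModule δ ρ) :
    BalancedTensor (coinvariants δ) M →ₗ[k] M ⊗[k] H :=
  Submodule.liftQ _
    (TensorProduct.lift (((hopfAct k H A M).compl₂ ρ) ∘ₗ (TensorProduct.mk k A H).flip 1)) (by
      refine balancedRelations_le _ fun a b m => ?_
      have h1 : (b : A) ⊗ₜ[k] (1 : H) = δ b := (coinvariants_apply b).symm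
      have h2 : (a * (b : A)) ⊗ₜ[k] (1 : H) = (a ⊗ₜ 1) * δ b := by
        rw [← h1, Algebra.TensorProduct.tmul_mul_tmul, one_mul]
      simp only [LinearMap.mem_ker, map_sub, TensorProduct.lift.tmul, LinearMap.comp_apply,
        LinearMap.flip_apply, TensorProduct.mk_apply, LinearMap.compl₂_apply, h2, hopfAct_mul]
      rw [Subalgebra.smul_def, hρ.map_smul, sub_self])

@[simp]
theorem hopfModuleMap_tmul {ρ : M →ₗ[k] M ⊗[k] H} (hρ : IsHopfModule δ ρ) (a : A) (m : M) :
    hopfModuleMap hρ (BalancedTensor.tmul a m) = hopfAct k H A M (a ⊗ₜ 1) (ρ m) := by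
  simp [hopfModuleMap, BalancedTensor.tmul]

/-- The map `M ⊗ H → M ⊗ H`, `m ⊗ h ↦ m₀ ⊗ h m₁`. -/
def twist (ρ : M →ₗ[k] M ⊗[k] H) : M ⊗[k] H →ₗ[k] M ⊗[k] H :=
  (LinearMap.mul' k H ∘ₗ (TensorProduct.comm k H H).toLinearMap).lTensor M ∘ₗ
    (TensorProduct.assoc k M H H).toLinearMap ∘ₗ ρ.rTensor H

theorem twist_tmul (ρ : M →ₗ[k] M ⊗[k] H) (m : M) (h : H) :
    twist ρ (m ⊗ₜ h) = (LinearMap.mulLeft k h).lTensor M (ρ m) := by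
  simp only [twist, LinearMap.comp_apply, LinearMap.rTensor_tmul, LinearEquiv.coe_coe]
  induction ρ m with
  | zero => simp
  | add x y hx hy => simp only [TensorProduct.add_tmul, map_add, hx, hy]
  | tmul x g => simp

-- A left inverse is `m ⊗ h ↦ m₀ ⊗ h S⁻¹(m₁)`: coassociativity leaves `h m₂ S⁻¹(m₁)`, which
-- collapses by `h₂ S⁻¹(h₁) = ε(h)`.
open HopfAlgebra Coalgebra in
theorem twist_injective (hS : Function.Bijective (antipode k (A := H)))
    {ρ : M →ₗ[k] M ⊗[k] H} (hρ : IsHopfModule δ ρ) :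
    Function.Injective (twist ρ) := by
  let T' : M ⊗[k] H →ₗ[k] M ⊗[k] H :=
    (LinearMap.mul' k H ∘ₗ (TensorProduct.comm k H H).toLinearMap ∘ₗ
      (antipodeInv hS).rTensor H).lTensor M ∘ₗ
      (TensorProduct.assoc k M H H).toLinearMap ∘ₗ ρ.rTensor H
  have key : ∀ z, T' (twist ρ z) = z := by
    intro z
    induction z with
    | zero => simp
    | add x y hx hy => simp only [map_add, hx, hy]
    | tmul m h =>
      rw [twist_tmul]
      let G : H ⊗[k] H →ₗ[k] H :=
        LinearMap.mulLeft k h ∘ₗ LinearMap.mul' k H ∘ₗ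
          (TensorProduct.comm k H H).toLinearMap ∘ₗ (antipodeInv hS).rTensor H
      have h1 : ∀ Z, T' ((LinearMap.mulLeft k h).lTensor M Z) =
          G.lTensor M (TensorProduct.assoc k M H H (ρ.rTensor H Z)) := by
        intro Z
        induction Z with
        | zero => simp
        | add x y hx hy => simp only [map_add, hx, hy]
        | tmul x g =>
          simp only [T', G, LinearMap.comp_apply, LinearMap.lTensor_tmul, LinearMap.rTensor_tmul,
            LinearEquiv.coe_coe]
          induction ρ x with
          | zero => simp
          | add x y hx hy => simp only [TensorProduct.add_tmul, map_add, hx, hy]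
          | tmul x y => simp [mul_assoc]
      have h2 : G ∘ₗ comul = (LinearMap.toSpanSingleton k H h) ∘ₗ counit := by
        ext x
        simp only [G, LinearMap.comp_apply, LinearEquiv.coe_coe, mul_comm_antipodeInv_comul]
        simp [Algebra.algebraMap_eq_smul_one]
      rw [h1, hρ.coassoc, ← LinearMap.comp_apply, ← LinearMap.lTensor_comp, h2,
        LinearMap.lTensor_comp, LinearMap.comp_apply]
      conv_rhs => rw [← hρ.counit m]
      induction (counit (R := k)).lTensor M (ρ m) with
      | zero => simp
      | add x y hx hy => simp only [map_add, hx, hy, TensorProduct.add_tmul]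
      | tmul x y => simp [TensorProduct.smul_tmul']
  exact Function.LeftInverse.injective key

end HopfModules

/-! ### Calculus of balanced tensors. -/

namespace BalancedTensor

variable {k : Type*} [Field k] {R : Type*} [Ring R] [Algebra k R] {S : Subalgebra k R}
  {M N : Type*} [AddCommGroup M] [Module k M] [Module S M]
  [AddCommGroup N] [Module k N] [Module S N]

@[elab_as_elim]
theorem induction {p : BalancedTensor S M → Prop} (z : BalancedTensor S M) (zero : p 0)
    (tmul : ∀ r m, p (tmul r m)) (add : ∀ x y, p x → p y → p (x + y)) : p z := by
  obtain ⟨z, rfl⟩ := Submodule.mkQ_surjective _ z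
  induction z with
  | zero => simpa using zero
  | tmul r m => exact tmul r m
  | add x y hx hy => simpa using add _ _ hx hy

theorem exists_sum (z : BalancedTensor S M) :
    ∃ (n : ℕ) (a : Fin n → R) (m : Fin n → M), z = ∑ i, tmul (a i) (m i) := by
  induction z using induction with
  | zero => exact ⟨0, Fin.elim0, Fin.elim0, by simp⟩
  | tmul r m => exact ⟨1, fun _ => r, fun _ => m, by simp⟩
  | add x y hx hy =>
    obtain ⟨n, a, m, rfl⟩ := hx
    obtain ⟨n', a', m', rfl⟩ := hy
    exact ⟨n + n', Fin.append a a', Fin.append m m', by simp [Fin.sum_univ_add]⟩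

variable (S M) in
/-- The bilinear map `(r, m) ↦ r ⊗_S m`. -/
def mk : R →ₗ[k] M →ₗ[k] BalancedTensor S M :=
  (TensorProduct.mk k R M).compr₂ (balancedRelations S M).mkQ

@[simp]
theorem mk_apply (r : R) (m : M) : mk S M r m = tmul r m := rfl

theorem tmul_add (r : R) (m m' : M) : tmul (S := S) r (m + m') = tmul r m + tmul r m' :=
  (mk S M r).map_add m m'

@[simp]
theorem map_tmul [IsScalarTower k S M] [IsScalarTower k S N] (f : M →ₗ[S] N) (r : R) (m : M) :
    map f (tmul r m) = tmul r (f m) := rfl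

@[simp]
theorem lmul_tmul (ω r : R) (m : M) : lmul ω (tmul (S := S) r m) = tmul (ω * r) m := rfl

@[simp]
theorem rmul_tmul (ω r m : R) : rmul ω (tmul (S := S) r m) = tmul r (m * ω) := rfl

variable (S M) in
/-- The left action as a bilinear map. -/
def lmulHom : R →ₗ[k] BalancedTensor S M →ₗ[k] BalancedTensor S M where
  toFun := lmul
  map_add' x y := by
    ext z
    simp [lmul, LinearMap.rTensor, add_mul, TensorProduct.add_tmul]
  map_smul' c x := by
    ext z
    simp only [lmul, LinearMap.rTensor, TensorProduct.AlgebraTensorModule.curry_apply,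
      LinearMap.restrictScalars_self, TensorProduct.curry_apply, LinearMap.comp_apply,
      Submodule.mkQ_apply, Submodule.mapQ_apply, TensorProduct.map_tmul, LinearMap.mulLeft_apply,
      LinearMap.id_apply, LinearMap.smul_apply, RingHom.id_apply, smul_mul_assoc,
      ← TensorProduct.smul_tmul', Submodule.Quotient.mk_smul]

@[simp]
theorem lmulHom_apply (ω : R) (z : BalancedTensor S M) : lmulHom S M ω z = lmul ω z := rfl

theorem lmul_mul (ω η : R) (z : BalancedTensor S M) : lmul (ω * η) z = lmul ω (lmul η z) := by
  induction z using induction with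
  | zero => simp
  | tmul r m => simp [mul_assoc]
  | add x y hx hy => simp only [map_add, hx, hy]

variable (S) in
/-- The right action as a bilinear map. -/
def rmulHom : R →ₗ[k] BalancedTensor S R →ₗ[k] BalancedTensor S R where
  toFun := rmul
  map_add' x y := by
    ext z
    simp [rmul, LinearMap.lTensor, mul_add, TensorProduct.tmul_add]
  map_smul' c x := by
    ext z
    simp [rmul, LinearMap.lTensor]

theorem lmul_rmul (ω η : R) (z : BalancedTensor S R) : lmul ω (rmul η z) = rmul η (lmul ω z) := by
  induction z using induction with
  | zero => simp
  | tmul r m => simp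
  | add x y hx hy => simp only [map_add, hx, hy]

section CanonicalMap

variable {T : Type*} [Ring T] [Algebra k T] (δ ι : R →ₐ[k] T)

theorem canonicalMap_lmul (r : R) (z : BalancedTensor (AlgHom.equalizer δ ι) R) :
    canonicalMap δ ι (lmul r z) = ι r * canonicalMap δ ι z := by
  induction z using induction with
  | zero => simp
  | tmul r m => simp [canonicalMap_tmul, mul_assoc]
  | add x y hx hy => simp only [map_add, hx, hy, mul_add]

theorem canonicalMap_rmul (r : R) (z : BalancedTensor (AlgHom.equalizer δ ι) R) :
    canonicalMap δ ι (rmul r z) = canonicalMap δ ι z * δ r := by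
  induction z using induction with
  | zero => simp
  | tmul r m => simp [canonicalMap_tmul, mul_assoc]
  | add x y hx hy => simp only [map_add, hx, hy, add_mul]

end CanonicalMap

end BalancedTensor

/-! ### Injectivity of `A ⊗_B M → M ⊗ H` for relative Hopf modules. -/

section Descent

open HopfAlgebra Coalgebra BalancedTensor

variable {k : Type*} [Field k] {H : Type*} [Ring H] [HopfAlgebra k H]
  {A : Type*} [Ring A] [Algebra k A] {δ : A →ₐ[k] A ⊗[k] H}
  {M : Type*} [AddCommGroup M] [Module k M] [Module A M] [IsScalarTower k A M]

theorem IsComoduleAlgebra.isHopfModule (hδ : IsComoduleAlgebra δ) :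
    IsHopfModule δ δ.toLinearMap where
  map_smul a m := by
    have : ∀ z w : A ⊗[k] H, hopfAct k H A A z w = z * w := by
      intro z w
      induction z with
      | zero => simp
      | add x y hx hy => simp only [map_add, LinearMap.add_apply, hx, hy, add_mul]
      | tmul a g =>
        induction w with
        | zero => simp
        | add x y hx hy => simp only [map_add, hx, hy, mul_add]
        | tmul a g => simp
    simp [this]
  coassoc := hδ.coassoc
  counit := hδ.counit

/-- Coassociativity gives `m₀ ⊗ S⁻¹(m₂) m₁`, and `S⁻¹(h₂) h₁ = ε(h)`. -/
theorem twist_antipodeInv (hS : Function.Bijective (antipode k (A := H)))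
    {ρ : M →ₗ[k] M ⊗[k] H} (hρ : IsHopfModule δ ρ) (m : M) :
    twist ρ ((antipodeInv hS).lTensor M (ρ m)) = m ⊗ₜ 1 := by
  let G : H ⊗[k] H →ₗ[k] H := LinearMap.mul' k H ∘ₗ (antipodeInv hS).rTensor H ∘ₗ
    (TensorProduct.comm k H H).toLinearMap
  have h1 : ∀ Z, twist ρ ((antipodeInv hS).lTensor M Z) =
      G.lTensor M (TensorProduct.assoc k M H H (ρ.rTensor H Z)) := by
    intro Z
    induction Z with
    | zero => simp
    | add x y hx hy => simp only [map_add, hx, hy]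
    | tmul x g =>
      simp only [G, LinearMap.lTensor_tmul, LinearMap.rTensor_tmul, twist_tmul]
      induction ρ x with
      | zero => simp
      | add x y hx hy => simp only [TensorProduct.add_tmul, map_add, hx, hy]
      | tmul x y => simp
  have h2 : G ∘ₗ comul = (LinearMap.toSpanSingleton k H 1) ∘ₗ counit := by
    ext x
    simp only [G, LinearMap.comp_apply, LinearEquiv.coe_coe, mul_antipodeInv_comm_comul]
    simp [Algebra.algebraMap_eq_smul_one]
  rw [h1, hρ.coassoc, ← LinearMap.comp_apply, ← LinearMap.lTensor_comp, h2,
    LinearMap.lTensor_comp, LinearMap.comp_apply]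
  conv_rhs => rw [← hρ.counit m]
  induction (counit (R := k)).lTensor M (ρ m) with
  | zero => simp
  | add x y hx hy => simp only [map_add, hx, hy, TensorProduct.add_tmul]
  | tmul x y => simp [TensorProduct.smul_tmul']

theorem twist_hopfAct {ρ : M →ₗ[k] M ⊗[k] H} (hρ : IsHopfModule δ ρ) (W : A ⊗[k] H) (m : M) :
    twist ρ (hopfAct k H A M W (m ⊗ₜ 1)) = hopfAct k H A M (twist δ.toLinearMap W) (ρ m) := by
  induction W with
  | zero => simp
  | add x y hx hy => simp only [map_add, LinearMap.add_apply, hx, hy]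
  | tmul x h =>
    rw [hopfAct_tmul, twist_tmul, twist_tmul, hρ.map_smul, mul_one]
    simp only [AlgHom.toLinearMap_apply]
    induction δ x with
    | zero => simp
    | add x y hx hy => simp only [map_add, LinearMap.add_apply, hx, hy]
    | tmul x g =>
      induction ρ m with
      | zero => simp
      | add x y hx hy => simp only [map_add, hx, hy]
      | tmul x y => simp [mul_assoc]

/-- The translation map as a linear map. -/
def translation (hδ : IsQuantumPrincipalBundle δ) :
    H →ₗ[k] BalancedTensor (coinvariants δ) A :=
  (LinearEquiv.ofBijective (galoisMap δ) hδ.bijective).symm.toLinearMap ∘ₗ TensorProduct.mk k A H 1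

theorem translation_apply (hδ : IsQuantumPrincipalBundle δ) (h : H) :
    translation hδ h = translationMap hδ h := rfl

theorem galoisMap_translation (hδ : IsQuantumPrincipalBundle δ) (h : H) :
    galoisMap δ (translation hδ h) = 1 ⊗ₜ h :=
  (LinearEquiv.ofBijective (galoisMap δ) hδ.bijective).apply_symm_apply _

/-- The map `A ⊗_B A → A ⊗_B M`, `a ⊗ a' ↦ a ⊗ a' m`. -/
def actOn (δ : A →ₐ[k] A ⊗[k] H) (m : M) :
    BalancedTensor (coinvariants δ) A →ₗ[k] BalancedTensor (coinvariants δ) M :=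
  BalancedTensor.map ((LinearMap.toSpanSingleton A M m).restrictScalars (coinvariants δ))

@[simp]
theorem actOn_tmul (m : M) (a a' : A) : actOn δ m (tmul a a') = tmul a (a' • m) := rfl

theorem actOn_smul (m : M) (a : A) (z : BalancedTensor (coinvariants δ) A) :
    actOn δ (a • m) z = actOn δ m (rmul a z) := by
  induction z using induction with
  | zero => simp
  | tmul r m => simp [mul_smul]
  | add x y hx hy => simp only [map_add, hx, hy]

variable (M) in
/-- The map `M ⊗ H → A ⊗_B M`, `m ⊗ h ↦ τ(h) m`. -/
def translate (hδ : IsQuantumPrincipalBundle δ) :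
    M ⊗[k] H →ₗ[k] BalancedTensor (coinvariants δ) M :=
  TensorProduct.lift (LinearMap.mk₂ k (fun m h => actOn δ m (translation hδ h))
    (fun m m' h => by
      induction translation hδ h using induction with
      | zero => simp
      | tmul r m => simp [tmul_add]
      | add x y hx hy => simp only [map_add, hx, hy]; abel)
    (fun c m h => by
      induction translation hδ h using induction with
      | zero => simp
      | tmul r m => rw [actOn_tmul, smul_comm]; exact (BalancedTensor.mk _ _ _).map_smul _ _
      | add x y hx hy => simp only [map_add, hx, hy, smul_add])
    (fun m h h' => by simp)
    (fun c m h => by simp))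

@[simp]
theorem translate_tmul (hδ : IsQuantumPrincipalBundle δ) (m : M) (h : H) :
    translate M hδ (m ⊗ₜ h) = actOn δ m (translation hδ h) := rfl

theorem hopfModuleMap_actOn {ρ : M →ₗ[k] M ⊗[k] H} (hρ : IsHopfModule δ ρ) (m : M)
    (z : BalancedTensor (coinvariants δ) A) :
    hopfModuleMap hρ (actOn δ m z) = hopfAct k H A M (galoisMap δ z) (ρ m) := by
  induction z using induction with
  | zero => simp
  | tmul a a' =>
    rw [actOn_tmul, hopfModuleMap_tmul, hρ.map_smul, ← hopfAct_mul, canonicalMap_tmul]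
    rfl
  | add x y hx hy => simp only [map_add, LinearMap.add_apply, hx, hy]

/-- The legs of `τ(h)` enter only through `χ(τ(h)) = 1 ⊗ h`, which acts on `ρ(m)` by left
multiplication with `h`. -/
theorem hopfModuleMap_translate (hδ : IsQuantumPrincipalBundle δ) {ρ : M →ₗ[k] M ⊗[k] H}
    (hρ : IsHopfModule δ ρ) (z : M ⊗[k] H) :
    hopfModuleMap hρ (translate M hδ z) = twist ρ z := by
  induction z with
  | zero => simp
  | add x y hx hy => simp only [map_add, hx, hy]
  | tmul m h =>
    rw [translate_tmul, hopfModuleMap_actOn, galoisMap_translation, twist_tmul]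
    induction ρ m with
    | zero => simp
    | add x y hx hy => simp only [map_add, hx, hy]
    | tmul x y => simp

theorem hopfAct_antipodeInv_mul (hS : Function.Bijective (antipode k (A := H)))
    (b : A) (Z : A ⊗[k] H) :
    (antipodeInv hS).lTensor A (Z * (b ⊗ₜ 1)) = (antipodeInv hS).lTensor A Z * (b ⊗ₜ 1) := by
  induction Z with
  | zero => simp
  | add x y hx hy => simp only [map_add, add_mul, hx, hy]
  | tmul x y => simp

/-- `∑ τ(S⁻¹(a₁)) a₀ = a ⊗_B 1`. -/
theorem translate_antipodeInv (hS : Function.Bijective (antipode k (A := H)))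
    (hδ : IsQuantumPrincipalBundle δ) (a : A) :
    translate A hδ ((antipodeInv hS).lTensor A (δ a)) = tmul a 1 := by
  apply hδ.bijective.1
  have hA := hδ.comoduleAlgebra.isHopfModule
  -- For `M = A` the Hopf module map is `χ` itself, so the images can be computed with the twist.
  have hc : ∀ z, hopfModuleMap hA z = galoisMap δ z := by
    intro z
    have : z = actOn δ (1 : A) z := by
      induction z using induction with
      | zero => simp
      | tmul a a' => simp
      | add x y hx hy => rw [map_add, ← hx, ← hy]
    conv_lhs => rw [this, hopfModuleMap_actOn]
    simp only [AlgHom.toLinearMap_apply, map_one, Algebra.TensorProduct.one_def]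
    induction galoisMap δ z with
    | zero => simp
    | add x y hx hy => simp only [map_add, LinearMap.add_apply, hx, hy]
    | tmul x y => simp
  rw [← hc, hopfModuleMap_translate, canonicalMap_tmul, map_one, mul_one]
  exact twist_antipodeInv hS hA a

/-- For a relative Hopf module `M`, the map `A ⊗_B M → M ⊗ H` is injective. -/
theorem hopfModuleMap_injective (hS : Function.Bijective (antipode k (A := H)))
    (hδ : IsQuantumPrincipalBundle δ) {ρ : M →ₗ[k] M ⊗[k] H} (hρ : IsHopfModule δ ρ) :
    Function.Injective (hopfModuleMap hρ) := by
  -- `κ(a ⊗ m) = a₀ m ⊗ S⁻¹(a₁)`. It is injective because `translate` is a left inverse, and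
  -- following it with the injective `twist` gives the Hopf module map.
  let κ₀ : A ⊗[k] M →ₗ[k] M ⊗[k] H :=
    TensorProduct.lift (((hopfAct k H A M).compl₂ ((TensorProduct.mk k M H).flip 1)) ∘ₗ
      (antipodeInv hS).lTensor A ∘ₗ δ.toLinearMap)
  let κ : BalancedTensor (coinvariants δ) M →ₗ[k] M ⊗[k] H :=
    Submodule.liftQ _ κ₀ (by
      refine balancedRelations_le _ fun a b m => ?_
      simp only [LinearMap.mem_ker, map_sub, TensorProduct.lift.tmul, LinearMap.comp_apply, κ₀,
        LinearMap.flip_apply, TensorProduct.mk_apply, LinearMap.compl₂_apply,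
        AlgHom.toLinearMap_apply, map_mul, coinvariants_apply, hopfAct_antipodeInv_mul,
        hopfAct_mul, hopfAct_tmul, Subalgebra.smul_def, mul_one, sub_self])
  have hκ : ∀ a m, κ (tmul a m) =
      hopfAct k H A M ((antipodeInv hS).lTensor A (δ a)) (m ⊗ₜ 1) := fun a m => by
    simp [κ, κ₀, tmul]
  have h1 : ∀ z, translate M hδ (κ z) = z := by
    intro z
    induction z using induction with
    | zero => simp
    | add x y hx hy => simp only [map_add, hx, hy]
    | tmul a m =>
      have : ∀ W, translate M hδ (hopfAct k H A M W (m ⊗ₜ 1)) =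
          actOn δ m (translate A hδ W) := by
        intro W
        induction W with
        | zero => simp
        | add x y hx hy => simp only [map_add, LinearMap.add_apply, hx, hy]
        | tmul x h =>
          simp only [hopfAct_tmul, mul_one, translate_tmul, actOn_smul]
          rfl
      rw [hκ, this, translate_antipodeInv]
      simp
  have h2 : ∀ z, twist ρ (κ z) = hopfModuleMap hρ z := by
    intro z
    induction z using induction with
    | zero => simp
    | add x y hx hy => simp only [map_add, hx, hy]
    | tmul a m =>
      rw [hκ, twist_hopfAct hρ, hopfModuleMap_tmul]
      rw [← AlgHom.toLinearMap_apply, twist_antipodeInv hS hδ.comoduleAlgebra.isHopfModule]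
  intro x y hxy
  rw [← h2, ← h2] at hxy
  have := twist_injective hS hρ hxy
  rw [← h1 x, this, h1]

end Descent

/-! ### Consequences of faithful flatness. -/

section FaithfullyFlat

open HopfAlgebra Coalgebra BalancedTensor

variable {k : Type u} [Field k] {A : Type v} [Ring A] [Algebra k A]
  {M : Type v} [AddCommGroup M] [Module k M] {S : Subalgebra k A} [Module S M]
  [IsScalarTower k S M]
  {N : Type v} [AddCommGroup N] [Module k N] [Module S N] [IsScalarTower k S N]

namespace BalancedTensor

theorem map_zero_apply (z : BalancedTensor S M) :
    map (0 : M →ₗ[S] N) z = 0 := by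
  induction z using induction with
  | zero => simp
  | tmul r m => simpa using (BalancedTensor.mk S N r).map_zero
  | add x y hx hy => simp only [map_add, hx, hy, add_zero]

theorem map_map {P : Type v} [AddCommGroup P] [Module k P] [Module S P] [IsScalarTower k S P]
    (g : N →ₗ[S] P) (f : M →ₗ[S] N) (z : BalancedTensor S M) :
    map g (map f z) = map (g ∘ₗ f) z := by
  induction z using induction with
  | zero => simp
  | tmul r m => simp
  | add x y hx hy => simp only [map_add, hx, hy]

end BalancedTensor

/-- A faithfully flat extension is pure: `1 ⊗ n` vanishes only for `n = 0`. -/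
theorem IsRightFaithfullyFlat.eq_zero_of_one_tmul (hS : IsRightFaithfullyFlat S) {n : N}
    (hn : tmul (S := S) 1 n = 0) : n = 0 := by
  -- Flatness embeds `A ⊗ C` in `A ⊗ N`, where its image is generated by `1 ⊗ n = 0`. Thus `A ⊗ C =
  -- 0`, and reflecting exactness of `C → C → C` with zero maps forces `C = 0`.
  let C : Submodule S N := Submodule.span S {n}
  have hmem : n ∈ C := Submodule.mem_span_singleton_self n
  have h1 : Function.Exact (0 : C →ₗ[S] C) C.subtype := by
    intro x
    simp [eq_comm]
  have hi : ∀ z, BalancedTensor.map (R := A) C.subtype z = 0 → z = 0 := by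
    intro z hz
    obtain ⟨w, rfl⟩ := ((hS C C N 0 C.subtype).1 h1 z).1 hz
    exact map_zero_apply w
  have hC : ∀ z : BalancedTensor S C, z = 0 := by
    intro z
    apply hi
    induction z using induction with
    | zero => simp
    | tmul r c =>
      obtain ⟨c, hc⟩ := c
      obtain ⟨s, rfl⟩ := Submodule.mem_span_singleton.1 hc
      have : tmul (S := S) r (s • n) = lmul (r * (s : A)) (tmul 1 n) := by
        rw [lmul_tmul, mul_one, tmul_smul]
      rw [map_tmul, Submodule.subtype_apply, this, hn, map_zero]
    | add x y hx hy => rw [map_add, hx, hy, add_zero]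
  have h2 : Function.Exact (0 : C →ₗ[S] C) (0 : C →ₗ[S] C) :=
    (hS C C C 0 0).2 fun z => ⟨fun _ => ⟨0, by rw [hC z, map_zero]⟩, fun _ => map_zero_apply z⟩
  obtain ⟨w, hw⟩ := (h2 ⟨n, hmem⟩).1 rfl
  exact (congrArg Subtype.val hw).symm

/-- Descent of membership in the range of a linear map along a faithfully flat extension. -/
theorem IsRightFaithfullyFlat.mem_range (hS : IsRightFaithfullyFlat S) (f : M →ₗ[S] N) {n : N}
    (t : BalancedTensor S M) (ht : BalancedTensor.map f t = tmul 1 n) : n ∈ LinearMap.range f := by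
  -- Purity is applied to the class of `n` in the cokernel of `f`.
  let q := (LinearMap.range f).mkQ
  have h1 : tmul (S := S) 1 (q n) = 0 := by
    rw [← map_tmul, ← ht, map_map, LinearMap.range_mkQ_comp f, map_zero_apply]
  have := hS.eq_zero_of_one_tmul h1
  simpa [q] using this

/-- Flatness: an element annihilated by `id ⊗ g` comes from the kernel of `g`. -/
theorem IsRightFaithfullyFlat.exists_of_map_eq_zero (hS : IsRightFaithfullyFlat S)
    (g : M →ₗ[S] N) {t : BalancedTensor S M} (ht : BalancedTensor.map g t = 0) :
    ∃ t' : BalancedTensor S (LinearMap.ker g), BalancedTensor.map (LinearMap.ker g).subtype t' = t :=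
  ((hS _ M N (LinearMap.ker g).subtype g).1 (fun x => by simp) t).1 ht

end FaithfullyFlat

/-! ### The two descent principles for relative Hopf modules. -/

section HopfModuleDescent

open HopfAlgebra Coalgebra BalancedTensor

variable {k : Type u} [Field k] {H : Type v} [Ring H] [HopfAlgebra k H]
  {A : Type v} [Ring A] [Algebra k A] {δ : A →ₐ[k] A ⊗[k] H}
  {M : Type v} [AddCommGroup M] [Module k M]
  {N : Type v} [AddCommGroup N] [Module k N] [Module A N] [IsScalarTower k A N]

theorem counit_hopfModuleMap_tmul {ρ : N →ₗ[k] N ⊗[k] H} (hρ : IsHopfModule δ ρ) (a : A) (n : N) :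
    TensorProduct.rid k N ((counit (R := k)).lTensor N (hopfModuleMap hρ (tmul a n))) = a • n := by
  rw [hopfModuleMap_tmul]
  conv_rhs => rw [← hρ.counit n]
  induction ρ n with
  | zero => simp
  | add x y hx hy => simp only [map_add, hx, hy, smul_add]
  | tmul x y => simp [smul_comm a]

/-- If the image of `t` in `N ⊗ H` agrees with `n ⊗ 1` for a coinvariant `n`, then `n` is in the
range of `f`. -/
theorem mem_range_of_hopfModuleMap (hS : Function.Bijective (antipode k (A := H)))
    (hδ : IsQuantumPrincipalBundle δ) [Module (coinvariants δ) M]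
    [IsScalarTower k (coinvariants δ) M] {ρ : N →ₗ[k] N ⊗[k] H} (hρ : IsHopfModule δ ρ)
    (f : M →ₗ[coinvariants δ] N) {n : N} (hn : ρ n = n ⊗ₜ 1)
    (t : BalancedTensor (coinvariants δ) M)
    (ht : hopfModuleMap hρ (BalancedTensor.map f t) = n ⊗ₜ 1) : n ∈ LinearMap.range f := by
  refine hδ.faithfullyFlat.mem_range f t (hopfModuleMap_injective hS hδ hρ ?_)
  rw [ht, hopfModuleMap_tmul, hn]
  simp

/-- If `m` is the image of a tensor which is annihilated by `id ⊗ g`, then `m` is in `A · ker g`. -/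
theorem mem_span_smul_ker [Module A M] [IsScalarTower k A M]
    (hS : Function.Bijective (antipode k (A := H)))
    (hδ : IsQuantumPrincipalBundle δ) {ρ : M →ₗ[k] M ⊗[k] H} (hρ : IsHopfModule δ ρ)
    {ρN : N →ₗ[k] N ⊗[k] H} (hρN : IsHopfModule δ ρN)
    (g : M →ₗ[coinvariants δ] N) {m : M} (t : BalancedTensor (coinvariants δ) M)
    (ht : hopfModuleMap hρ t = m ⊗ₜ 1) (htg : hopfModuleMap hρN (BalancedTensor.map g t) = 0) :
    m ∈ Submodule.span k {x | ∃ (a : A) (b : M), g b = 0 ∧ x = a • b} := by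
  have h0 : BalancedTensor.map g t = 0 :=
    hopfModuleMap_injective hS hδ hρN (by rw [htg, map_zero])
  obtain ⟨t', rfl⟩ := hδ.faithfullyFlat.exists_of_map_eq_zero g h0
  -- Applying `id ⊗ ε` to the image of `∑ aᵢ ⊗ bᵢ` gives `∑ aᵢ bᵢ`; after flatness has moved the
  -- `bᵢ` into the kernel, this exhibits `m` in the span.
  have hm : m = TensorProduct.rid k M ((counit (R := k)).lTensor M
      (hopfModuleMap hρ (BalancedTensor.map (LinearMap.ker g).subtype t'))) := by
    rw [ht]
    simp
  rw [hm]
  clear hm ht htg h0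
  induction t' using induction with
  | zero => simp
  | tmul a b =>
    rw [map_tmul, counit_hopfModuleMap_tmul]
    exact Submodule.subset_span ⟨a, b, b.2, rfl⟩
  | add x y hx hy =>
    simp only [map_add]
    exact add_mem hx hy

end HopfModuleDescent

/-! ### Sign rules in the graded tensor product. -/

section Graded

open GradedTensorProduct

variable {k : Type*} [Field k]
  {ΩA : Type*} [Ring ΩA] [Algebra k ΩA] {𝒜 : ℕ → Submodule k ΩA} [GradedAlgebra 𝒜]
  {ΩH : Type*} [Ring ΩH] [Algebra k ΩH] {ℋ : ℕ → Submodule k ΩH} [GradedAlgebra ℋ]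

theorem graded_induction (𝒜 : ℕ → Submodule k ΩA) [GradedAlgebra 𝒜] {p : ΩA → Prop} (ω : ΩA)
    (zero : p 0) (homogeneous : ∀ n, ∀ ω ∈ 𝒜 n, p ω) (add : ∀ x y, p x → p y → p (x + y)) : p ω :=
  DirectSum.Decomposition.inductionOn 𝒜 zero (fun x => homogeneous _ _ x.2) add ω

theorem linearMap_ext_graded (𝒜 : ℕ → Submodule k ΩA) [GradedAlgebra 𝒜]
    {V : Type*} [AddCommGroup V] [Module k V] {f g : ΩA →ₗ[k] V}
    (h : ∀ n, ∀ ω ∈ 𝒜 n, f ω = g ω) : f = g := by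
  ext ω
  induction ω using graded_induction 𝒜 with
  | zero => simp
  | homogeneous n ω hω => exact h n ω hω
  | add x y hx hy => simp [hx, hy]

theorem tmul_mul_tmul_of_mem (ω : ΩA) {θ : ΩH} {η : ΩA} (θ' : ΩH) {i j : ℕ} (hθ : θ ∈ ℋ j)
    (hη : η ∈ 𝒜 i) : (tmul k ω θ * tmul k η θ' : 𝒜 ᵍ⊗[k] ℋ) =
      (-1 : k) ^ (j * i) • tmul k (ω * η) (θ * θ') := by
  have := tmul_coe_mul_coe_tmul (R := k) 𝒜 ℋ ω ⟨θ, hθ⟩ ⟨η, hη⟩ θ'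
  rw [this, Units.smul_def, ← Int.cast_smul_eq_zsmul k]
  simp

theorem tmul_mul_tmul_left_zero (ω : ΩA) (θ : ΩH) {η : ΩA} (θ' : ΩH) (hη : η ∈ 𝒜 0) :
    (tmul k ω θ * tmul k η θ' : 𝒜 ᵍ⊗[k] ℋ) = tmul k (ω * η) (θ * θ') := by
  induction θ using graded_induction ℋ with
  | zero => simp [tmul]
  | homogeneous n θ hθ => rw [tmul_mul_tmul_of_mem ω θ' hθ hη]; simp
  | add x y hx hy => simp only [tmul, TensorProduct.tmul_add, map_add, add_mul] at *; rw [hx, hy]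

theorem tmul_mul_tmul_right_zero (ω : ΩA) {θ : ΩH} (η : ΩA) (θ' : ΩH) (hθ : θ ∈ ℋ 0) :
    (tmul k ω θ * tmul k η θ' : 𝒜 ᵍ⊗[k] ℋ) = tmul k (ω * η) (θ * θ') := by
  induction η using graded_induction 𝒜 with
  | zero => simp [tmul]
  | homogeneous n η hη => rw [tmul_mul_tmul_of_mem ω θ' hθ hη]; simp
  | add x y hx hy =>
    simp only [tmul, TensorProduct.add_tmul, map_add, mul_add] at *; rw [hx, hy]

theorem tmul_mul_tmul_left_one (ω : ΩA) (θ : ΩH) {η : ΩA} (θ' : ΩH) (hη : η ∈ 𝒜 1) :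
    (tmul k ω θ * tmul k η θ' : 𝒜 ᵍ⊗[k] ℋ) =
      tmul k (ω * η) (gradingInvolution ℋ θ * θ') := by
  induction θ using graded_induction ℋ with
  | zero => simp [tmul]
  | homogeneous n θ hθ =>
    rw [tmul_mul_tmul_of_mem ω θ' hθ hη, gradingInvolution_apply hθ]; simp [tmul]
  | add x y hx hy =>
    simp only [tmul, TensorProduct.tmul_add, map_add, add_mul] at *; rw [hx, hy]

end Graded

/-! ### Induction over a calculus and projection to degree zero. -/

section CalculusGeneration

variable {k : Type*} [Field k] {A : Type*} [Ring A] [Algebra k A]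
  {Ω : Type*} [Ring Ω] [Algebra k Ω] {𝒜 : ℕ → Submodule k Ω} [GradedAlgebra 𝒜]
  (C : DifferentialCalculus k A 𝒜)

namespace DifferentialCalculus

theorem incl_mem (a : A) : C.incl a ∈ 𝒜 0 := by
  rw [← C.range_incl]
  exact ⟨a, rfl⟩

theorem exists_incl {ω : Ω} (hω : ω ∈ 𝒜 0) : ∃ a, C.incl a = ω := by
  rw [← C.range_incl] at hω
  exact hω

theorem d_incl_mem (a : A) : C.d (C.incl a) ∈ 𝒜 1 := C.d_mem 0 _ (C.incl_mem a)

theorem mul_d_mem {n : ℕ} {ω : Ω} (hω : ω ∈ 𝒜 n) (a : A) : ω * C.d (C.incl a) ∈ 𝒜 (n + 1) :=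
  SetLike.mul_mem_graded hω (C.d_incl_mem a)

theorem d_one : C.d 1 = 0 := by
  have := C.leibniz 0 1 1 (SetLike.one_mem_graded 𝒜)
  simpa using this

/-- A calculus is generated by `A` under right multiplication with exact one-forms. -/
theorem induction_mem {P : ℕ → Submodule k Ω} (incl : ∀ a, C.incl a ∈ P 0)
    (mul_d : ∀ n ω a, ω ∈ 𝒜 n → ω ∈ P n → ω * C.d (C.incl a) ∈ P (n + 1)) (n : ℕ) :
    𝒜 n ≤ P n := by
  rcases Nat.eq_zero_or_pos n with rfl | hn
  · rintro ω hω
    obtain ⟨a, rfl⟩ := C.exists_incl hω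
    exact incl a
  rw [C.generated n hn, Submodule.span_le]
  rintro _ ⟨a₀, a, rfl⟩
  have : ∀ (n : ℕ) (a : Fin n → A), C.incl a₀ * (List.ofFn fun i => C.d (C.incl (a i))).prod ∈ 𝒜 n ∧
      C.incl a₀ * (List.ofFn fun i => C.d (C.incl (a i))).prod ∈ P n := by
    intro n
    induction n with
    | zero => intro a; simpa using ⟨C.incl_mem a₀, incl a₀⟩
    | succ n ih =>
      intro a
      have h := ih (fun i => a i.castSucc)
      rw [List.ofFn_succ', List.prod_concat, ← mul_assoc]
      exact ⟨C.mul_d_mem h.1 _, mul_d n _ _ h.1 h.2⟩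
  exact (this n a).2

theorem linearMap_ext {V : Type*} [AddCommGroup V] [Module k V] {f g : Ω →ₗ[k] V}
    (incl : ∀ a, f (C.incl a) = g (C.incl a))
    (mul_d : ∀ ω a, f ω = g ω → f (ω * C.d (C.incl a)) = g (ω * C.d (C.incl a))) : f = g := by
  refine linearMap_ext_graded 𝒜 fun n ω hω => ?_
  exact C.induction_mem (P := fun _ => LinearMap.eqLocus f g) incl
    (fun n ω a _ h => mul_d ω a h) n hω

/-- The projection of a calculus onto its degree zero part. -/
def π : Ω →ₗ[k] A :=
  (LinearEquiv.ofInjective C.incl.toLinearMap C.incl_injective).symm.toLinearMap ∘ₗ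
    (GradedAlgebra.proj 𝒜 0).codRestrict (LinearMap.range C.incl.toLinearMap)
      (fun ω => by rw [C.range_incl]; exact SetLike.coe_mem _)

theorem incl_π (ω : Ω) : C.incl (C.π ω) = GradedAlgebra.proj 𝒜 0 ω := by
  have := LinearEquiv.apply_symm_apply (LinearEquiv.ofInjective C.incl.toLinearMap C.incl_injective)
    ((GradedAlgebra.proj 𝒜 0).codRestrict (LinearMap.range C.incl.toLinearMap)
      (fun ω => by rw [C.range_incl]; exact SetLike.coe_mem _) ω)
  exact congrArg Subtype.val this

@[simp]
theorem π_incl (a : A) : C.π (C.incl a) = a := by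
  apply C.incl_injective
  rw [incl_π, GradedAlgebra.proj_apply, DirectSum.decompose_of_mem_same 𝒜 (C.incl_mem a)]

theorem π_of_mem {n : ℕ} (hn : n ≠ 0) {ω : Ω} (hω : ω ∈ 𝒜 n) : C.π ω = 0 := by
  apply C.incl_injective
  rw [incl_π, GradedAlgebra.proj_apply, DirectSum.decompose_of_mem_ne 𝒜 hω hn, map_zero]

theorem π_incl_mul (a : A) (ω : Ω) : C.π (C.incl a * ω) = a * C.π ω := by
  induction ω using graded_induction 𝒜 with
  | zero => simp
  | homogeneous n ω hω =>
    rcases eq_or_ne n 0 with rfl | hn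
    · obtain ⟨b, rfl⟩ := C.exists_incl hω
      rw [← map_mul, π_incl, π_incl]
    · have := SetLike.mul_mem_graded (C.incl_mem a) hω
      rw [zero_add] at this
      rw [C.π_of_mem hn hω, C.π_of_mem hn this, mul_zero]
  | add x y hx hy => simp only [mul_add, map_add, hx, hy]

theorem π_mul_incl (a : A) (ω : Ω) : C.π (ω * C.incl a) = C.π ω * a := by
  induction ω using graded_induction 𝒜 with
  | zero => simp
  | homogeneous n ω hω =>
    rcases eq_or_ne n 0 with rfl | hn
    · obtain ⟨b, rfl⟩ := C.exists_incl hω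
      rw [← map_mul, π_incl, π_incl]
    · have := SetLike.mul_mem_graded hω (C.incl_mem a)
      rw [add_zero] at this
      rw [C.π_of_mem hn hω, C.π_of_mem hn this, zero_mul]
  | add x y hx hy => simp only [add_mul, map_add, hx, hy]

theorem π_mul_d (ω : Ω) (a : A) : C.π (ω * C.d (C.incl a)) = 0 := by
  induction ω using graded_induction 𝒜 with
  | zero => simp
  | homogeneous n ω hω => exact C.π_of_mem (Nat.succ_ne_zero n) (C.mul_d_mem hω a)
  | add x y hx hy => simp only [add_mul, map_add, hx, hy, add_zero]

theorem π_gradingInvolution (ω : Ω) : C.π (gradingInvolution 𝒜 ω) = C.π ω := by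
  induction ω using graded_induction 𝒜 with
  | zero => simp
  | homogeneous n ω hω =>
    rw [gradingInvolution_apply hω]
    rcases eq_or_ne n 0 with rfl | hn
    · simp
    · rw [map_smul, C.π_of_mem hn hω, smul_zero]
  | add x y hx hy => simp only [map_add, hx, hy]

end DifferentialCalculus

end CalculusGeneration

namespace DifferentialCalculus

variable {k : Type*} [Field k] {A : Type*} [Ring A] [Algebra k A]
  {Ω : Type*} [Ring Ω] [Algebra k Ω] {𝒜 : ℕ → Submodule k Ω} [GradedAlgebra 𝒜]
  (C : DifferentialCalculus k A 𝒜)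

/-- `a ↦ (ω ↦ a ω)`. -/
def leftMul : A →ₗ[k] Ω →ₗ[k] Ω := LinearMap.mul k Ω ∘ₗ C.incl.toLinearMap

/-- `a ↦ (ω ↦ ω a)`. -/
def rightMul : A →ₗ[k] Ω →ₗ[k] Ω := (LinearMap.mul k Ω).flip ∘ₗ C.incl.toLinearMap

/-- `a ↦ (ω ↦ ω da)`. -/
def rightMulD : A →ₗ[k] Ω →ₗ[k] Ω := (LinearMap.mul k Ω).flip ∘ₗ C.d ∘ₗ C.incl.toLinearMap

/-- `a ↦ (ω ↦ (-1)^|ω| ω a)`. -/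
def rightMulSigned : A →ₗ[k] Ω →ₗ[k] Ω := C.rightMul.compl₂ (gradingInvolution 𝒜)

@[simp]
theorem leftMul_apply (a : A) (ω : Ω) : C.leftMul a ω = C.incl a * ω := rfl

@[simp]
theorem rightMul_apply (a : A) (ω : Ω) : C.rightMul a ω = ω * C.incl a := rfl

@[simp]
theorem rightMulD_apply (a : A) (ω : Ω) : C.rightMulD a ω = ω * C.d (C.incl a) := rfl

end DifferentialCalculus

/-! ### The coaction on forms and its coassociativity. -/

section Coaction

open GradedTensorProduct TensorProduct

variable {k : Type*} [Field k] {A : Type*} [Ring A] [Algebra k A]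
  {H : Type*} [Ring H] [HopfAlgebra k H]
  {ΩA : Type*} [Ring ΩA] [Algebra k ΩA] {𝒜 : ℕ → Submodule k ΩA} [GradedAlgebra 𝒜]
  {ΩH : Type*} [Ring ΩH] [Algebra k ΩH] {ℋ : ℕ → Submodule k ΩH} [GradedAlgebra ℋ]
  (CA : DifferentialCalculus k A 𝒜) (CH : DifferentialCalculus k H ℋ)

/-- The linear map `Ω(A) → Ω(A) ⊗ Ω(H)` underlying an algebra map to the graded tensor product. -/
def coaction (Δ : ΩA →ₐ[k] 𝒜 ᵍ⊗[k] ℋ) : ΩA →ₗ[k] ΩA ⊗[k] ΩH :=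
  (of k 𝒜 ℋ).symm.toLinearMap ∘ₗ Δ.toLinearMap

theorem of_coaction (Δ : ΩA →ₐ[k] 𝒜 ᵍ⊗[k] ℋ) (ω : ΩA) : of k 𝒜 ℋ (coaction Δ ω) = Δ ω := rfl

/-- Right multiplication with elements of `A ⊗ H`. -/
def tensorRightMul : A ⊗[k] H →ₗ[k] ΩA ⊗[k] ΩH →ₗ[k] ΩA ⊗[k] ΩH :=
  TensorProduct.map₂ CA.rightMul CH.rightMul

/-- Right multiplication with differentials of elements of `A ⊗ H`. -/
def tensorRightMulD : A ⊗[k] H →ₗ[k] ΩA ⊗[k] ΩH →ₗ[k] ΩA ⊗[k] ΩH :=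
  TensorProduct.map₂ CA.rightMulD CH.rightMulSigned + TensorProduct.map₂ CA.rightMul CH.rightMulD

/-- Left multiplication with elements of `A ⊗ H`. -/
def tensorLeftMul : A ⊗[k] H →ₗ[k] ΩA ⊗[k] ΩH →ₗ[k] ΩA ⊗[k] ΩH :=
  TensorProduct.map₂ CA.leftMul CH.leftMul

@[simp]
theorem tensorRightMul_tmul (a : A) (h : H) (ω : ΩA) (θ : ΩH) :
    tensorRightMul CA CH (a ⊗ₜ h) (ω ⊗ₜ θ) = (ω * CA.incl a) ⊗ₜ (θ * CH.incl h) := rfl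

@[simp]
theorem tensorRightMulD_tmul (a : A) (h : H) (ω : ΩA) (θ : ΩH) :
    tensorRightMulD CA CH (a ⊗ₜ h) (ω ⊗ₜ θ) =
      (ω * CA.d (CA.incl a)) ⊗ₜ (gradingInvolution ℋ θ * CH.incl h) +
        (ω * CA.incl a) ⊗ₜ (θ * CH.d (CH.incl h)) := rfl

@[simp]
theorem tensorLeftMul_tmul (a : A) (h : H) (ω : ΩA) (θ : ΩH) :
    tensorLeftMul CA CH (a ⊗ₜ h) (ω ⊗ₜ θ) = (CA.incl a * ω) ⊗ₜ (CH.incl h * θ) := rfl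

theorem of_mul_incl (X : ΩA ⊗[k] ΩH) (Z : A ⊗[k] H) :
    of k 𝒜 ℋ X * of k 𝒜 ℋ (map CA.incl.toLinearMap CH.incl.toLinearMap Z) =
      of k 𝒜 ℋ (tensorRightMul CA CH Z X) := by
  induction Z with
  | zero => simp
  | add x y hx hy => simp only [map_add, LinearMap.add_apply, mul_add, hx, hy]
  | tmul a h =>
    induction X with
    | zero => simp
    | add x y hx hy => simp only [map_add, add_mul, hx, hy]
    | tmul ω θ => exact tmul_mul_tmul_left_zero ω θ _ (CA.incl_mem a)

theorem incl_mul_of (X : ΩA ⊗[k] ΩH) (Z : A ⊗[k] H) :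
    of k 𝒜 ℋ (map CA.incl.toLinearMap CH.incl.toLinearMap Z) * of k 𝒜 ℋ X =
      of k 𝒜 ℋ (tensorLeftMul CA CH Z X) := by
  induction Z with
  | zero => simp
  | add x y hx hy => simp only [map_add, LinearMap.add_apply, add_mul, hx, hy]
  | tmul a h =>
    induction X with
    | zero => simp
    | add x y hx hy => simp only [map_add, mul_add, hx, hy]
    | tmul ω θ => exact tmul_mul_tmul_right_zero _ ω θ (CH.incl_mem h)

theorem of_mul_d_incl (X : ΩA ⊗[k] ΩH) (Z : A ⊗[k] H) :
    of k 𝒜 ℋ X * tensorD CA CH (of k 𝒜 ℋ (map CA.incl.toLinearMap CH.incl.toLinearMap Z)) =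
      of k 𝒜 ℋ (tensorRightMulD CA CH Z X) := by
  induction Z with
  | zero => simp
  | add x y hx hy => simp only [map_add, LinearMap.add_apply, mul_add, hx, hy]
  | tmul a h =>
    induction X with
    | zero => simp
    | add x y hx hy => simp only [map_add, add_mul, hx, hy]
    | tmul ω θ =>
      have h1 := tensorD_tmul CA CH (CA.incl_mem a) (CH.incl h)
      rw [pow_zero, one_smul] at h1
      rw [map_tmul]
      refine (congrArg (of k 𝒜 ℋ (ω ⊗ₜ θ) * ·) h1).trans ?_
      simp only [mul_add]
      rw [tmul_mul_tmul_left_one ω θ _ (CA.d_incl_mem a),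
        tmul_mul_tmul_left_zero ω θ _ (CA.incl_mem a)]
      simp

variable {CA CH} {δ : A →ₐ[k] A ⊗[k] H} {Δ : ΩA →ₐ[k] 𝒜 ᵍ⊗[k] ℋ}

namespace IsDGAExtension

theorem coaction_incl (hΔ : IsDGAExtension CA CH δ Δ) (a : A) :
    coaction Δ (CA.incl a) = map CA.incl.toLinearMap CH.incl.toLinearMap (δ a) :=
  hΔ.map_incl a

theorem coaction_mul_incl (hΔ : IsDGAExtension CA CH δ Δ) (ω : ΩA) (a : A) :
    coaction Δ (ω * CA.incl a) = tensorRightMul CA CH (δ a) (coaction Δ ω) := by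
  apply (of k 𝒜 ℋ).injective
  rw [of_coaction, map_mul, hΔ.map_incl, ← of_mul_incl, of_coaction]

theorem coaction_incl_mul (hΔ : IsDGAExtension CA CH δ Δ) (a : A) (ω : ΩA) :
    coaction Δ (CA.incl a * ω) = tensorLeftMul CA CH (δ a) (coaction Δ ω) := by
  apply (of k 𝒜 ℋ).injective
  rw [of_coaction, map_mul, hΔ.map_incl, ← incl_mul_of, of_coaction]

theorem coaction_mul_d (hΔ : IsDGAExtension CA CH δ Δ) (ω : ΩA) (a : A) :
    coaction Δ (ω * CA.d (CA.incl a)) = tensorRightMulD CA CH (δ a) (coaction Δ ω) := by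
  apply (of k 𝒜 ℋ).injective
  rw [of_coaction, map_mul, hΔ.map_d, hΔ.map_incl, ← of_mul_d_incl, of_coaction]

/-- Linear maps which agree on the degree `n` part of `Ω(A) ⊗ Ω(H)` agree on the coaction of
`n`-forms. -/
theorem eq_on_coaction (hΔ : IsDGAExtension CA CH δ Δ) {V : Type*} [AddCommGroup V] [Module k V]
    {f g : ΩA ⊗[k] ΩH →ₗ[k] V} {n : ℕ}
    (h : ∀ r s ω θ, r + s = n → ω ∈ 𝒜 r → θ ∈ ℋ s → f (ω ⊗ₜ θ) = g (ω ⊗ₜ θ))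
    {ω : ΩA} (hω : ω ∈ 𝒜 n) : f (coaction Δ ω) = g (coaction Δ ω) := by
  have h1 : tensorDegree 𝒜 ℋ n ≤ LinearMap.eqLocus (f ∘ₗ (of k 𝒜 ℋ).symm.toLinearMap)
      (g ∘ₗ (of k 𝒜 ℋ).symm.toLinearMap) := by
    refine Submodule.span_le.2 ?_
    rintro _ ⟨r, s, ω, θ, hn, hω, hθ, rfl⟩
    exact h r s ω θ hn hω hθ
  exact h1 (hΔ.map_degree n ω hω)

/-- The coaction preserves total degree, so `(-1)ⁿ` splits as `(-1)ʳ (-1)ˢ` on a component of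
bidegree `(r, s)`. -/
theorem coaction_gradingInvolution (hΔ : IsDGAExtension CA CH δ Δ) (ω : ΩA) :
    coaction Δ (gradingInvolution 𝒜 ω) =
      map (gradingInvolution 𝒜) (gradingInvolution ℋ) (coaction Δ ω) := by
  have : coaction Δ ∘ₗ gradingInvolution 𝒜 =
      map (gradingInvolution 𝒜) (gradingInvolution ℋ) ∘ₗ coaction Δ := by
    refine linearMap_ext_graded 𝒜 fun n ω hω => ?_
    rw [LinearMap.comp_apply, gradingInvolution_apply hω, map_smul, LinearMap.comp_apply]
    refine hΔ.eq_on_coaction (f := (-1 : k) ^ n • LinearMap.id) ?_ hω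
    intro r s ω θ hn hω hθ
    rw [map_tmul, gradingInvolution_apply hω, gradingInvolution_apply hθ, ← hn, pow_add,
      smul_tmul_smul]
    rfl
  exact LinearMap.congr_fun this ω

end IsDGAExtension

/-- The coaction on forms is coassociative. -/
theorem coaction_coassoc (hδ : IsComoduleAlgebra δ) (hΔ : IsDGAExtension CA CH δ Δ)
    {ΔH : ΩH →ₐ[k] ℋ ᵍ⊗[k] ℋ} (hΔH : IsDGAExtension CH CH (Bialgebra.comulAlgHom k H) ΔH)
    (ω : ΩA) :
    TensorProduct.assoc k ΩA ΩH ΩH ((coaction Δ).rTensor ΩH (coaction Δ ω)) =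
      (coaction ΔH).lTensor ΩA (coaction Δ ω) := by
  let L : ΩA →ₗ[k] ΩA ⊗[k] (ΩH ⊗[k] ΩH) :=
    (TensorProduct.assoc k ΩA ΩH ΩH).toLinearMap ∘ₗ (coaction Δ).rTensor ΩH ∘ₗ coaction Δ
  let R : ΩA →ₗ[k] ΩA ⊗[k] (ΩH ⊗[k] ΩH) := (coaction ΔH).lTensor ΩA ∘ₗ coaction Δ
  -- Right multiplication by the differential of an element of `A ⊗ H ⊗ H`. Replacing `ω` by `ω da`
  -- changes both iterated coactions through `D`, evaluated at the two sides of coassociativity for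
  -- `a`; induction over the calculus then applies.
  let D : A ⊗[k] (H ⊗[k] H) →ₗ[k] ΩA ⊗[k] (ΩH ⊗[k] ΩH) →ₗ[k] ΩA ⊗[k] (ΩH ⊗[k] ΩH) :=
    TensorProduct.map₂ CA.rightMulD ((tensorRightMul CH CH).compl₂
      (map (gradingInvolution ℋ) (gradingInvolution ℋ))) +
    TensorProduct.map₂ CA.rightMul (tensorRightMulD CH CH)
  have hR : ∀ (Z : A ⊗[k] H) (X : ΩA ⊗[k] ΩH),
      (coaction ΔH).lTensor ΩA (tensorRightMulD CA CH Z X) =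
        D ((Coalgebra.comul (R := k)).lTensor A Z) ((coaction ΔH).lTensor ΩA X) := by
    intro Z X
    induction Z with
    | zero => simp
    | add x y hx hy => simp only [map_add, LinearMap.add_apply, hx, hy]
    | tmul a h =>
      induction X with
      | zero => simp
      | add x y hx hy => simp only [map_add, hx, hy]
      | tmul ω θ =>
        simp only [tensorRightMulD_tmul, map_add, LinearMap.lTensor_tmul, D, LinearMap.add_apply,
          hΔH.coaction_mul_incl, hΔH.coaction_mul_d, hΔH.coaction_gradingInvolution]
        rfl
  have hL : ∀ (Z : A ⊗[k] H) (X : ΩA ⊗[k] ΩH),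
      TensorProduct.assoc k ΩA ΩH ΩH ((coaction Δ).rTensor ΩH (tensorRightMulD CA CH Z X)) =
        D (TensorProduct.assoc k A H H (δ.toLinearMap.rTensor H Z))
          (TensorProduct.assoc k ΩA ΩH ΩH ((coaction Δ).rTensor ΩH X)) := by
    intro Z X
    induction Z with
    | zero => simp
    | add x y hx hy => simp only [map_add, LinearMap.add_apply, hx, hy]
    | tmul a h =>
      induction X with
      | zero => simp
      | add x y hx hy => simp only [map_add, hx, hy]
      | tmul ω θ =>
        simp only [tensorRightMulD_tmul, map_add, LinearMap.rTensor_tmul,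
          hΔ.coaction_mul_incl, hΔ.coaction_mul_d, AlgHom.toLinearMap_apply]
        induction δ a with
        | zero => simp
        | add x y hx hy =>
          simp only [map_add, LinearMap.add_apply, TensorProduct.add_tmul, ← hx, ← hy]
          abel
        | tmul a' h' =>
          induction coaction Δ ω with
          | zero => simp
          | add x y hx hy =>
            simp only [map_add, TensorProduct.add_tmul, ← hx, ← hy]
            abel
          | tmul ω' θ' =>
            simp only [tensorRightMulD_tmul, tensorRightMul_tmul, TensorProduct.add_tmul, map_add,
              assoc_tmul, D, LinearMap.add_apply, map₂_apply_tmul, LinearMap.compl₂_apply, map_tmul,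
              DifferentialCalculus.rightMulD_apply, DifferentialCalculus.rightMul_apply,
              TensorProduct.tmul_add]
            abel
  have key : L = R := by
    refine CA.linearMap_ext (fun a => ?_) (fun ω a h => ?_)
    · have h1 : ∀ Z : A ⊗[k] H, TensorProduct.assoc k ΩA ΩH ΩH ((coaction Δ).rTensor ΩH
          (map CA.incl.toLinearMap CH.incl.toLinearMap Z)) =
          map CA.incl.toLinearMap (map CH.incl.toLinearMap CH.incl.toLinearMap)
            (TensorProduct.assoc k A H H (δ.toLinearMap.rTensor H Z)) := by
        intro Z
        induction Z with
        | zero => simp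
        | add x y hx hy => simp only [map_add, hx, hy]
        | tmul x h =>
          simp only [map_tmul, LinearMap.rTensor_tmul, AlgHom.toLinearMap_apply, hΔ.coaction_incl]
          induction δ x with
          | zero => simp
          | add x y hx hy => simp only [map_add, TensorProduct.add_tmul, hx, hy]
          | tmul x y => simp
      have h2 : ∀ Z : A ⊗[k] H, (coaction ΔH).lTensor ΩA
          (map CA.incl.toLinearMap CH.incl.toLinearMap Z) =
          map CA.incl.toLinearMap (map CH.incl.toLinearMap CH.incl.toLinearMap)
            ((Coalgebra.comul (R := k)).lTensor A Z) := by
        intro Z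
        induction Z with
        | zero => simp
        | add x y hx hy => simp only [map_add, hx, hy]
        | tmul x h =>
          simp only [map_tmul, LinearMap.lTensor_tmul, AlgHom.toLinearMap_apply,
            hΔH.coaction_incl]
          rfl
      simp only [L, R, LinearMap.comp_apply, LinearEquiv.coe_coe, hΔ.coaction_incl, h1, h2,
        hδ.coassoc]
    · have h' : TensorProduct.assoc k ΩA ΩH ΩH ((coaction Δ).rTensor ΩH (coaction Δ ω)) =
        (coaction ΔH).lTensor ΩA (coaction Δ ω) := h
      simp only [L, R, LinearMap.comp_apply, LinearEquiv.coe_coe, hΔ.coaction_mul_d, hL, hR, h',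
        hδ.coassoc]
  exact LinearMap.congr_fun key ω

end Coaction

section TensorLemmas

variable {k : Type*} [Field k] {M N P M' N' P' : Type*}
  [AddCommGroup M] [Module k M] [AddCommGroup N] [Module k N] [AddCommGroup P] [Module k P]
  [AddCommGroup M'] [Module k M'] [AddCommGroup N'] [Module k N'] [AddCommGroup P'] [Module k P']

theorem map_map_assoc_apply (f : M →ₗ[k] M') (g : N →ₗ[k] N') (h : P →ₗ[k] P')
    (x : (M ⊗[k] N) ⊗[k] P) :
    TensorProduct.map f (TensorProduct.map g h) (TensorProduct.assoc k M N P x) =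
      TensorProduct.assoc k M' N' P' (TensorProduct.map (TensorProduct.map f g) h x) := by
  have : TensorProduct.map f (TensorProduct.map g h) ∘ₗ (TensorProduct.assoc k M N P).toLinearMap =
      (TensorProduct.assoc k M' N' P').toLinearMap ∘ₗ
        TensorProduct.map (TensorProduct.map f g) h := by
    ext x y z
    simp
  exact LinearMap.congr_fun this x

end TensorLemmas

/-! ### Relative Hopf modules with an inert tensor factor. -/

section HopfModuleTensor

open Coalgebra

variable {k : Type*} [Field k] {H : Type*} [Ring H] [HopfAlgebra k H]
  {A : Type*} [Ring A] [Algebra k A] {δ : A →ₐ[k] A ⊗[k] H}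
  {M : Type*} [AddCommGroup M] [Module k M] [Module A M] [IsScalarTower k A M]
  (V : Type*) [AddCommGroup V] [Module k V]

/-- The coaction `m ⊗ v ↦ m₀ ⊗ v ⊗ m₁` on `M ⊗ V`. -/
def tensorCoaction (ρ : M →ₗ[k] M ⊗[k] H) : M ⊗[k] V →ₗ[k] (M ⊗[k] V) ⊗[k] H :=
  (TensorProduct.rightComm k M H V).toLinearMap ∘ₗ ρ.rTensor V

@[simp]
theorem tensorCoaction_tmul (ρ : M →ₗ[k] M ⊗[k] H) (m : M) (v : V) :
    tensorCoaction V ρ (m ⊗ₜ v) = TensorProduct.rightComm k M H V (ρ m ⊗ₜ v) := rfl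

theorem hopfAct_rightComm (z : A ⊗[k] H) (w : M ⊗[k] H) (v : V) :
    hopfAct k H A (M ⊗[k] V) z (TensorProduct.rightComm k M H V (w ⊗ₜ v)) =
      TensorProduct.rightComm k M H V (hopfAct k H A M z w ⊗ₜ v) := by
  induction z with
  | zero => simp
  | add x y hx hy => simp only [map_add, LinearMap.add_apply, TensorProduct.add_tmul, hx, hy]
  | tmul a g =>
    induction w with
    | zero => simp
    | add x y hx hy => simp only [map_add, TensorProduct.add_tmul, hx, hy]
    | tmul m h => simp [TensorProduct.smul_tmul']

/-- `V` carries neither action nor coaction. The case `V = Ω(H)` makes descent available for maps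
with values in `Ω(A) ⊗ Ω(H)`. -/
theorem IsHopfModule.tensor {ρ : M →ₗ[k] M ⊗[k] H} (hρ : IsHopfModule δ ρ) :
    IsHopfModule δ (tensorCoaction V ρ) where
  map_smul a m := by
    induction m with
    | zero => simp
    | add x y hx hy => simp only [smul_add, map_add, hx, hy]
    | tmul m v =>
      rw [TensorProduct.smul_tmul', tensorCoaction_tmul, tensorCoaction_tmul, hρ.map_smul,
        hopfAct_rightComm]
  coassoc m := by
    induction m with
    | zero => simp
    | add x y hx hy => simp only [map_add, hx, hy]
    | tmul m v =>
      have h1 : ∀ Z : M ⊗[k] H, TensorProduct.assoc k (M ⊗[k] V) H H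
          ((tensorCoaction V ρ).rTensor H (TensorProduct.rightComm k M H V (Z ⊗ₜ v))) =
          TensorProduct.rightComm k M (H ⊗[k] H) V
            (TensorProduct.assoc k M H H (ρ.rTensor H Z) ⊗ₜ v) := by
        intro Z
        induction Z with
        | zero => simp
        | add x y hx hy => simp only [map_add, TensorProduct.add_tmul, hx, hy]
        | tmul x h =>
          simp only [TensorProduct.rightComm_tmul, LinearMap.rTensor_tmul, tensorCoaction_tmul]
          induction ρ x with
          | zero => simp
          | add x y hx hy => simp only [map_add, TensorProduct.add_tmul, hx, hy]
          | tmul x y => simp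
      have h2 : ∀ Z : M ⊗[k] H, (comul (R := k)).lTensor (M ⊗[k] V)
          (TensorProduct.rightComm k M H V (Z ⊗ₜ v)) =
          TensorProduct.rightComm k M (H ⊗[k] H) V ((comul (R := k)).lTensor M Z ⊗ₜ v) := by
        intro Z
        induction Z with
        | zero => simp
        | add x y hx hy => simp only [map_add, TensorProduct.add_tmul, hx, hy]
        | tmul x h => simp
      rw [tensorCoaction_tmul, h1, h2, hρ.coassoc]
  counit m := by
    induction m with
    | zero => simp
    | add x y hx hy => simp only [map_add, hx, hy]
    | tmul m v =>
      rw [tensorCoaction_tmul]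
      conv_rhs => rw [← hρ.counit m]
      induction ρ m with
      | zero => simp
      | add x y hx hy => simp only [map_add, TensorProduct.add_tmul, hx, hy]
      | tmul x h => simp [TensorProduct.smul_tmul']

theorem hopfModuleMap_tensor {ρ : M →ₗ[k] M ⊗[k] H} (hρ : IsHopfModule δ ρ) (a : A) (m : M)
    (v : V) : hopfModuleMap (hρ.tensor V) (BalancedTensor.tmul a (m ⊗ₜ v)) =
      TensorProduct.rightComm k M H V (hopfModuleMap hρ (BalancedTensor.tmul a m) ⊗ₜ v) := by
  rw [hopfModuleMap_tmul, tensorCoaction_tmul, hopfAct_rightComm, hopfModuleMap_tmul]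

end HopfModuleTensor

/-! ### The `H`-coactions on `Ω(A)` and `Ω(H)`, and left invariant forms. -/

section DegreeZeroCoactions

open GradedTensorProduct TensorProduct Coalgebra HopfAlgebra

variable {k : Type*} [Field k] {A : Type*} [Ring A] [Algebra k A]
  {H : Type*} [Ring H] [HopfAlgebra k H]
  {ΩA : Type*} [Ring ΩA] [Algebra k ΩA] {𝒜 : ℕ → Submodule k ΩA} [GradedAlgebra 𝒜]
  {ΩH : Type*} [Ring ΩH] [Algebra k ΩH] {ℋ : ℕ → Submodule k ΩH} [GradedAlgebra ℋ]
  {CA : DifferentialCalculus k A 𝒜} {CH : DifferentialCalculus k H ℋ}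
  {δ : A →ₐ[k] A ⊗[k] H} {Δ : ΩA →ₐ[k] 𝒜 ᵍ⊗[k] ℋ} {ΔH : ΩH →ₐ[k] ℋ ᵍ⊗[k] ℋ}

theorem isComoduleAlgebra_comul : IsComoduleAlgebra (Bialgebra.comulAlgHom k H) where
  coassoc h := coassoc_apply h
  counit h := by simp

variable (CH) in
/-- The `H`-coaction on forms `Ω(A) → Ω(A) ⊗ H`. -/
def hopfCoaction (Δ : ΩA →ₐ[k] 𝒜 ᵍ⊗[k] ℋ) : ΩA →ₗ[k] ΩA ⊗[k] H :=
  CH.π.lTensor ΩA ∘ₗ coaction Δ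

variable (CH) in
/-- The left `H`-coaction on forms `Ω(H) → H ⊗ Ω(H)`. -/
def leftCoaction (ΔH : ΩH →ₐ[k] ℋ ᵍ⊗[k] ℋ) : ΩH →ₗ[k] H ⊗[k] ΩH :=
  CH.π.rTensor ΩH ∘ₗ coaction ΔH

/-- In positive total degree each component has a leg of positive degree, which `π` kills; in degree
zero the coaction is the comultiplication. -/
theorem map_π_π_coaction (hΔH : IsDGAExtension CH CH (Bialgebra.comulAlgHom k H) ΔH) (θ : ΩH) :
    map CH.π CH.π (coaction ΔH θ) = comul (R := k) (CH.π θ) := by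
  have : map CH.π CH.π ∘ₗ coaction ΔH = comul (R := k) ∘ₗ CH.π := by
    refine linearMap_ext_graded ℋ fun n θ hθ => ?_
    rcases eq_or_ne n 0 with rfl | hn
    · obtain ⟨h, rfl⟩ := CH.exists_incl hθ
      rw [LinearMap.comp_apply, hΔH.coaction_incl, LinearMap.comp_apply, CH.π_incl,
        ← LinearMap.comp_apply, ← map_comp]
      have : CH.π ∘ₗ CH.incl.toLinearMap = LinearMap.id := by ext; simp
      rw [this]
      simp
    · rw [LinearMap.comp_apply, LinearMap.comp_apply, CH.π_of_mem hn hθ, map_zero]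
      refine hΔH.eq_on_coaction (f := map CH.π CH.π) (g := 0) (fun r s ω θ hrs hω hθ => ?_) hθ
      rw [map_tmul, LinearMap.zero_apply]
      rcases eq_or_ne r 0 with rfl | hr
      · rw [CH.π_of_mem (by omega) hθ, tmul_zero]
      · rw [CH.π_of_mem hr hω, zero_tmul]
  exact LinearMap.congr_fun this θ

/-- `∑ ρ(ω₀) ⊗ ω₁ = ∑ ω₀ ⊗ Δ_L(ω₁)`. -/
theorem hopfCoaction_cotensor (hδ : IsComoduleAlgebra δ) (hΔ : IsDGAExtension CA CH δ Δ)
    (hΔH : IsDGAExtension CH CH (Bialgebra.comulAlgHom k H) ΔH) (ω : ΩA) :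
    TensorProduct.assoc k ΩA H ΩH ((hopfCoaction CH Δ).rTensor ΩH (coaction Δ ω)) =
      (leftCoaction CH ΔH).lTensor ΩA (coaction Δ ω) := by
  have h := congrArg (map LinearMap.id (map CH.π LinearMap.id)) (coaction_coassoc hδ hΔ hΔH ω)
  rw [map_map_assoc_apply] at h
  have e1 : (hopfCoaction CH Δ).rTensor ΩH =
      map (map LinearMap.id CH.π) LinearMap.id ∘ₗ (coaction Δ).rTensor ΩH :=
    LinearMap.rTensor_comp _ _ _
  have e2 : (leftCoaction CH ΔH).lTensor ΩA =
      map LinearMap.id (map CH.π LinearMap.id) ∘ₗ (coaction ΔH).lTensor ΩA :=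
    LinearMap.lTensor_comp _ _ _
  rw [e1, e2]
  exact h

theorem lTensor_π_rTensor_hopfCoaction (X : ΩA ⊗[k] ΩH) :
    (hopfCoaction CH Δ).rTensor H (CH.π.lTensor ΩA X) =
      CH.π.lTensor (ΩA ⊗[k] H) ((hopfCoaction CH Δ).rTensor ΩH X) := by
  rw [← LinearMap.comp_apply, LinearMap.rTensor_comp_lTensor, ← LinearMap.comp_apply,
    LinearMap.lTensor_comp_rTensor]

theorem lTensor_π_leftCoaction (hΔH : IsDGAExtension CH CH (Bialgebra.comulAlgHom k H) ΔH)
    (θ : ΩH) : CH.π.lTensor H (leftCoaction CH ΔH θ) = comul (R := k) (CH.π θ) := by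
  rw [← map_π_π_coaction hΔH, leftCoaction, LinearMap.comp_apply, ← LinearMap.comp_apply,
    LinearMap.lTensor_comp_rTensor]

/-- The left coaction on `Ω(H)` is coassociative. -/
theorem leftCoaction_coassoc (hΔH : IsDGAExtension CH CH (Bialgebra.comulAlgHom k H) ΔH) (θ : ΩH) :
    TensorProduct.assoc k H H ΩH ((comul (R := k)).rTensor ΩH (leftCoaction CH ΔH θ)) =
      (leftCoaction CH ΔH).lTensor H (leftCoaction CH ΔH θ) := by
  have h := congrArg (map CH.π LinearMap.id)
    (hopfCoaction_cotensor isComoduleAlgebra_comul hΔH hΔH θ)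
  have e1 : ∀ X : ΩH ⊗[k] ΩH, map CH.π LinearMap.id (TensorProduct.assoc k ΩH H ΩH
      ((hopfCoaction CH ΔH).rTensor ΩH X)) =
      TensorProduct.assoc k H H ΩH ((comul (R := k)).rTensor ΩH (CH.π.rTensor ΩH X)) := by
    intro X
    rw [← map_id (R := k) (M := H) (N := ΩH), map_map_assoc_apply]
    congr 1
    induction X with
    | zero => simp
    | add x y hx hy => simp only [map_add, hx, hy]
    | tmul ω θ =>
      simp only [LinearMap.rTensor_tmul, map_tmul, LinearMap.id_apply, hopfCoaction,
        LinearMap.comp_apply, ← map_π_π_coaction hΔH]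
      congr 1
      rw [← LinearMap.comp_apply, LinearMap.lTensor, ← map_comp, LinearMap.id_comp,
        LinearMap.comp_id]
  have e2 : ∀ X : ΩH ⊗[k] ΩH, map CH.π LinearMap.id ((leftCoaction CH ΔH).lTensor ΩH X) =
      (leftCoaction CH ΔH).lTensor H (CH.π.rTensor ΩH X) := by
    intro X
    induction X with
    | zero => simp
    | add x y hx hy => simp only [map_add, hx, hy]
    | tmul ω θ => simp
  rw [e1, e2] at h
  exact h

theorem hopfCoaction_incl (hΔ : IsDGAExtension CA CH δ Δ) (a : A) :
    hopfCoaction CH Δ (CA.incl a) = CA.incl.toLinearMap.rTensor H (δ a) := by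
  rw [hopfCoaction, LinearMap.comp_apply, hΔ.coaction_incl, ← LinearMap.comp_apply,
    LinearMap.lTensor, ← map_comp]
  have : CH.π ∘ₗ CH.incl.toLinearMap = LinearMap.id := by ext; simp
  rw [this]
  rfl

/-- `π` kills the summand containing `dh`, and the sign of the other summand is invisible in degree
zero. -/
theorem hopfCoaction_mul_d (hΔ : IsDGAExtension CA CH δ Δ) (ω : ΩA) (a : A) :
    hopfCoaction CH Δ (ω * CA.d (CA.incl a)) =
      TensorProduct.map₂ CA.rightMulD (LinearMap.mul k H).flip (δ a) (hopfCoaction CH Δ ω) := by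
  rw [hopfCoaction, LinearMap.comp_apply, hΔ.coaction_mul_d, LinearMap.comp_apply]
  induction δ a with
  | zero => simp
  | add x y hx hy => simp only [map_add, LinearMap.add_apply, hx, hy]
  | tmul x h =>
    induction coaction Δ ω with
    | zero => simp
    | add x y hx hy => simp only [map_add, hx, hy]
    | tmul ω θ => simp [CH.π_mul_d, CH.π_mul_incl, CH.π_gradingInvolution]

theorem hopfCoaction_counit (hδ : IsComoduleAlgebra δ) (hΔ : IsDGAExtension CA CH δ Δ) (ω : ΩA) :
    TensorProduct.rid k ΩA ((counit (R := k)).lTensor ΩA (hopfCoaction CH Δ ω)) = ω := by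
  have key : (TensorProduct.rid k ΩA).toLinearMap ∘ₗ (counit (R := k)).lTensor ΩA ∘ₗ
      hopfCoaction CH Δ = LinearMap.id := by
    refine CA.linearMap_ext (fun a => ?_) (fun ω a h => ?_)
    · simp only [LinearMap.comp_apply, LinearEquiv.coe_coe, LinearMap.id_apply,
        hopfCoaction_incl hΔ]
      conv_rhs => rw [← hδ.counit a]
      induction δ a with
      | zero => simp
      | add x y hx hy => simp only [map_add, hx, hy]
      | tmul x h => simp
    · simp only [LinearMap.comp_apply, LinearEquiv.coe_coe, LinearMap.id_apply] at h ⊢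
      rw [hopfCoaction_mul_d hΔ]
      conv_rhs => rw [← h, ← hδ.counit a]
      induction δ a with
      | zero => simp
      | add x y hx hy => simp only [map_add, LinearMap.add_apply, mul_add, hx, hy]
      | tmul x h =>
        induction hopfCoaction CH Δ ω with
        | zero => simp
        | add x y hx hy => simp only [map_add, add_mul, hx, hy]
        | tmul ω g =>
          simp [smul_smul]
          rw [mul_comm]
  exact LinearMap.congr_fun key ω

theorem hopfCoaction_coassoc (hδ : IsComoduleAlgebra δ) (hΔ : IsDGAExtension CA CH δ Δ)
    (hΔH : IsDGAExtension CH CH (Bialgebra.comulAlgHom k H) ΔH) (ω : ΩA) :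
    TensorProduct.assoc k ΩA H H ((hopfCoaction CH Δ).rTensor H (hopfCoaction CH Δ ω)) =
      (comul (R := k)).lTensor ΩA (hopfCoaction CH Δ ω) := by
  have h := congrArg (map LinearMap.id (map LinearMap.id CH.π))
    (hopfCoaction_cotensor hδ hΔ hΔH ω)
  rw [map_map_assoc_apply, map_id] at h
  have h1 : ∀ X : ΩA ⊗[k] ΩH, (comul (R := k)).lTensor ΩA (CH.π.lTensor ΩA X) =
      map LinearMap.id (map LinearMap.id CH.π) ((leftCoaction CH ΔH).lTensor ΩA X) := by
    intro X
    induction X with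
    | zero => simp
    | add x y hx hy => simp only [map_add, hx, hy]
    | tmul ω θ =>
      simp only [LinearMap.lTensor_tmul, map_tmul, LinearMap.id_apply]
      rw [← lTensor_π_leftCoaction hΔH]
      rfl
  conv_lhs => rw [hopfCoaction, LinearMap.comp_apply]
  conv_rhs => rw [hopfCoaction, LinearMap.comp_apply, h1, ← h]
  exact congrArg _ (lTensor_π_rTensor_hopfCoaction (coaction Δ ω))

/-- Forms on `A` are a relative Hopf module. -/
theorem isHopfModule_forms [Module A ΩA] [IsScalarTower k A ΩA]
    (hact : ∀ (a : A) (ω : ΩA), a • ω = CA.incl a * ω)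
    (hδ : IsComoduleAlgebra δ) (hΔ : IsDGAExtension CA CH δ Δ)
    (hΔH : IsDGAExtension CH CH (Bialgebra.comulAlgHom k H) ΔH) :
    IsHopfModule δ (hopfCoaction CH Δ) where
  map_smul a ω := by
    rw [hact, hopfCoaction, LinearMap.comp_apply, hΔ.coaction_incl_mul, LinearMap.comp_apply]
    induction δ a with
    | zero => simp
    | add x y hx hy => simp only [map_add, LinearMap.add_apply, hx, hy]
    | tmul x h =>
      induction coaction Δ ω with
      | zero => simp
      | add x y hx hy => simp only [map_add, hx, hy]
      | tmul ω θ => simp [hact, CH.π_incl_mul]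
  coassoc ω := hopfCoaction_coassoc hδ hΔ hΔH ω
  counit ω := hopfCoaction_counit hδ hΔ ω

theorem leftCoaction_incl_mul (hΔH : IsDGAExtension CH CH (Bialgebra.comulAlgHom k H) ΔH)
    (h : H) (θ : ΩH) : leftCoaction CH ΔH (CH.incl h * θ) =
      TensorProduct.map₂ (LinearMap.mul k H) CH.leftMul (comul (R := k) h)
        (leftCoaction CH ΔH θ) := by
  rw [leftCoaction, LinearMap.comp_apply, hΔH.coaction_incl_mul, LinearMap.comp_apply,
    Bialgebra.comulAlgHom_apply]
  induction comul (R := k) h with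
  | zero => simp
  | add x y hx hy => simp only [map_add, LinearMap.add_apply, hx, hy]
  | tmul x h =>
    induction coaction ΔH θ with
    | zero => simp
    | add x y hx hy => simp only [map_add, hx, hy]
    | tmul ω θ => simp [CH.π_incl_mul]

theorem leftCoaction_mem (hΔH : IsDGAExtension CH CH (Bialgebra.comulAlgHom k H) ΔH) {n : ℕ}
    {θ : ΩH} (hθ : θ ∈ ℋ n) :
    (GradedAlgebra.proj ℋ n).lTensor H (leftCoaction CH ΔH θ) = leftCoaction CH ΔH θ := by
  refine hΔH.eq_on_coaction (f := (GradedAlgebra.proj ℋ n).lTensor H ∘ₗ CH.π.rTensor ΩH)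
    (g := CH.π.rTensor ΩH) (fun r s ω θ hrs hω hs => ?_) hθ
  rcases eq_or_ne r 0 with rfl | hr
  · rw [zero_add] at hrs
    subst hrs
    simp [DirectSum.decompose_of_mem_same ℋ hs]
  · simp [CH.π_of_mem hr hω]

variable (CH) in
/-- The left invariant forms on `H` of degree `n`. -/
def leftInvariant (ΔH : ΩH →ₐ[k] ℋ ᵍ⊗[k] ℋ) (n : ℕ) : Submodule k ΩH :=
  ℋ n ⊓ LinearMap.eqLocus (leftCoaction CH ΔH) (TensorProduct.mk k H ΩH 1)

variable (CH) in
/-- The map `θ ↦ S(θ₋₁) θ₀`, the projection onto left invariant forms. -/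
def invariantProj (ΔH : ΩH →ₐ[k] ℋ ᵍ⊗[k] ℋ) : ΩH →ₗ[k] ΩH :=
  TensorProduct.lift (CH.leftMul ∘ₗ antipode k) ∘ₗ leftCoaction CH ΔH

/-- Since `Δ(S h) = S(h₂) ⊗ S(h₁)`, the coaction of `S(θ₋₁) θ₀` has first leg `S(h₂) h₃` and second
leg `S(h₁) θ₀` with `h = θ₋₁`; the first leg collapses to a counit. -/
theorem leftCoaction_invariantProj (hΔH : IsDGAExtension CH CH (Bialgebra.comulAlgHom k H) ΔH)
    (θ : ΩH) : leftCoaction CH ΔH (invariantProj CH ΔH θ) = 1 ⊗ₜ invariantProj CH ΔH θ := by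
  let Q : H ⊗[k] (H ⊗[k] ΩH) →ₗ[k] H ⊗[k] ΩH := TensorProduct.lift
    (TensorProduct.map₂ (LinearMap.mul k H) CH.leftMul ∘ₗ comul (R := k) ∘ₗ antipode k)
  have h1 : ∀ W : H ⊗[k] ΩH, leftCoaction CH ΔH (TensorProduct.lift (CH.leftMul ∘ₗ antipode k) W) =
      Q ((leftCoaction CH ΔH).lTensor H W) := by
    intro W
    induction W with
    | zero => simp
    | add x y hx hy => simp only [map_add, hx, hy]
    | tmul h θ =>
      simp only [lift.tmul, LinearMap.comp_apply, DifferentialCalculus.leftMul_apply,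
        leftCoaction_incl_mul hΔH, LinearMap.lTensor_tmul, Q]
  have h2 : ∀ W : H ⊗[k] ΩH, Q (TensorProduct.assoc k H H ΩH ((comul (R := k)).rTensor ΩH W)) =
      1 ⊗ₜ TensorProduct.lift (CH.leftMul ∘ₗ antipode k) W := by
    intro W
    induction W with
    | zero => simp
    | add x y hx hy => simp only [map_add, hx, hy, tmul_add]
    | tmul h θ =>
      let E : H ⊗[k] (H ⊗[k] H) →ₗ[k] H ⊗[k] ΩH :=
        (TensorProduct.comm k ΩH H).toLinearMap ∘ₗ
        TensorProduct.map (CH.leftMul.flip θ ∘ₗ antipode k)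
          (LinearMap.mul' k H ∘ₗ (antipode k).rTensor H)
      have h3 : ∀ Z : H ⊗[k] H, Q (TensorProduct.assoc k H H ΩH (Z ⊗ₜ θ)) =
          E (TensorProduct.assoc k H H H ((comul (R := k)).rTensor H Z)) := by
        intro Z
        induction Z with
        | zero => simp
        | add x y hx hy => simp only [map_add, add_tmul, hx, hy]
        | tmul g g' =>
          simp only [assoc_tmul, Q, lift.tmul, LinearMap.comp_apply, comul_antipode,
            LinearMap.rTensor_tmul]
          induction comul (R := k) g with
          | zero => simp
          | add x y hx hy => simp only [map_add, LinearMap.add_apply, add_tmul, hx, hy]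
          | tmul x y => simp [E]
      have h4 : ∀ Z : H ⊗[k] H, E ((comul (R := k)).lTensor H Z) =
          1 ⊗ₜ (CH.incl (antipode k (TensorProduct.rid k H ((counit (R := k)).lTensor H Z))) * θ) := by
        intro Z
        induction Z with
        | zero => simp
        | add x y hx hy => simp only [map_add, add_mul, tmul_add, hx, hy]
        | tmul g g' =>
          simp [E, Algebra.algebraMap_eq_smul_one]
      rw [LinearMap.rTensor_tmul, h3, coassoc_apply, h4]
      simp
  rw [invariantProj, LinearMap.comp_apply, h1, ← leftCoaction_coassoc hΔH, h2]

theorem invariantProj_mem (hΔH : IsDGAExtension CH CH (Bialgebra.comulAlgHom k H) ΔH) {n : ℕ}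
    {θ : ΩH} (hθ : θ ∈ ℋ n) : invariantProj CH ΔH θ ∈ leftInvariant CH ΔH n := by
  refine Submodule.mem_inf.2 ⟨?_, leftCoaction_invariantProj hΔH θ⟩
  rw [invariantProj, LinearMap.comp_apply, ← leftCoaction_mem hΔH hθ]
  induction leftCoaction CH ΔH θ with
  | zero => simp
  | add x y hx hy => simpa only [map_add] using add_mem hx hy
  | tmul h θ =>
    have := SetLike.mul_mem_graded (CH.incl_mem (antipode k h))
      (SetLike.coe_mem (DirectSum.decompose ℋ θ n))
    rw [zero_add] at this
    exact this

variable (CH ΔH) in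
/-- The multiplication `H ⊗ Λⁿ → Ωⁿ(H)`. -/
def invariantMul (n : ℕ) : H ⊗[k] leftInvariant CH ΔH n →ₗ[k] ΩH :=
  TensorProduct.lift (CH.leftMul.compl₂ (leftInvariant CH ΔH n).subtype)

/-- Injective half of the fundamental theorem of Hopf modules. For left invariant `x`, the coaction
of `h x` is `h₁ ⊗ h₂ x`, and `g ⊗ ω ↦ g₁ ⊗ S(g₂) ω` returns `h ⊗ x`. -/
theorem invariantMul_injective (hΔH : IsDGAExtension CH CH (Bialgebra.comulAlgHom k H) ΔH)
    (n : ℕ) : Function.Injective (invariantMul CH ΔH n) := by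
  let J : H ⊗[k] ΩH →ₗ[k] H ⊗[k] ΩH :=
    (TensorProduct.lift (CH.leftMul ∘ₗ antipode k)).lTensor H ∘ₗ
      (TensorProduct.assoc k H H ΩH).toLinearMap ∘ₗ (comul (R := k)).rTensor ΩH
  have h1 : ∀ z, J (leftCoaction CH ΔH (invariantMul CH ΔH n z)) =
      (leftInvariant CH ΔH n).subtype.lTensor H z := by
    intro z
    induction z with
    | zero => simp
    | add x y hx hy => simp only [map_add, hx, hy]
    | tmul h x =>
      obtain ⟨x, hx⟩ := x
      have hx2 : leftCoaction CH ΔH x = 1 ⊗ₜ x := hx.2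
      simp only [invariantMul, lift.tmul, LinearMap.compl₂_apply, Submodule.subtype_apply,
        DifferentialCalculus.leftMul_apply, leftCoaction_incl_mul hΔH, hx2, LinearMap.lTensor_tmul]
      let E : H ⊗[k] (H ⊗[k] H) →ₗ[k] H ⊗[k] ΩH :=
        (CH.leftMul.flip x ∘ₗ LinearMap.mul' k H ∘ₗ (antipode k).rTensor H).lTensor H
      have h3 : ∀ Z : H ⊗[k] H, J (TensorProduct.map₂ (LinearMap.mul k H) CH.leftMul Z (1 ⊗ₜ x)) =
          E (TensorProduct.assoc k H H H ((comul (R := k)).rTensor H Z)) := by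
        intro Z
        induction Z with
        | zero => simp
        | add x y hx hy => simp only [map_add, LinearMap.add_apply, hx, hy]
        | tmul g g' =>
          simp only [J, LinearMap.comp_apply, map₂_apply_tmul, map_tmul, LinearMap.rTensor_tmul,
            LinearMap.mul_apply', mul_one, LinearEquiv.coe_coe]
          induction comul (R := k) g with
          | zero => simp
          | add x y hx hy => simp only [map_add, add_tmul, hx, hy]
          | tmul x y => simp [E, mul_assoc]
      have h4 : ∀ Z : H ⊗[k] H, E ((comul (R := k)).lTensor H Z) =
          TensorProduct.rid k H ((counit (R := k)).lTensor H Z) ⊗ₜ x := by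
        intro Z
        induction Z with
        | zero => simp
        | add x y hx hy => simp only [map_add, add_tmul, hx, hy]
        | tmul g g' => simp [E, Algebra.algebraMap_eq_smul_one, smul_tmul]
      rw [h3, coassoc_apply, h4]
      simp
  have h2 : Function.Injective ((leftInvariant CH ΔH n).subtype.lTensor H) :=
    Module.Flat.lTensor_preserves_injective_linearMap _ (Submodule.injective_subtype _)
  intro x y hxy
  apply h2
  rw [← h1, ← h1, hxy]

end DegreeZeroCoactions

/-! ### Reconstruction of a form on `H` from its left invariant projection. -/

section LeftCounit

open TensorProduct Coalgebra HopfAlgebra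

variable {k : Type*} [Field k] {H : Type*} [Ring H] [HopfAlgebra k H]
  {ΩH : Type*} [Ring ΩH] [Algebra k ΩH] {ℋ : ℕ → Submodule k ΩH} [GradedAlgebra ℋ]
  {CH : DifferentialCalculus k H ℋ} {ΔH : ΩH →ₐ[k] ℋ ᵍ⊗[k] ℋ}

theorem leftCoaction_mul_d (hΔH : IsDGAExtension CH CH (Bialgebra.comulAlgHom k H) ΔH)
    (θ : ΩH) (h : H) : leftCoaction CH ΔH (θ * CH.d (CH.incl h)) =
      TensorProduct.map₂ (LinearMap.mul k H).flip CH.rightMulD (comul (R := k) h)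
        (leftCoaction CH ΔH θ) := by
  rw [leftCoaction, LinearMap.comp_apply, hΔH.coaction_mul_d, LinearMap.comp_apply,
    Bialgebra.comulAlgHom_apply]
  induction comul (R := k) h with
  | zero => simp
  | add x y hx hy => simp only [map_add, LinearMap.add_apply, hx, hy]
  | tmul x h =>
    induction coaction ΔH θ with
    | zero => simp
    | add x y hx hy => simp only [map_add, hx, hy]
    | tmul ω θ => simp [CH.π_mul_d, CH.π_mul_incl]

theorem leftCoaction_incl (hΔH : IsDGAExtension CH CH (Bialgebra.comulAlgHom k H) ΔH) (h : H) :
    leftCoaction CH ΔH (CH.incl h) = CH.incl.toLinearMap.lTensor H (comul (R := k) h) := by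
  rw [leftCoaction, LinearMap.comp_apply, hΔH.coaction_incl, ← LinearMap.comp_apply,
    LinearMap.rTensor, ← map_comp]
  have : CH.π ∘ₗ CH.incl.toLinearMap = LinearMap.id := by ext; simp
  rw [this]
  rfl

theorem leftCoaction_counit (hΔH : IsDGAExtension CH CH (Bialgebra.comulAlgHom k H) ΔH) (θ : ΩH) :
    TensorProduct.lid k ΩH ((counit (R := k)).rTensor ΩH (leftCoaction CH ΔH θ)) = θ := by
  have key : (TensorProduct.lid k ΩH).toLinearMap ∘ₗ (counit (R := k)).rTensor ΩH ∘ₗ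
      leftCoaction CH ΔH = LinearMap.id := by
    refine CH.linearMap_ext (fun h => ?_) (fun θ h ih => ?_)
    · simp only [LinearMap.comp_apply, LinearEquiv.coe_coe, LinearMap.id_apply,
        leftCoaction_incl hΔH]
      have h1 : TensorProduct.lid k H ((counit (R := k)).rTensor H (comul h)) = h := by simp
      conv_rhs => rw [← h1]
      induction comul (R := k) h with
      | zero => simp
      | add x y hx hy => simp only [map_add, hx, hy]
      | tmul x h => simp
    · simp only [LinearMap.comp_apply, LinearEquiv.coe_coe, LinearMap.id_apply] at ih ⊢
      rw [leftCoaction_mul_d hΔH]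
      have h1 : TensorProduct.lid k H ((counit (R := k)).rTensor H (comul h)) = h := by simp
      conv_rhs => rw [← ih, ← h1]
      induction comul (R := k) h with
      | zero => simp
      | add x y hx hy => simp only [map_add, LinearMap.add_apply, mul_add, hx, hy]
      | tmul x h =>
        induction leftCoaction CH ΔH θ with
        | zero => simp
        | add x y hx hy => simp only [map_add, add_mul, hx, hy]
        | tmul g θ =>
          simp [smul_smul]
          rw [mul_comm]
  exact LinearMap.congr_fun key θ

/-- `∑ θ₋₂ S(θ₋₁) θ₀ = θ`. -/
theorem leftMul_invariantProj (hΔH : IsDGAExtension CH CH (Bialgebra.comulAlgHom k H) ΔH)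
    (θ : ΩH) : TensorProduct.lift CH.leftMul
      ((invariantProj CH ΔH).lTensor H (leftCoaction CH ΔH θ)) = θ := by
  let K : H ⊗[k] (H ⊗[k] ΩH) →ₗ[k] ΩH :=
    TensorProduct.lift CH.leftMul ∘ₗ (TensorProduct.lift (CH.leftMul ∘ₗ antipode k)).lTensor H
  have h1 : TensorProduct.lift CH.leftMul
      ((invariantProj CH ΔH).lTensor H (leftCoaction CH ΔH θ)) =
      K ((leftCoaction CH ΔH).lTensor H (leftCoaction CH ΔH θ)) := by
    rw [invariantProj, LinearMap.lTensor_comp]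
    rfl
  have h2 : ∀ W : H ⊗[k] ΩH, K (TensorProduct.assoc k H H ΩH ((comul (R := k)).rTensor ΩH W)) =
      TensorProduct.lid k ΩH ((counit (R := k)).rTensor ΩH W) := by
    intro W
    induction W with
    | zero => simp
    | add x y hx hy => simp only [map_add, hx, hy]
    | tmul h θ =>
      have h3 : ∀ Z : H ⊗[k] H, K (TensorProduct.assoc k H H ΩH (Z ⊗ₜ θ)) =
          CH.incl (LinearMap.mul' k H ((antipode k).lTensor H Z)) * θ := by
        intro Z
        induction Z with
        | zero => simp
        | add x y hx hy => simp only [map_add, add_tmul, add_mul, hx, hy]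
        | tmul x y => simp [K, mul_assoc]
      rw [LinearMap.rTensor_tmul, h3, mul_antipode_lTensor_comul_apply]
      simp [Algebra.algebraMap_eq_smul_one]
  rw [h1, ← leftCoaction_coassoc hΔH, h2, leftCoaction_counit hΔH]

end LeftCounit

/-! ### Horizontal forms. -/

section Horizontal

open GradedTensorProduct TensorProduct Coalgebra HopfAlgebra

variable {k : Type*} [Field k] {A : Type*} [Ring A] [Algebra k A]
  {H : Type*} [Ring H] [HopfAlgebra k H]
  {ΩA : Type*} [Ring ΩA] [Algebra k ΩA] {𝒜 : ℕ → Submodule k ΩA} [GradedAlgebra 𝒜]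
  {ΩH : Type*} [Ring ΩH] [Algebra k ΩH] {ℋ : ℕ → Submodule k ΩH} [GradedAlgebra ℋ]
  {CA : DifferentialCalculus k A 𝒜} {CH : DifferentialCalculus k H ℋ}
  {δ : A →ₐ[k] A ⊗[k] H} {Δ : ΩA →ₐ[k] 𝒜 ᵍ⊗[k] ℋ} {ΔH : ΩH →ₐ[k] ℋ ᵍ⊗[k] ℋ}

variable (CH) in
/-- The horizontal forms `{ω | Δ(ω) ∈ Ω(A) ⊗ H}`. -/
def horizontal (Δ : ΩA →ₐ[k] 𝒜 ᵍ⊗[k] ℋ) : Submodule k ΩA :=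
  LinearMap.eqLocus (coaction Δ) (CH.incl.toLinearMap.lTensor ΩA ∘ₗ hopfCoaction CH Δ)

theorem coaction_of_mem_horizontal {m : ΩA} (hm : m ∈ horizontal CH Δ) :
    coaction Δ m = CH.incl.toLinearMap.lTensor ΩA (hopfCoaction CH Δ m) := hm

theorem lTensor_incl_π (X : ΩA ⊗[k] ΩH) :
    CH.incl.toLinearMap.lTensor ΩA (CH.π.lTensor ΩA X) =
      (GradedAlgebra.proj ℋ 0).lTensor ΩA X := by
  rw [← LinearMap.comp_apply, ← LinearMap.lTensor_comp]
  congr 2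
  ext θ
  exact CH.incl_π θ

theorem mem_horizontal_of_coaction_eq {m : ΩA} {W : ΩA ⊗[k] H}
    (h : coaction Δ m = CH.incl.toLinearMap.lTensor ΩA W) :
    m ∈ horizontal CH Δ ∧ hopfCoaction CH Δ m = W := by
  have h1 : hopfCoaction CH Δ m = W := by
    rw [hopfCoaction, LinearMap.comp_apply, h, ← LinearMap.comp_apply, ← LinearMap.lTensor_comp]
    have : CH.π ∘ₗ CH.incl.toLinearMap = LinearMap.id := by ext; simp
    rw [this, LinearMap.lTensor_id, LinearMap.id_apply]
  exact ⟨by rw [← h1] at h; exact h, h1⟩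

theorem incl_mem_horizontal (hΔ : IsDGAExtension CA CH δ Δ) (a : A) :
    CA.incl a ∈ horizontal CH Δ := by
  refine (mem_horizontal_of_coaction_eq (W := CA.incl.toLinearMap.rTensor H (δ a)) ?_).1
  rw [hΔ.coaction_incl, ← LinearMap.comp_apply, LinearMap.lTensor_comp_rTensor]

theorem baseForms_mem_horizontal {b : ΩA} (hb : b ∈ baseForms Δ) :
    b ∈ horizontal CH Δ ∧ hopfCoaction CH Δ b = b ⊗ₜ 1 := by
  refine mem_horizontal_of_coaction_eq ?_
  have h : Δ b = GradedTensorProduct.includeLeft 𝒜 ℋ b := hb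
  rw [LinearMap.lTensor_tmul, AlgHom.toLinearMap_apply, map_one]
  exact h

variable (ΩA CH) in
/-- Left multiplication with elements of `Ω(A) ⊗ H`. -/
def horizontalMul : ΩA ⊗[k] H →ₗ[k] ΩA ⊗[k] ΩH →ₗ[k] ΩA ⊗[k] ΩH :=
  TensorProduct.map₂ (LinearMap.mul k ΩA) CH.leftMul

@[simp]
theorem horizontalMul_tmul (ω η : ΩA) (h : H) (θ : ΩH) :
    horizontalMul ΩA CH (ω ⊗ₜ h) (η ⊗ₜ θ) = (ω * η) ⊗ₜ (CH.incl h * θ) := rfl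

theorem of_horizontal_mul (W : ΩA ⊗[k] H) (X : ΩA ⊗[k] ΩH) :
    of k 𝒜 ℋ (CH.incl.toLinearMap.lTensor ΩA W) * of k 𝒜 ℋ X =
      of k 𝒜 ℋ (horizontalMul ΩA CH W X) := by
  induction W with
  | zero => simp
  | add x y hx hy => simp only [map_add, LinearMap.add_apply, add_mul, hx, hy]
  | tmul ω h =>
    induction X with
    | zero => simp
    | add x y hx hy => simp only [map_add, mul_add, hx, hy]
    | tmul η θ => exact tmul_mul_tmul_right_zero _ η θ (CH.incl_mem h)

theorem coaction_horizontal_mul {m : ΩA} (hm : m ∈ horizontal CH Δ) (η : ΩA) :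
    coaction Δ (m * η) = horizontalMul ΩA CH (hopfCoaction CH Δ m) (coaction Δ η) := by
  apply (of k 𝒜 ℋ).injective
  rw [of_coaction, map_mul, ← of_coaction, ← of_coaction, coaction_of_mem_horizontal hm,
    of_horizontal_mul]

theorem lTensor_horizontalMul {f : ΩH →ₗ[k] ΩH} (hf : ∀ h θ, f (CH.incl h * θ) = CH.incl h * f θ)
    (W : ΩA ⊗[k] H) (X : ΩA ⊗[k] ΩH) :
    f.lTensor ΩA (horizontalMul ΩA CH W X) = horizontalMul ΩA CH W (f.lTensor ΩA X) := by
  induction W with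
  | zero => simp
  | add x y hx hy => simp only [map_add, LinearMap.add_apply, hx, hy]
  | tmul ω h =>
    induction X with
    | zero => simp
    | add x y hx hy => simp only [map_add, hx, hy]
    | tmul η θ => simp [hf]

theorem horizontalMul_incl (W V : ΩA ⊗[k] H) :
    horizontalMul ΩA CH W (CH.incl.toLinearMap.lTensor ΩA V) =
      CH.incl.toLinearMap.lTensor ΩA (W * V) := by
  induction W with
  | zero => simp
  | add x y hx hy => simp only [map_add, LinearMap.add_apply, add_mul, hx, hy]
  | tmul ω h =>
    induction V with
    | zero => simp
    | add x y hx hy => simp only [map_add, mul_add, hx, hy]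
    | tmul η θ => simp

theorem hopfCoaction_horizontal_mul {m : ΩA} (hm : m ∈ horizontal CH Δ) (η : ΩA) :
    hopfCoaction CH Δ (m * η) = hopfCoaction CH Δ m * hopfCoaction CH Δ η := by
  have key : ∀ (W : ΩA ⊗[k] H) (X : ΩA ⊗[k] ΩH),
      CH.π.lTensor ΩA (horizontalMul ΩA CH W X) = W * CH.π.lTensor ΩA X := by
    intro W X
    induction W with
    | zero => simp
    | add x y hx hy => simp only [map_add, LinearMap.add_apply, add_mul, hx, hy]
    | tmul ω h =>
      induction X with
      | zero => simp
      | add x y hx hy => simp only [map_add, mul_add, hx, hy]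
      | tmul η θ => simp [CH.π_incl_mul]
  conv_lhs => rw [hopfCoaction, LinearMap.comp_apply, coaction_horizontal_mul hm, key]
  rfl

theorem mul_mem_horizontal {m m' : ΩA} (hm : m ∈ horizontal CH Δ) (hm' : m' ∈ horizontal CH Δ) :
    m * m' ∈ horizontal CH Δ := by
  refine (mem_horizontal_of_coaction_eq
    (W := hopfCoaction CH Δ m * hopfCoaction CH Δ m') ?_).1
  rw [coaction_horizontal_mul hm, coaction_of_mem_horizontal hm', horizontalMul_incl]

theorem proj_incl_mul (n : ℕ) (h : H) (θ : ΩH) :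
    GradedAlgebra.proj ℋ n (CH.incl h * θ) = CH.incl h * GradedAlgebra.proj ℋ n θ := by
  induction θ using graded_induction ℋ with
  | zero => simp
  | homogeneous j θ hθ =>
    have hmul := SetLike.mul_mem_graded (CH.incl_mem h) hθ
    rw [zero_add] at hmul
    rcases eq_or_ne j n with rfl | hj
    · rw [GradedAlgebra.proj_apply, GradedAlgebra.proj_apply,
        DirectSum.decompose_of_mem_same ℋ hθ, DirectSum.decompose_of_mem_same ℋ hmul]
    · rw [GradedAlgebra.proj_apply, GradedAlgebra.proj_apply,
        DirectSum.decompose_of_mem_ne ℋ hθ hj, DirectSum.decompose_of_mem_ne ℋ hmul hj, mul_zero]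
  | add x y hx hy => simp only [mul_add, map_add, hx, hy]

/-- The coaction of `H` restricts to horizontal forms. -/
theorem rTensor_coaction_hopfCoaction (hδ : IsComoduleAlgebra δ) (hΔ : IsDGAExtension CA CH δ Δ)
    (hΔH : IsDGAExtension CH CH (Bialgebra.comulAlgHom k H) ΔH) {m : ΩA}
    (hm : m ∈ horizontal CH Δ) :
    (coaction Δ).rTensor H (hopfCoaction CH Δ m) =
      (CH.incl.toLinearMap.lTensor ΩA ∘ₗ hopfCoaction CH Δ).rTensor H
        (hopfCoaction CH Δ m) := by
  apply (TensorProduct.assoc k ΩA ΩH H).injective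
  have h := congrArg (map LinearMap.id (map LinearMap.id CH.π)) (coaction_coassoc hδ hΔ hΔH m)
  rw [map_map_assoc_apply, map_id] at h
  have h1 : (coaction Δ).rTensor H (hopfCoaction CH Δ m) =
      CH.π.lTensor (ΩA ⊗[k] ΩH) ((coaction Δ).rTensor ΩH (coaction Δ m)) := by
    rw [hopfCoaction, LinearMap.comp_apply]
    generalize coaction Δ m = X
    rw [← LinearMap.comp_apply, LinearMap.rTensor_comp_lTensor, ← LinearMap.comp_apply, LinearMap.lTensor_comp_rTensor]
  have h2 : ∀ W : ΩA ⊗[k] H, map LinearMap.id (map LinearMap.id CH.π)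
      ((coaction ΔH).lTensor ΩA (CH.incl.toLinearMap.lTensor ΩA W)) =
      map LinearMap.id (map CH.incl.toLinearMap LinearMap.id)
        ((comul (R := k)).lTensor ΩA W) := by
    intro W
    induction W with
    | zero => simp
    | add x y hx hy => simp only [map_add, hx, hy]
    | tmul ω h =>
      simp only [LinearMap.lTensor_tmul, map_tmul, LinearMap.id_apply, AlgHom.toLinearMap_apply,
        hΔH.coaction_incl, Bialgebra.comulAlgHom_apply]
      rw [← LinearMap.comp_apply, ← map_comp]
      have : CH.π ∘ₗ CH.incl.toLinearMap = LinearMap.id := by ext; simp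
      rw [this, LinearMap.id_comp]
  rw [h1]
  refine h.trans ?_
  rw [coaction_of_mem_horizontal hm, h2, ← hopfCoaction_coassoc hδ hΔ hΔH, map_map_assoc_apply,
    LinearMap.rTensor_comp, LinearMap.comp_apply]
  rfl

end Horizontal

section ActEval

variable {k : Type*} [Field k] {A : Type*} [Ring A] [Algebra k A] (S : Subalgebra k A)
  (N : Type*) [AddCommGroup N] [Module k N] [Module A N] [IsScalarTower k A N]

/-- The action map `A ⊗_S N → N`, `a ⊗ n ↦ a n`. -/
def actEval : BalancedTensor S N →ₗ[k] N :=
  Submodule.liftQ _ (TensorProduct.lift (Algebra.lsmul k k N).toLinearMap) (by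
    refine balancedRelations_le _ fun a b n => ?_
    simp [Subalgebra.smul_def])

@[simp]
theorem actEval_tmul (a : A) (n : N) : actEval S N (BalancedTensor.tmul a n) = a • n := rfl

end ActEval

/-! ### Descent for horizontal forms and for vertical parts. -/

section Descended

open GradedTensorProduct TensorProduct Coalgebra HopfAlgebra BalancedTensor

variable {k : Type u} [Field k] {A : Type v} [Ring A] [Algebra k A]
  {H : Type v} [Ring H] [HopfAlgebra k H]
  {ΩA : Type v} [Ring ΩA] [Algebra k ΩA] {𝒜 : ℕ → Submodule k ΩA} [GradedAlgebra 𝒜]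
  {ΩH : Type v} [Ring ΩH] [Algebra k ΩH] {ℋ : ℕ → Submodule k ΩH} [GradedAlgebra ℋ]
  {CA : DifferentialCalculus k A 𝒜} {CH : DifferentialCalculus k H ℋ}
  {δ : A →ₐ[k] A ⊗[k] H} {Δ : ΩA →ₐ[k] 𝒜 ᵍ⊗[k] ℋ} {ΔH : ΩH →ₐ[k] ℋ ᵍ⊗[k] ℋ}

variable (ΩA CH) in
/-- The map `ω ⊗ θ ↦ ω ⊗ θ₀ ⊗ θ₋₁`. -/
def leftCoactionOn (ΔH : ΩH →ₐ[k] ℋ ᵍ⊗[k] ℋ) : ΩA ⊗[k] ΩH →ₗ[k] (ΩA ⊗[k] ΩH) ⊗[k] H :=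
  (TensorProduct.rightComm k ΩA H ΩH).toLinearMap ∘ₗ
    (TensorProduct.assoc k ΩA H ΩH).symm.toLinearMap ∘ₗ (leftCoaction CH ΔH).lTensor ΩA

theorem leftCoactionOn_tmul (ω : ΩA) {θ : ΩH} (hθ : leftCoaction CH ΔH θ = 1 ⊗ₜ θ) :
    leftCoactionOn ΩA CH ΔH (ω ⊗ₜ θ) = (ω ⊗ₜ θ) ⊗ₜ 1 := by
  simp [leftCoactionOn, hθ]

/-- The cotensor identity with the `H`-leg moved last: on values of `Δ`, coacting on the first
factor agrees with coacting on the second. -/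
theorem leftCoactionOn_coaction (hδ : IsComoduleAlgebra δ) (hΔ : IsDGAExtension CA CH δ Δ)
    (hΔH : IsDGAExtension CH CH (Bialgebra.comulAlgHom k H) ΔH) (ω : ΩA) :
    tensorCoaction ΩH (hopfCoaction CH Δ) (coaction Δ ω) =
      leftCoactionOn ΩA CH ΔH (coaction Δ ω) := by
  simp only [leftCoactionOn, LinearMap.comp_apply, ← hopfCoaction_cotensor hδ hΔ hΔH,
    LinearEquiv.coe_coe, LinearEquiv.symm_apply_apply, tensorCoaction]

theorem leftCoaction_proj (hΔH : IsDGAExtension CH CH (Bialgebra.comulAlgHom k H) ΔH) (n : ℕ)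
    (θ : ΩH) : leftCoaction CH ΔH (GradedAlgebra.proj ℋ n θ) =
      (GradedAlgebra.proj ℋ n).lTensor H (leftCoaction CH ΔH θ) := by
  induction θ using graded_induction ℋ with
  | zero => simp
  | add x y hx hy => simp only [map_add, hx, hy]
  | homogeneous j θ hθ =>
    rw [GradedAlgebra.proj_apply]
    rcases eq_or_ne j n with rfl | hj
    · rw [DirectSum.decompose_of_mem_same ℋ hθ, leftCoaction_mem hΔH hθ]
    · rw [DirectSum.decompose_of_mem_ne ℋ hθ hj, map_zero, ← leftCoaction_mem hΔH hθ,
        ← LinearMap.comp_apply, ← LinearMap.lTensor_comp]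
      have : GradedAlgebra.proj ℋ n ∘ₗ GradedAlgebra.proj ℋ j = 0 := by
        ext θ
        exact DirectSum.decompose_of_mem_ne ℋ (SetLike.coe_mem _) hj
      rw [this, LinearMap.lTensor_zero, LinearMap.zero_apply]

theorem leftCoactionOn_proj (hΔH : IsDGAExtension CH CH (Bialgebra.comulAlgHom k H) ΔH) (n : ℕ)
    (X : ΩA ⊗[k] ΩH) :
    leftCoactionOn ΩA CH ΔH ((GradedAlgebra.proj ℋ n).lTensor ΩA X) =
      ((GradedAlgebra.proj ℋ n).lTensor ΩA).rTensor H (leftCoactionOn ΩA CH ΔH X) := by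
  induction X with
  | zero => simp
  | add x y hx hy => simp only [map_add, hx, hy]
  | tmul ω θ =>
    simp only [leftCoactionOn, LinearMap.comp_apply, LinearMap.lTensor_tmul,
      leftCoaction_proj hΔH]
    induction leftCoaction CH ΔH θ with
    | zero => simp
    | add x y hx hy => simp only [map_add, TensorProduct.tmul_add, hx, hy]
    | tmul h θ => simp

theorem tensorCoaction_proj (ρ : ΩA →ₗ[k] ΩA ⊗[k] H) (n : ℕ) (X : ΩA ⊗[k] ΩH) :
    tensorCoaction ΩH ρ ((GradedAlgebra.proj ℋ n).lTensor ΩA X) =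
      ((GradedAlgebra.proj ℋ n).lTensor ΩA).rTensor H (tensorCoaction ΩH ρ X) := by
  induction X with
  | zero => simp
  | add x y hx hy => simp only [map_add, hx, hy]
  | tmul ω θ =>
    simp only [tensorCoaction_tmul, LinearMap.lTensor_tmul]
    induction ρ ω with
    | zero => simp
    | add x y hx hy => simp only [map_add, add_tmul, hx, hy]
    | tmul h θ => simp

variable [Module A ΩA] [IsScalarTower k A ΩA]

theorem smul_leftCoactionOn (a : A) (X : ΩA ⊗[k] ΩH) :
    leftCoactionOn ΩA CH ΔH (a • X) =
      hopfAct k H A (ΩA ⊗[k] ΩH) (a ⊗ₜ 1) (leftCoactionOn ΩA CH ΔH X) := by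
  induction X with
  | zero => simp
  | add x y hx hy => simp only [smul_add, map_add, hx, hy]
  | tmul ω θ =>
    simp only [leftCoactionOn, LinearMap.comp_apply, LinearMap.lTensor_tmul, smul_tmul']
    induction leftCoaction CH ΔH θ with
    | zero => simp
    | add x y hx hy => simp only [map_add, TensorProduct.tmul_add, hx, hy]
    | tmul h θ => simp [smul_tmul']

/-- When the two coactions agree on the values of `f`, the one on `Ω(H)` may be used, and it
commutes with the action of `A`. Hypotheses of descent thus reduce to the multiplied-out element of
`Ω(A) ⊗ Ω(H)`. -/
theorem hopfModuleMap_map {ρ : ΩA →ₗ[k] ΩA ⊗[k] H} (hρ : IsHopfModule δ ρ)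
    (f : ΩA →ₗ[coinvariants δ] ΩA ⊗[k] ΩH)
    (hf : ∀ ω, tensorCoaction ΩH ρ (f ω) = leftCoactionOn ΩA CH ΔH (f ω))
    (z : BalancedTensor (coinvariants δ) ΩA) :
    hopfModuleMap (hρ.tensor ΩH) (BalancedTensor.map f z) =
      leftCoactionOn ΩA CH ΔH (actEval (coinvariants δ) _ (BalancedTensor.map f z)) := by
  induction z using BalancedTensor.induction with
  | zero => simp
  | add x y hx hy => simp only [map_add, hx, hy]
  | tmul a ω =>
    rw [BalancedTensor.map_tmul, hopfModuleMap_tmul, hf, actEval_tmul, smul_leftCoactionOn]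

/-- The coaction on forms as a map of left modules over the coinvariants. -/
def coactionB (hact : ∀ (a : A) (ω : ΩA), a • ω = CA.incl a * ω)
    (hΔ : IsDGAExtension CA CH δ Δ) : ΩA →ₗ[coinvariants δ] ΩA ⊗[k] ΩH where
  toFun := coaction Δ
  map_add' := map_add _
  map_smul' b ω := by
    rw [Subalgebra.smul_def, hact, hΔ.coaction_incl_mul, coinvariants_apply, RingHom.id_apply,
      Subalgebra.smul_def]
    induction coaction Δ ω with
    | zero => simp
    | add x y hx hy => simp only [smul_add, map_add, hx, hy]
    | tmul ω θ => simp [smul_tmul', hact]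

@[simp]
theorem coactionB_apply (hact : ∀ (a : A) (ω : ΩA), a • ω = CA.incl a * ω)
    (hΔ : IsDGAExtension CA CH δ Δ) (ω : ΩA) : coactionB hact hΔ ω = coaction Δ ω := rfl

variable (ΩA ΩH δ) in
/-- The inclusion `ω ↦ ω ⊗ 1` as a map of left modules over the coinvariants. -/
def inclLeftB : ΩA →ₗ[coinvariants δ] ΩA ⊗[k] ΩH where
  toFun ω := ω ⊗ₜ 1
  map_add' x y := add_tmul x y 1
  map_smul' b ω := by simp [Subalgebra.smul_def, smul_tmul']

theorem map_sub_apply {M N : Type v} [AddCommGroup M] [Module k M] [Module (coinvariants δ) M]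
    [IsScalarTower k (coinvariants δ) M] [AddCommGroup N] [Module k N]
    [Module (coinvariants δ) N] [IsScalarTower k (coinvariants δ) N]
    (f g : M →ₗ[coinvariants δ] N) (z : BalancedTensor (coinvariants δ) M) :
    BalancedTensor.map (f - g) z = BalancedTensor.map f z - BalancedTensor.map g z := by
  induction z using BalancedTensor.induction with
  | zero => simp
  | tmul a m =>
    simp only [BalancedTensor.map_tmul, LinearMap.sub_apply]
    exact (BalancedTensor.mk _ N a).map_sub _ _
  | add x y hx hy => simp only [map_add, hx, hy]; abel

theorem actEval_coactionB_actOn (hact : ∀ (a : A) (ω : ΩA), a • ω = CA.incl a * ω)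
    (hΔ : IsDGAExtension CA CH δ Δ) (ω : ΩA) (z : BalancedTensor (coinvariants δ) A) :
    actEval (coinvariants δ) _ (BalancedTensor.map (coactionB hact hΔ) (actOn δ ω z)) =
      tensorLeftMul CA CH (galoisMap δ z) (coaction Δ ω) := by
  induction z using BalancedTensor.induction with
  | zero => simp
  | add x y hx hy => simp only [map_add, LinearMap.add_apply, hx, hy]
  | tmul a a' =>
    rw [actOn_tmul, BalancedTensor.map_tmul, actEval_tmul, coactionB_apply, hact, hΔ.coaction_incl_mul,
      canonicalMap_tmul, Algebra.TensorProduct.includeLeft_apply]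
    induction δ a' with
    | zero => simp
    | add x y hx hy => simp only [map_add, LinearMap.add_apply, smul_add, mul_add, hx, hy]
    | tmul x h =>
      induction coaction Δ ω with
      | zero => simp
      | add x y hx hy => simp only [map_add, smul_add, hx, hy]
      | tmul ω θ => simp [smul_tmul', hact, mul_assoc]

/-- Horizontal forms are spanned by products of elements of `A` with base forms. -/
theorem horizontal_le_span (hact : ∀ (a : A) (ω : ΩA), a • ω = CA.incl a * ω)
    (hS : Function.Bijective (antipode k (A := H))) (hδ : IsQuantumPrincipalBundle δ)
    (hΔ : IsDGAExtension CA CH δ Δ)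
    (hΔH : IsDGAExtension CH CH (Bialgebra.comulAlgHom k H) ΔH) {m : ΩA}
    (hm : m ∈ horizontal CH Δ) :
    m ∈ Submodule.span k {x | ∃ (a : A) (b : ΩA), b ∈ baseForms Δ ∧ x = CA.incl a * b} := by
  have hρ := isHopfModule_forms hact hδ.comoduleAlgebra hΔ hΔH
  -- The tensor `t = τ(S⁻¹(m₁)) m₀` is the preimage of `m ⊗ 1` to which descent is applied.
  let Y := (antipodeInv hS).lTensor ΩA (hopfCoaction CH Δ m)
  let t := translate ΩA hδ Y
  have ht : hopfModuleMap hρ t = m ⊗ₜ 1 := by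
    rw [hopfModuleMap_translate, twist_antipodeInv hS hρ]
  -- Multiplying out gives `(1 ⊗ S⁻¹(m₁)) Δ(m₀)`. Horizontality of `m` places `Δ(m₀)` in `Ω(A) ⊗ H`,
  -- so the twist identity collapses this to `m ⊗ 1`.
  have hev : actEval (coinvariants δ) _ (BalancedTensor.map (coactionB hact hΔ) t) = m ⊗ₜ 1 := by
    let U : (ΩA ⊗[k] ΩH) ⊗[k] H →ₗ[k] ΩA ⊗[k] ΩH :=
      TensorProduct.lift ((tensorLeftMul CA CH ∘ₗ TensorProduct.mk k A H 1).flip)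
    have h1 : ∀ Z : ΩA ⊗[k] H, actEval (coinvariants δ) _
        (BalancedTensor.map (coactionB hact hΔ) (translate ΩA hδ Z)) =
        U ((coaction Δ).rTensor H Z) := by
      intro Z
      induction Z with
      | zero => simp
      | add x y hx hy => simp only [map_add, hx, hy]
      | tmul ω h =>
        rw [translate_tmul, actEval_coactionB_actOn, galoisMap_translation]
        simp [U]
    have h2 : ∀ Z : ΩA ⊗[k] H, U ((CH.incl.toLinearMap.lTensor ΩA ∘ₗ
        hopfCoaction CH Δ).rTensor H Z) =
        CH.incl.toLinearMap.lTensor ΩA (twist (hopfCoaction CH Δ) Z) := by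
      intro Z
      induction Z with
      | zero => simp
      | add x y hx hy => simp only [map_add, hx, hy]
      | tmul ω h =>
        rw [twist_tmul, LinearMap.rTensor_tmul, LinearMap.comp_apply]
        induction hopfCoaction CH Δ ω with
        | zero => simp
        | add x y hx hy => simp only [map_add, add_tmul, hx, hy]
        | tmul ω g => simp [U]
    have h3 : (coaction Δ).rTensor H Y =
        (CH.incl.toLinearMap.lTensor ΩA ∘ₗ hopfCoaction CH Δ).rTensor H Y := by
      have h := congrArg ((antipodeInv hS).lTensor (ΩA ⊗[k] ΩH))
        (rTensor_coaction_hopfCoaction hδ.comoduleAlgebra hΔ hΔH hm)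
      have comm : ∀ (f : ΩA →ₗ[k] ΩA ⊗[k] ΩH) (Z : ΩA ⊗[k] H),
          (antipodeInv hS).lTensor (ΩA ⊗[k] ΩH) (f.rTensor H Z) =
            f.rTensor H ((antipodeInv hS).lTensor ΩA Z) := by
        intro f Z
        rw [← LinearMap.comp_apply, LinearMap.lTensor_comp_rTensor, ← LinearMap.comp_apply,
          LinearMap.rTensor_comp_lTensor]
      rwa [comm, comm] at h
    rw [h1, h3, h2, twist_antipodeInv hS hρ]
    simp
  -- The kernel of `Δ - (· ⊗ 1)` consists of the base forms. Both maps send `t` to `(m ⊗ 1) ⊗ 1`,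
  -- the left invariance of `1 ∈ Ω(H)` entering for `Δ`.
  have h := mem_span_smul_ker hS hδ hρ (hρ.tensor ΩH)
    (coactionB hact hΔ - inclLeftB ΩA ΩH δ) (m := m) t ht (by
      rw [map_sub_apply, map_sub, hopfModuleMap_map hρ _ fun ω =>
        leftCoactionOn_coaction hδ.comoduleAlgebra hΔ hΔH ω, hev, leftCoactionOn_tmul]
      · have h4 : ∀ z, hopfModuleMap (hρ.tensor ΩH) (BalancedTensor.map (inclLeftB ΩA ΩH δ) z) =
            TensorProduct.rightComm k ΩA H ΩH (hopfModuleMap hρ z ⊗ₜ 1) := by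
          intro z
          induction z using BalancedTensor.induction with
          | zero => simp
          | add x y hx hy => simp only [map_add, add_tmul, hx, hy]
          | tmul a ω => exact hopfModuleMap_tensor ΩH hρ a ω 1
        rw [h4, ht]
        simp
      · rw [← map_one CH.incl, leftCoaction_incl hΔH]
        simp [Algebra.TensorProduct.one_def])
  refine Submodule.span_mono ?_ h
  rintro _ ⟨a, b, hb, rfl⟩
  refine ⟨a, b, ?_, hact a b⟩
  exact (of k 𝒜 ℋ).symm.injective (sub_eq_zero.1 hb)

/-- The part of the coaction of a `n`-form which is of degree `n` in `Ω(H)`. -/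
def verticalPart (hact : ∀ (a : A) (ω : ΩA), a • ω = CA.incl a * ω)
    (hΔ : IsDGAExtension CA CH δ Δ) (n : ℕ) : ΩA →ₗ[coinvariants δ] ΩA ⊗[k] ΩH where
  toFun ω := (GradedAlgebra.proj ℋ n).lTensor ΩA (coaction Δ (GradedAlgebra.proj 𝒜 n ω))
  map_add' x y := by simp only [map_add]
  map_smul' b ω := by
    have h1 : GradedAlgebra.proj 𝒜 n (b • ω) = b • GradedAlgebra.proj 𝒜 n ω := by
      rw [Subalgebra.smul_def, Subalgebra.smul_def, hact, hact]
      induction ω using graded_induction 𝒜 with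
      | zero => simp
      | homogeneous j ω hω =>
        have hmul := SetLike.mul_mem_graded (CA.incl_mem b) hω
        rw [zero_add] at hmul
        rcases eq_or_ne j n with rfl | hj
        · rw [GradedAlgebra.proj_apply, GradedAlgebra.proj_apply,
            DirectSum.decompose_of_mem_same 𝒜 hω, DirectSum.decompose_of_mem_same 𝒜 hmul]
        · rw [GradedAlgebra.proj_apply, GradedAlgebra.proj_apply,
            DirectSum.decompose_of_mem_ne 𝒜 hω hj, DirectSum.decompose_of_mem_ne 𝒜 hmul hj,
            mul_zero]
      | add x y hx hy => simp only [mul_add, map_add, hx, hy]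
    rw [h1, ← coactionB_apply hact hΔ, map_smul, coactionB_apply, RingHom.id_apply,
      Subalgebra.smul_def, Subalgebra.smul_def]
    induction coaction Δ (GradedAlgebra.proj 𝒜 n ω) with
    | zero => simp
    | add x y hx hy => simp only [smul_add, map_add, hx, hy]
    | tmul ω θ => simp [smul_tmul']

theorem verticalPart_apply (hact : ∀ (a : A) (ω : ΩA), a • ω = CA.incl a * ω)
    (hΔ : IsDGAExtension CA CH δ Δ) {n : ℕ} {ω : ΩA} (hω : ω ∈ 𝒜 n) :
    verticalPart hact hΔ n ω = (GradedAlgebra.proj ℋ n).lTensor ΩA (coaction Δ ω) := by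
  change (GradedAlgebra.proj ℋ n).lTensor ΩA (coaction Δ (GradedAlgebra.proj 𝒜 n ω)) = _
  rw [GradedAlgebra.proj_apply, DirectSum.decompose_of_mem_same 𝒜 hω]

/-- `1 ⊗ θ` is an `A`-linear combination of vertical parts of forms. -/
theorem exists_verticalPart (hact : ∀ (a : A) (ω : ΩA), a • ω = CA.incl a * ω)
    (hδ : IsQuantumPrincipalBundle δ) (hΔ : IsDGAExtension CA CH δ Δ) (n : ℕ) {θ : ΩH}
    (hθ : θ ∈ ℋ n) : ∃ t, actEval (coinvariants δ) _
      (BalancedTensor.map (verticalPart hact hΔ n) t) = (1 : ΩA) ⊗ₜ[k] θ := by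
  let P : ℕ → Submodule k ΩH := fun n => (LinearMap.range (actEval (coinvariants δ) _ ∘ₗ
    BalancedTensor.map (verticalPart hact hΔ n))).comap (TensorProduct.mk k ΩA ΩH 1)
  refine CH.induction_mem (P := P) (fun h => ?_) (fun n θ g hθ ih => ?_) n hθ
  · refine ⟨actOn δ (1 : ΩA) (translation hδ h), ?_⟩
    have h1 : ∀ z, actEval (coinvariants δ) _ (BalancedTensor.map (verticalPart hact hΔ 0)
        (actOn δ (1 : ΩA) z)) =
        TensorProduct.map CA.incl.toLinearMap CH.incl.toLinearMap (galoisMap δ z) := by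
      intro z
      induction z using BalancedTensor.induction with
      | zero => simp
      | add x y hx hy => simp only [map_add, hx, hy]
      | tmul a a' =>
        rw [actOn_tmul, hact, mul_one, BalancedTensor.map_tmul, actEval_tmul,
          verticalPart_apply hact hΔ (CA.incl_mem a'), hΔ.coaction_incl, canonicalMap_tmul,
          Algebra.TensorProduct.includeLeft_apply]
        induction δ a' with
        | zero => simp
        | add x y hx hy => simp only [map_add, smul_add, mul_add, hx, hy]
        | tmul x h =>
          simp [smul_tmul', hact, DirectSum.decompose_of_mem_same ℋ (CH.incl_mem h)]
    rw [LinearMap.comp_apply, h1, galoisMap_translation]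
    simp
  · obtain ⟨t, ht⟩ := ih
    -- In top vertical degree only the summand `a₀ ⊗ da₁` of the coaction of `da` contributes.
    let R : A ⊗[k] H →ₗ[k] ΩA ⊗[k] ΩH →ₗ[k] ΩA ⊗[k] ΩH :=
      TensorProduct.map₂ CA.rightMul CH.rightMulD
    have h1 : ∀ (y : ΩA), y ∈ 𝒜 n → ∀ a : A, verticalPart hact hΔ (n + 1)
        (y * CA.d (CA.incl a)) = R (δ a) (verticalPart hact hΔ n y) := by
      intro y hy a
      rw [verticalPart_apply hact hΔ hy, verticalPart_apply hact hΔ (CA.mul_d_mem hy a),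
        hΔ.coaction_mul_d]
      refine hΔ.eq_on_coaction (f := (GradedAlgebra.proj ℋ (n + 1)).lTensor ΩA ∘ₗ
        tensorRightMulD CA CH (δ a)) (g := R (δ a) ∘ₗ (GradedAlgebra.proj ℋ n).lTensor ΩA) ?_ hy
      intro r s ω θ hrs _ hs
      simp only [LinearMap.comp_apply]
      induction δ a with
      | zero => simp
      | add x y hx hy => simp only [map_add, LinearMap.add_apply, hx, hy]
      | tmul x h =>
        have e1 : gradingInvolution ℋ θ * CH.incl h ∈ ℋ s := by
          rw [gradingInvolution_apply hs, smul_mul_assoc]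
          have := SetLike.mul_mem_graded hs (CH.incl_mem h)
          rw [add_zero] at this
          exact Submodule.smul_mem _ _ this
        have e2 := CH.mul_d_mem hs h
        simp only [tensorRightMulD_tmul, map_add, LinearMap.lTensor_tmul,
          GradedAlgebra.proj_apply, R]
        rw [DirectSum.decompose_of_mem_ne ℋ e1 (by omega), tmul_zero, zero_add]
        rcases eq_or_ne s n with rfl | hsn
        · rw [DirectSum.decompose_of_mem_same ℋ e2, DirectSum.decompose_of_mem_same ℋ hs]
          rfl
        · rw [DirectSum.decompose_of_mem_ne ℋ e2 (by omega),
            DirectSum.decompose_of_mem_ne ℋ hs hsn]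
          simp
    have h2 : ∀ (b : A) (Z : A ⊗[k] H) (X : ΩA ⊗[k] ΩH), R Z (b • X) = b • R Z X := by
      intro b Z X
      induction Z with
      | zero => simp
      | add x y hx hy => simp only [map_add, LinearMap.add_apply, smul_add, hx, hy]
      | tmul x h =>
        induction X with
        | zero => simp
        | add x y hx hy => simp only [map_add, smul_add, hx, hy]
        | tmul ω θ => simp [R, smul_tmul', hact, mul_assoc]
    have h3 : ∀ (a a' : A) (t : BalancedTensor (coinvariants δ) ΩA), ∃ t',
        actEval (coinvariants δ) _ (BalancedTensor.map (verticalPart hact hΔ (n + 1)) t') =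
        a • R (δ a') (actEval (coinvariants δ) _
          (BalancedTensor.map (verticalPart hact hΔ n) t)) := by
      intro a a' t
      induction t using BalancedTensor.induction with
      | zero => exact ⟨0, by simp⟩
      | add x y hx hy =>
        obtain ⟨x', hx⟩ := hx
        obtain ⟨y', hy⟩ := hy
        exact ⟨x' + y', by simp only [map_add, smul_add, hx, hy]⟩
      | tmul x y =>
        have hmem : GradedAlgebra.proj 𝒜 n y ∈ 𝒜 n := SetLike.coe_mem _
        refine ⟨tmul (a * x) (GradedAlgebra.proj 𝒜 n y * CA.d (CA.incl a')), ?_⟩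
        rw [BalancedTensor.map_tmul, actEval_tmul, h1 _ hmem, BalancedTensor.map_tmul,
          actEval_tmul, h2, mul_smul, verticalPart_apply hact hΔ hmem]
        rfl
    -- The outcome of multiplying by `a` on the left and `da'` on the right depends only on `χ(a ⊗
    -- a')`. Taking `τ(g)` for `a ⊗ a'` leaves `1 ⊗ θ dg`.
    let G : A ⊗[k] H →ₗ[k] ΩA ⊗[k] ΩH :=
      TensorProduct.map CA.incl.toLinearMap (CH.rightMulD.flip θ)
    have h4 : ∀ z, ∃ t', actEval (coinvariants δ) _
        (BalancedTensor.map (verticalPart hact hΔ (n + 1)) t') = G (galoisMap δ z) := by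
      intro z
      induction z using BalancedTensor.induction with
      | zero => exact ⟨0, by simp⟩
      | add x y hx hy =>
        obtain ⟨x', hx⟩ := hx
        obtain ⟨y', hy⟩ := hy
        exact ⟨x' + y', by simp only [map_add, hx, hy]⟩
      | tmul a a' =>
        obtain ⟨t', ht'⟩ := h3 a a' t
        refine ⟨t', ht'.trans ?_⟩
        rw [LinearMap.comp_apply, TensorProduct.mk_apply] at ht
        rw [ht, canonicalMap_tmul, Algebra.TensorProduct.includeLeft_apply]
        induction δ a' with
        | zero => simp
        | add x y hx hy => simp only [map_add, LinearMap.add_apply, smul_add, mul_add, hx, hy]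
        | tmul x h => simp [R, G, smul_tmul', hact]
    obtain ⟨t', ht'⟩ := h4 (translation hδ g)
    refine ⟨t', ht'.trans ?_⟩
    rw [galoisMap_translation]
    simp [G]

/-- Left invariant forms on `H` are vertical parts of forms on `A`. -/
theorem leftInvariant_mem_range (hact : ∀ (a : A) (ω : ΩA), a • ω = CA.incl a * ω)
    (hS : Function.Bijective (antipode k (A := H))) (hδ : IsQuantumPrincipalBundle δ)
    (hΔ : IsDGAExtension CA CH δ Δ)
    (hΔH : IsDGAExtension CH CH (Bialgebra.comulAlgHom k H) ΔH) {n : ℕ} {θ : ΩH}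
    (hθ : θ ∈ leftInvariant CH ΔH n) :
    ∃ ω ∈ 𝒜 n, (GradedAlgebra.proj ℋ n).lTensor ΩA (coaction Δ ω) = 1 ⊗ₜ θ := by
  have hρ := isHopfModule_forms hact hδ.comoduleAlgebra hΔ hΔH
  obtain ⟨t, ht⟩ := exists_verticalPart hact hδ hΔ n hθ.1
  have hinv : leftCoaction CH ΔH θ = 1 ⊗ₜ θ := hθ.2
  have h1 : hopfCoaction CH Δ 1 = 1 ⊗ₜ 1 := by
    rw [← map_one CA.incl, hopfCoaction_incl hΔ]
    simp [Algebra.TensorProduct.one_def]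
  -- An `A`-combination of vertical parts equals `1 ⊗ θ`, which is coinvariant; descent removes the
  -- coefficients and yields a single form.
  obtain ⟨ω, hω⟩ := mem_range_of_hopfModuleMap hS hδ (hρ.tensor ΩH) (verticalPart hact hΔ n)
    (n := (1 : ΩA) ⊗ₜ θ) (by simp [h1]) t (by
      rw [hopfModuleMap_map (CH := CH) (ΔH := ΔH) hρ (verticalPart hact hΔ n) (fun ω => ?_), ht,
        leftCoactionOn_tmul _ hinv]
      change tensorCoaction ΩH (hopfCoaction CH Δ) ((GradedAlgebra.proj ℋ n).lTensor ΩA _) =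
        leftCoactionOn ΩA CH ΔH ((GradedAlgebra.proj ℋ n).lTensor ΩA _)
      rw [tensorCoaction_proj, leftCoactionOn_proj hΔH,
        leftCoactionOn_coaction hδ.comoduleAlgebra hΔ hΔH])
  exact ⟨GradedAlgebra.proj 𝒜 n ω, SetLike.coe_mem _, hω⟩

end Descended

/-! ### Truncation by vertical degree. -/

section Truncation

open GradedTensorProduct TensorProduct

variable {k : Type*} [Field k] {ΩA : Type*} [Ring ΩA] [Algebra k ΩA]
  {ΩH : Type*} [Ring ΩH] [Algebra k ΩH] (ℋ : ℕ → Submodule k ΩH) [GradedAlgebra ℋ]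

/-- The projection of `Ω(H)` onto the parts of degree less than `p`. -/
def truncate (p : ℕ) : ΩH →ₗ[k] ΩH := ∑ q ∈ Finset.range p, GradedAlgebra.proj ℋ q

theorem truncate_of_mem {p q : ℕ} {θ : ΩH} (hθ : θ ∈ ℋ q) :
    truncate ℋ p θ = if q < p then θ else 0 := by
  have h (r : ℕ) : GradedAlgebra.proj ℋ r θ = if q = r then θ else 0 := by
    rw [GradedAlgebra.proj_apply]
    split_ifs with hr
    · subst hr
      exact DirectSum.decompose_of_mem_same ℋ hθ
    · exact DirectSum.decompose_of_mem_ne ℋ hθ hr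
  simp [truncate, h]

variable {ℋ}

theorem lTensor_truncate_of_succ {p : ℕ} {Z : ΩA ⊗[k] ΩH}
    (h : (truncate ℋ (p + 1)).lTensor ΩA Z = Z)
    (h' : (GradedAlgebra.proj ℋ p).lTensor ΩA Z = 0) : (truncate ℋ p).lTensor ΩA Z = Z := by
  have h1 : truncate ℋ (p + 1) = truncate ℋ p + GradedAlgebra.proj ℋ p :=
    Finset.sum_range_succ _ _
  rwa [h1, LinearMap.lTensor_add, LinearMap.add_apply, h', add_zero] at h

theorem lTensor_eq_of_truncate {V : Type*} [AddCommGroup V] [Module k V] {p : ℕ}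
    {f g : ΩH →ₗ[k] V} (hfg : ∀ q < p, ∀ θ ∈ ℋ q, f θ = g θ) {Z : ΩA ⊗[k] ΩH}
    (h : (truncate ℋ p).lTensor ΩA Z = Z) : f.lTensor ΩA Z = g.lTensor ΩA Z := by
  have h1 : f ∘ₗ truncate ℋ p = g ∘ₗ truncate ℋ p := by
    refine linearMap_ext_graded ℋ fun q θ hθ => ?_
    rw [LinearMap.comp_apply, LinearMap.comp_apply, truncate_of_mem ℋ hθ]
    split_ifs with hq
    · exact hfg q hq θ hθ
    · simp
  rw [← h, ← LinearMap.comp_apply, ← LinearMap.comp_apply, ← LinearMap.lTensor_comp, h1,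
    LinearMap.lTensor_comp]

end Truncation

/-! ### Vertical sections and a spanning set for the forms on `A`. -/

section Sections

open GradedTensorProduct TensorProduct Coalgebra HopfAlgebra

variable {k : Type u} [Field k] {A : Type v} [Ring A] [Algebra k A]
  {H : Type v} [Ring H] [HopfAlgebra k H]
  {ΩA : Type v} [Ring ΩA] [Algebra k ΩA] {𝒜 : ℕ → Submodule k ΩA} [GradedAlgebra 𝒜]
  {ΩH : Type v} [Ring ΩH] [Algebra k ΩH] {ℋ : ℕ → Submodule k ΩH} [GradedAlgebra ℋ]
  {CA : DifferentialCalculus k A 𝒜} {CH : DifferentialCalculus k H ℋ}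
  {δ : A →ₐ[k] A ⊗[k] H} {Δ : ΩA →ₐ[k] 𝒜 ᵍ⊗[k] ℋ} {ΔH : ΩH →ₐ[k] ℋ ᵍ⊗[k] ℋ}

variable (CH Δ ΔH) in
/-- A linear choice of `n`-forms on `A` with a prescribed left invariant vertical part. -/
structure IsVerticalSection (n : ℕ) (φ : leftInvariant CH ΔH n →ₗ[k] ΩA) : Prop where
  mem : ∀ θ, φ θ ∈ 𝒜 n
  proj_coaction : ∀ θ, (GradedAlgebra.proj ℋ n).lTensor ΩA (coaction Δ (φ θ)) = 1 ⊗ₜ (θ : ΩH)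

/-- Preimages are chosen on a `k`-basis; no compatibility beyond linearity is required. -/
theorem exists_verticalSection [Module A ΩA] [IsScalarTower k A ΩA]
    (hact : ∀ (a : A) (ω : ΩA), a • ω = CA.incl a * ω)
    (hS : Function.Bijective (antipode k (A := H))) (hδ : IsQuantumPrincipalBundle δ)
    (hΔ : IsDGAExtension CA CH δ Δ)
    (hΔH : IsDGAExtension CH CH (Bialgebra.comulAlgHom k H) ΔH) (n : ℕ) :
    ∃ φ, IsVerticalSection CH Δ ΔH n φ := by
  choose f hf hf' using fun θ : leftInvariant CH ΔH n =>
    leftInvariant_mem_range hact hS hδ hΔ hΔH θ.2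
  let b := Module.Basis.ofVectorSpace k (leftInvariant CH ΔH n)
  refine ⟨b.constr k fun i => f (b i), fun θ => ?_, fun θ => ?_⟩
  · have h := LinearMap.mem_range_self (b.constr k fun i => f (b i)) θ
    rw [b.constr_range] at h
    refine Submodule.span_le.2 ?_ h
    rintro _ ⟨i, rfl⟩
    exact hf _
  · have h : (GradedAlgebra.proj ℋ n).lTensor ΩA ∘ₗ coaction Δ ∘ₗ b.constr k (fun i => f (b i)) =
        TensorProduct.mk k ΩA ΩH 1 ∘ₗ (leftInvariant CH ΔH n).subtype := by
      refine b.ext fun i => ?_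
      simp only [LinearMap.comp_apply, b.constr_basis, hf']
      rfl
    exact LinearMap.congr_fun h θ

theorem lTensor_truncate_coaction (hΔ : IsDGAExtension CA CH δ Δ) {n : ℕ} {ω : ΩA} (hω : ω ∈ 𝒜 n) :
    (truncate ℋ (n + 1)).lTensor ΩA (coaction Δ ω) = coaction Δ ω := by
  refine hΔ.eq_on_coaction (g := LinearMap.id) (fun r s ω θ hrs _ hθ => ?_) hω
  rw [LinearMap.lTensor_tmul, truncate_of_mem ℋ hθ, if_pos (by omega), LinearMap.id_apply]

theorem truncate_incl_mul (p : ℕ) (h : H) (θ : ΩH) :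
    truncate ℋ p (CH.incl h * θ) = CH.incl h * truncate ℋ p θ := by
  simp only [truncate, LinearMap.sum_apply, proj_incl_mul, Finset.mul_sum]

/-- If the coaction of a form vanishes in vertical degrees greater than `p`, then its part of
vertical degree `p` lies in the tensor product of horizontal forms with `Ω(H)`. -/
theorem exists_horizontal_tensor (hδ : IsComoduleAlgebra δ)
    (hΔ : IsDGAExtension CA CH δ Δ)
    (hΔH : IsDGAExtension CH CH (Bialgebra.comulAlgHom k H) ΔH) {p : ℕ} {ω : ΩA}
    (hω : (truncate ℋ (p + 1)).lTensor ΩA (coaction Δ ω) = coaction Δ ω) :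
    ∃ X' : horizontal CH Δ ⊗[k] ΩH, (horizontal CH Δ).subtype.rTensor ΩH X' =
      (GradedAlgebra.proj ℋ p).lTensor ΩA (coaction Δ ω) := by
  -- The part of the coaction of positive vertical degree. Its kernel is the space of horizontal
  -- forms, and tensoring with `Ω(H)` over a field keeps this kernel.
  let D : ΩA →ₗ[k] ΩA ⊗[k] ΩH :=
    coaction Δ - CH.incl.toLinearMap.lTensor ΩA ∘ₗ hopfCoaction CH Δ
  have hD : D = (LinearMap.id - GradedAlgebra.proj ℋ 0).lTensor ΩA ∘ₗ coaction Δ := by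
    ext η
    simp only [D, LinearMap.sub_apply, LinearMap.comp_apply, LinearMap.lTensor_sub,
      LinearMap.lTensor_id, LinearMap.id_apply, hopfCoaction, lTensor_incl_π]
  have hex : Function.Exact (horizontal CH Δ).subtype D := by
    intro x
    rw [LinearMap.sub_apply, sub_eq_zero]
    exact ⟨fun h => ⟨⟨x, h⟩, rfl⟩, fun ⟨y, hy⟩ => hy ▸ y.2⟩
  refine (Module.Flat.rTensor_exact ΩH hex _).1 ?_
  apply (TensorProduct.assoc k ΩA ΩH ΩH).injective
  have h1 := congrArg (map LinearMap.id
    (map (LinearMap.id - GradedAlgebra.proj ℋ 0) (GradedAlgebra.proj ℋ p)))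
    (coaction_coassoc hδ hΔ hΔH ω)
  rw [map_map_assoc_apply] at h1
  have e1 : ∀ Y, map (map LinearMap.id (LinearMap.id - GradedAlgebra.proj ℋ 0))
      (GradedAlgebra.proj ℋ p) ((coaction Δ).rTensor ΩH Y) =
      D.rTensor ΩH ((GradedAlgebra.proj ℋ p).lTensor ΩA Y) := by
    intro Y
    rw [hD]
    induction Y with
    | zero => simp
    | add x y hx hy => simp only [map_add, hx, hy]
    | tmul η θ => rfl
  rw [e1] at h1
  rw [h1, map_zero]
  change LinearMap.lTensor ΩA _ (LinearMap.lTensor ΩA _ _) = 0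
  rw [← LinearMap.comp_apply, ← LinearMap.lTensor_comp,
    lTensor_eq_of_truncate (g := 0) (fun q hq θ hθ => ?_) hω, LinearMap.lTensor_zero,
    LinearMap.zero_apply]
  -- By coassociativity the obstruction lies in bidegrees (positive, `p`) of `Δ_H(θ)`; these are
  -- empty because `θ` has degree at most `p`.
  refine hΔH.eq_on_coaction (f := map (LinearMap.id - GradedAlgebra.proj ℋ 0)
    (GradedAlgebra.proj ℋ p)) (g := 0) (fun r s η η' hrs hη hη' => ?_) hθ
  rw [map_tmul, LinearMap.zero_apply, GradedAlgebra.proj_apply]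
  rcases eq_or_ne r 0 with rfl | hr
  · rw [LinearMap.sub_apply, GradedAlgebra.proj_apply, DirectSum.decompose_of_mem_same ℋ hη]
    simp
  · rw [DirectSum.decompose_of_mem_ne ℋ hη' (by omega), tmul_zero]

/-- Forms on `A` are spanned by products of horizontal forms with the values of vertical
sections. -/
theorem mem_span_horizontal_mul (hδ : IsComoduleAlgebra δ)
    (hΔ : IsDGAExtension CA CH δ Δ)
    (hΔH : IsDGAExtension CH CH (Bialgebra.comulAlgHom k H) ΔH)
    {φ : ∀ n, leftInvariant CH ΔH n →ₗ[k] ΩA} (hφ : ∀ n, IsVerticalSection CH Δ ΔH n (φ n))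
    (ω : ΩA) :
    ω ∈ Submodule.span k {x | ∃ m ∈ horizontal CH Δ, ∃ n θ, x = m * φ n θ} := by
  -- Induction on a strict bound `p` for the vertical degree; an `n`-form starts at `n + 1`.
  suffices h : ∀ p, ∀ ω : ΩA, (truncate ℋ p).lTensor ΩA (coaction Δ ω) = coaction Δ ω →
      ω ∈ Submodule.span k {x | ∃ m ∈ horizontal CH Δ, ∃ n θ, x = m * φ n θ} by
    induction ω using graded_induction 𝒜 with
    | zero => exact zero_mem _
    | homogeneous n ω hω => exact h (n + 1) ω (lTensor_truncate_coaction hΔ hω)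
    | add x y hx hy => exact add_mem hx hy
  intro p
  induction p with
  | zero =>
    intro ω hω
    have h0 : coaction Δ ω = 0 := by
      rw [← hω]
      simp [truncate]
    have : ω = 0 := by
      rw [← hopfCoaction_counit hδ hΔ ω, hopfCoaction, LinearMap.comp_apply, h0]
      simp
    rw [this]
    exact zero_mem _
  | succ p ih =>
    intro ω hω
    obtain ⟨X', hX'⟩ := exists_horizontal_tensor hδ hΔ hΔH hω
    let P : ΩH →ₗ[k] leftInvariant CH ΔH p :=
      (invariantProj CH ΔH ∘ₗ GradedAlgebra.proj ℋ p).codRestrict _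
        (fun θ => invariantProj_mem hΔH (SetLike.coe_mem _))
    -- `m ⊗ θ ↦ m φ(P θ)`. Applied to the leading vertical part of `ω`, it produces a form in the
    -- span with the same leading part, which can be subtracted.
    let μ : horizontal CH Δ ⊗[k] ΩH →ₗ[k] ΩA :=
      TensorProduct.lift ((LinearMap.mul k ΩA ∘ₗ (horizontal CH Δ).subtype).compl₂ (φ p ∘ₗ P))
    have hμ : ∀ Y, μ Y ∈ Submodule.span k {x | ∃ m ∈ horizontal CH Δ, ∃ n θ, x = m * φ n θ} ∧
        (truncate ℋ (p + 1)).lTensor ΩA (coaction Δ (μ Y)) = coaction Δ (μ Y) := by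
      intro Y
      induction Y with
      | zero => simp
      | add x y hx hy =>
        rw [map_add]
        refine ⟨add_mem hx.1 hy.1, ?_⟩
        rw [map_add, map_add, hx.2, hy.2]
      | tmul m θ =>
        refine ⟨Submodule.subset_span ⟨m, m.2, p, P θ, rfl⟩, ?_⟩
        change _ = coaction Δ ((m : ΩA) * φ p (P θ))
        rw [coaction_horizontal_mul m.2]
        change (truncate ℋ (p + 1)).lTensor ΩA (coaction Δ ((m : ΩA) * φ p (P θ))) = _
        rw [coaction_horizontal_mul m.2, lTensor_horizontalMul (truncate_incl_mul _),
          lTensor_truncate_coaction hΔ ((hφ p).mem _)]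
    let K : (ΩA ⊗[k] H) ⊗[k] ΩH →ₗ[k] ΩA ⊗[k] ΩH :=
      (TensorProduct.lift CH.leftMul ∘ₗ
        (invariantProj CH ΔH ∘ₗ GradedAlgebra.proj ℋ p).lTensor H).lTensor ΩA ∘ₗ
          (TensorProduct.assoc k ΩA H ΩH).toLinearMap
    have h1 : ∀ Y, (GradedAlgebra.proj ℋ p).lTensor ΩA (coaction Δ (μ Y)) =
        K ((hopfCoaction CH Δ).rTensor ΩH ((horizontal CH Δ).subtype.rTensor ΩH Y)) := by
      intro Y
      induction Y with
      | zero => simp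
      | add x y hx hy => simp only [map_add, hx, hy]
      | tmul m θ =>
        change (GradedAlgebra.proj ℋ p).lTensor ΩA (coaction Δ ((m : ΩA) * φ p (P θ))) = _
        rw [coaction_horizontal_mul m.2, lTensor_horizontalMul (proj_incl_mul _),
          (hφ p).proj_coaction, LinearMap.rTensor_tmul, LinearMap.rTensor_tmul,
          Submodule.subtype_apply]
        induction hopfCoaction CH Δ m with
        | zero => simp
        | add x y hx hy => simp only [map_add, LinearMap.add_apply, add_tmul, hx, hy]
        | tmul η h => simp [K, P]
    -- The cotensor identity moves the coaction from the horizontal leg to the left coaction on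
    -- `Ω(H)`, after which `θ₋₁ · P(θ₀) = θ` recovers the leading part.
    have h2 : (GradedAlgebra.proj ℋ p).lTensor ΩA (coaction Δ (μ X')) =
        (GradedAlgebra.proj ℋ p).lTensor ΩA (coaction Δ ω) := by
      rw [h1, hX']
      have h3 : TensorProduct.assoc k ΩA H ΩH ((hopfCoaction CH Δ).rTensor ΩH
          ((GradedAlgebra.proj ℋ p).lTensor ΩA (coaction Δ ω))) =
          (leftCoaction CH ΔH ∘ₗ GradedAlgebra.proj ℋ p).lTensor ΩA (coaction Δ ω) := by
        have h4 := congrArg (map LinearMap.id (map LinearMap.id (GradedAlgebra.proj ℋ p)))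
          (hopfCoaction_cotensor hδ hΔ hΔH ω)
        rw [map_map_assoc_apply, map_id] at h4
        have e1 : map LinearMap.id (GradedAlgebra.proj ℋ p)
            ((hopfCoaction CH Δ).rTensor ΩH (coaction Δ ω)) =
            (hopfCoaction CH Δ).rTensor ΩH ((GradedAlgebra.proj ℋ p).lTensor ΩA (coaction Δ ω)) := by
          change (LinearMap.lTensor (ΩA ⊗[k] H) (GradedAlgebra.proj ℋ p) ∘ₗ
            (hopfCoaction CH Δ).rTensor ΩH) _ = ((hopfCoaction CH Δ).rTensor ΩH ∘ₗ
            (GradedAlgebra.proj ℋ p).lTensor ΩA) _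
          rw [LinearMap.lTensor_comp_rTensor, LinearMap.rTensor_comp_lTensor]
        rw [e1] at h4
        rw [h4]
        change LinearMap.lTensor ΩA (LinearMap.lTensor H _) _ = _
        rw [← LinearMap.comp_apply, ← LinearMap.lTensor_comp]
        congr 2
        ext θ
        exact (leftCoaction_proj hΔH p θ).symm
      rw [LinearMap.comp_apply, LinearEquiv.coe_coe, h3, ← LinearMap.comp_apply,
        ← LinearMap.lTensor_comp]
      congr 2
      ext θ
      simp only [LinearMap.comp_apply]
      rw [LinearMap.lTensor_comp_apply, leftCoaction_mem hΔH
        (show GradedAlgebra.proj ℋ p θ ∈ ℋ p from SetLike.coe_mem _), leftMul_invariantProj hΔH]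
    have h5 : ω - μ X' ∈ Submodule.span k {x | ∃ m ∈ horizontal CH Δ, ∃ n θ, x = m * φ n θ} := by
      refine ih _ (lTensor_truncate_of_succ ?_ ?_)
      · rw [map_sub, map_sub, hω, (hμ X').2]
      · rw [map_sub, map_sub, h2, sub_self]
    simpa using add_mem h5 (hμ X').1

end Sections

/-! ### Injectivity of triangular maps. -/

section Filtered

open DirectSum

/-- A linear map out of a direct sum is injective if it is triangular with injective diagonal. -/
theorem injective_of_triangular {k : Type*} [Field k] {D : ℕ → Type*} [∀ p, AddCommGroup (D p)]
    [∀ p, Module k (D p)] {W W' : Type*} [AddCommGroup W] [Module k W] [AddCommGroup W']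
    [Module k W'] (F : (⨁ p, D p) →ₗ[k] W) (g : ℕ → W →ₗ[k] W')
    (triangular : ∀ p q, p < q → ∀ x, g q (F (lof k ℕ D p x)) = 0)
    (diagonal : ∀ p, Function.Injective fun x => g p (F (lof k ℕ D p x))) :
    Function.Injective F := by
  classical
  rw [injective_iff_map_eq_zero]
  intro z hz
  by_contra hne
  have hs : (DFinsupp.support z).Nonempty := by
    rwa [Finset.nonempty_iff_ne_empty, Ne, DFinsupp.support_eq_empty]
  -- At the highest degree `p` of the support, `g p` annihilates all components except the diagonal
  -- one.
  obtain ⟨p, hp, hmax⟩ := (DFinsupp.support z).exists_max_image id hs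
  have h1 : g p (F z) = g p (F (lof k ℕ D p (z p))) := by
    conv_lhs => rw [← DirectSum.sum_support_of z]
    rw [map_sum, map_sum]
    refine Finset.sum_eq_single_of_mem p hp fun i hi hip => ?_
    exact triangular i p (lt_of_le_of_ne (hmax i hi) hip) _
  have h2 : z p = 0 := by
    refine diagonal p ?_
    simp only [map_zero]
    rw [← h1, hz, map_zero]
  exact DFinsupp.mem_support_iff.1 hp h2

end Filtered

/-! ### Injectivity of the graded canonical map. -/

section Injectivity

open GradedTensorProduct TensorProduct Coalgebra HopfAlgebra
open BalancedTensor hiding map map_tmul tmul_add mk tmul_smul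

variable {k : Type u} [Field k] {A : Type v} [Ring A] [Algebra k A]
  {H : Type v} [Ring H] [HopfAlgebra k H]
  {ΩA : Type v} [Ring ΩA] [Algebra k ΩA] {𝒜 : ℕ → Submodule k ΩA} [GradedAlgebra 𝒜]
  {ΩH : Type v} [Ring ΩH] [Algebra k ΩH] {ℋ : ℕ → Submodule k ΩH} [GradedAlgebra ℋ]
  {CA : DifferentialCalculus k A 𝒜} {CH : DifferentialCalculus k H ℋ}
  {δ : A →ₐ[k] A ⊗[k] H} {Δ : ΩA →ₐ[k] 𝒜 ᵍ⊗[k] ℋ} {ΔH : ΩH →ₐ[k] ℋ ᵍ⊗[k] ℋ}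

theorem IsDGAExtension.incl_mem_baseForms (hΔ : IsDGAExtension CA CH δ Δ) (b : coinvariants δ) :
    CA.incl b ∈ baseForms Δ := by
  rw [AlgHom.mem_equalizer, hΔ.map_incl, coinvariants_apply, map_tmul]
  simp only [AlgHom.toLinearMap_apply, map_one]
  rfl

/-- The map `A ⊗_B A → Ω(A) ⊗_{Ω(B)} Ω(A)`. -/
def inclBalanced (hΔ : IsDGAExtension CA CH δ Δ) :
    BalancedTensor (coinvariants δ) A →ₗ[k] BalancedTensor (baseForms Δ) ΩA :=
  Submodule.liftQ _
    ((balancedRelations (baseForms Δ) ΩA).mkQ ∘ₗ map CA.incl.toLinearMap CA.incl.toLinearMap) (by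
      refine balancedRelations_le _ fun a b a' => ?_
      rw [LinearMap.mem_ker, map_sub, sub_eq_zero]
      have := BalancedTensor.tmul_smul (CA.incl a) (⟨CA.incl b, hΔ.incl_mem_baseForms b⟩ : baseForms Δ)
        (CA.incl a')
      simpa [Subalgebra.smul_def, BalancedTensor.tmul] using this)

@[simp]
theorem inclBalanced_tmul (hΔ : IsDGAExtension CA CH δ Δ) (a a' : A) :
    inclBalanced hΔ (tmul a a') = tmul (CA.incl a) (CA.incl a') := rfl

theorem inclBalanced_lmul (hΔ : IsDGAExtension CA CH δ Δ) (a : A)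
    (z : BalancedTensor (coinvariants δ) A) :
    inclBalanced hΔ (lmul a z) = lmul (CA.incl a) (inclBalanced hΔ z) := by
  induction z using BalancedTensor.induction with
  | zero => simp
  | add x y hx hy => simp only [map_add, hx, hy]
  | tmul x y => simp

theorem gradedGaloisMap_inclBalanced (hΔ : IsDGAExtension CA CH δ Δ)
    (z : BalancedTensor (coinvariants δ) A) :
    gradedGaloisMap Δ (inclBalanced hΔ z) =
      of k 𝒜 ℋ (map CA.incl.toLinearMap CH.incl.toLinearMap (galoisMap δ z)) := by
  induction z using BalancedTensor.induction with
  | zero => simp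
  | add x y hx hy => simp only [map_add, hx, hy]
  | tmul a a' =>
    have h1 : (GradedTensorProduct.includeLeft 𝒜 ℋ (CA.incl a) : 𝒜 ᵍ⊗[k] ℋ) =
        of k 𝒜 ℋ (map CA.incl.toLinearMap CH.incl.toLinearMap (a ⊗ₜ 1)) := by
      simp only [map_tmul, AlgHom.toLinearMap_apply, map_one]
      rfl
    rw [inclBalanced_tmul, canonicalMap_tmul, hΔ.map_incl, canonicalMap_tmul, h1, incl_mul_of,
      Algebra.TensorProduct.includeLeft_apply]
    congr 1
    induction δ a' with
    | zero => simp
    | add x y hx hy => simp only [map_add, mul_add, hx, hy]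
    | tmul x h => simp

/-- The translation map with values in forms. -/
def translationForms (hδ : IsQuantumPrincipalBundle δ) (hΔ : IsDGAExtension CA CH δ Δ) :
    H →ₗ[k] BalancedTensor (baseForms Δ) ΩA :=
  inclBalanced hΔ ∘ₗ translation hδ

theorem gradedGaloisMap_translationForms (hδ : IsQuantumPrincipalBundle δ)
    (hΔ : IsDGAExtension CA CH δ Δ) (h : H) :
    gradedGaloisMap Δ (translationForms hδ hΔ h) = GradedTensorProduct.tmul k 1 (CH.incl h) := by
  rw [translationForms, LinearMap.comp_apply, gradedGaloisMap_inclBalanced, galoisMap_translation,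
    map_tmul]
  simp [GradedTensorProduct.tmul]

/-- `1 ⊗ a = a₀ τ(a₁)`. -/
theorem tmul_one_incl (hδ : IsQuantumPrincipalBundle δ) (hΔ : IsDGAExtension CA CH δ Δ) (a : A) :
    tmul 1 (CA.incl a) = TensorProduct.lift ((lmulHom (baseForms Δ) ΩA ∘ₗ
      CA.incl.toLinearMap).compl₂ (translationForms hδ hΔ)) (δ a) := by
  let Q : A ⊗[k] H →ₗ[k] BalancedTensor (coinvariants δ) A :=
    TensorProduct.lift ((lmulHom (coinvariants δ) A).compl₂ (translation hδ))
  have h1 : ∀ W, galoisMap δ (Q W) = W := by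
    intro W
    induction W with
    | zero => simp
    | add x y hx hy => simp only [map_add, hx, hy]
    | tmul a h =>
      simp only [Q, TensorProduct.lift.tmul, LinearMap.compl₂_apply, lmulHom_apply]
      rw [canonicalMap_lmul, galoisMap_translation]
      simp
  have h2 : Q (δ a) = tmul 1 a := by
    apply hδ.bijective.1
    rw [h1, canonicalMap_tmul, map_one, one_mul]
  rw [← map_one CA.incl, ← inclBalanced_tmul hΔ, ← h2]
  induction δ a with
  | zero => simp
  | add x y hx hy => simp only [map_add, hx, hy]
  | tmul a h =>
    simp only [Q, TensorProduct.lift.tmul, LinearMap.compl₂_apply, lmulHom_apply,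
      inclBalanced_lmul]
    rfl

section Commutation

variable [Module A ΩA] [IsScalarTower k A ΩA]

/-- The map `A ⊗_B Ω(A) → Ω(A) ⊗_{Ω(B)} Ω(A)`. -/
def inclLeftBalanced (hact : ∀ (a : A) (ω : ΩA), a • ω = CA.incl a * ω)
    (hΔ : IsDGAExtension CA CH δ Δ) :
    BalancedTensor (coinvariants δ) ΩA →ₗ[k] BalancedTensor (baseForms Δ) ΩA :=
  Submodule.liftQ _
    ((balancedRelations (baseForms Δ) ΩA).mkQ ∘ₗ CA.incl.toLinearMap.rTensor ΩA) (by
      refine balancedRelations_le _ fun a b ω => ?_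
      rw [LinearMap.mem_ker, map_sub, sub_eq_zero]
      have := BalancedTensor.tmul_smul (CA.incl a) (⟨CA.incl b, hΔ.incl_mem_baseForms b⟩ : baseForms Δ) ω
      simpa [Subalgebra.smul_def, BalancedTensor.tmul, hact] using this)

theorem hopfAct_incl (hact : ∀ (a : A) (ω : ΩA), a • ω = CA.incl a * ω) (a : A) (W : ΩA ⊗[k] H) :
    hopfAct k H A ΩA (a ⊗ₜ 1) W = (CA.incl a ⊗ₜ 1) * W := by
  induction W with
  | zero => simp
  | add x y hx hy => simp only [map_add, mul_add, hx, hy]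
  | tmul ω h => simp [hact]

/-- With `m = ∑ a b` and `b` base forms, `m ⊗ η = ∑ a ⊗ b η`: the left leg can be brought into `A`,
where descent applies. -/
theorem exists_inclLeftBalanced (hact : ∀ (a : A) (ω : ΩA), a • ω = CA.incl a * ω)
    (hS : Function.Bijective (antipode k (A := H))) (hδ : IsQuantumPrincipalBundle δ)
    (hΔ : IsDGAExtension CA CH δ Δ)
    (hΔH : IsDGAExtension CH CH (Bialgebra.comulAlgHom k H) ΔH)
    (hρ : IsHopfModule δ (hopfCoaction CH Δ)) {m : ΩA} (hm : m ∈ horizontal CH Δ) (η : ΩA) :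
    ∃ u, inclLeftBalanced hact hΔ u = tmul m η ∧
      hopfModuleMap hρ u = (m ⊗ₜ 1) * hopfCoaction CH Δ η := by
  have hspan := horizontal_le_span hact hS hδ hΔ hΔH hm
  clear hm
  induction hspan using Submodule.span_induction with
  | zero => exact ⟨0, by simpa using ((BalancedTensor.mk _ ΩA).map_zero₂ η).symm, by simp⟩
  | add x y _ _ hx hy =>
    obtain ⟨u, hu, hu'⟩ := hx
    obtain ⟨w, hw, hw'⟩ := hy
    refine ⟨u + w, ?_, ?_⟩
    · rw [map_add, hu, hw]
      exact ((BalancedTensor.mk _ ΩA).map_add₂ x y η).symm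
    · rw [map_add, hu', hw', TensorProduct.add_tmul, add_mul]
  | smul c x _ hx =>
    obtain ⟨u, hu, hu'⟩ := hx
    refine ⟨c • u, ?_, ?_⟩
    · rw [map_smul, hu]
      exact ((BalancedTensor.mk _ ΩA).map_smul₂ c x η).symm
    · rw [map_smul, hu', ← smul_tmul', smul_mul_assoc]
  | mem x hx =>
    obtain ⟨a, b, hb, rfl⟩ := hx
    refine ⟨tmul a (b * η), ?_, ?_⟩
    · exact (BalancedTensor.tmul_smul (CA.incl a) (⟨b, hb⟩ : baseForms Δ) η).symm
    · obtain ⟨hb1, hb2⟩ := baseForms_mem_horizontal (CH := CH) hb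
      rw [hopfModuleMap_tmul, hopfAct_incl hact, hopfCoaction_horizontal_mul hb1, hb2, ← mul_assoc]
      simp

/-- The translation map commutes with base forms. -/
theorem lmul_translationForms (hact : ∀ (a : A) (ω : ΩA), a • ω = CA.incl a * ω)
    (hS : Function.Bijective (antipode k (A := H))) (hδ : IsQuantumPrincipalBundle δ)
    (hΔ : IsDGAExtension CA CH δ Δ)
    (hΔH : IsDGAExtension CH CH (Bialgebra.comulAlgHom k H) ΔH) {b : ΩA} (hb : b ∈ baseForms Δ)
    (h : H) : lmul b (translationForms hδ hΔ h) = rmul b (translationForms hδ hΔ h) := by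
  have hρ := isHopfModule_forms hact hδ.comoduleAlgebra hΔ hΔH
  obtain ⟨hb1, hb2⟩ := baseForms_mem_horizontal (CH := CH) hb
  let I : A ⊗[k] H →ₐ[k] ΩA ⊗[k] H := Algebra.TensorProduct.map CA.incl (AlgHom.id k H)
  have hI : ∀ a, hopfCoaction CH Δ (CA.incl a) = I (δ a) := hopfCoaction_incl hΔ
  -- Both `b τ(h)` and `τ(h) b` lift to `A ⊗_B Ω(A)`, and the injective Hopf module map sends both
  -- lifts to `b ⊗ h`.
  have h1 : ∀ z, ∃ u, inclLeftBalanced hact hΔ u = lmul b (inclBalanced hΔ z) ∧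
      hopfModuleMap hρ u = (b ⊗ₜ 1) * I (galoisMap δ z) := by
    intro z
    induction z using BalancedTensor.induction with
    | zero => exact ⟨0, by simp, by simp⟩
    | add x y hx hy =>
      obtain ⟨u, hu, hu'⟩ := hx
      obtain ⟨w, hw, hw'⟩ := hy
      exact ⟨u + w, by simp only [map_add, hu, hw], by simp only [map_add, mul_add, hu', hw']⟩
    | tmul a a' =>
      obtain ⟨u, hu, hu'⟩ := exists_inclLeftBalanced hact hS hδ hΔ hΔH hρ
        (mul_mem_horizontal hb1 (incl_mem_horizontal hΔ a)) (CA.incl a')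
      refine ⟨u, hu, ?_⟩
      rw [hu', hI, canonicalMap_tmul, map_mul, ← mul_assoc]
      simp [I]
  have h2 : ∀ z, ∃ u, inclLeftBalanced hact hΔ u = rmul b (inclBalanced hΔ z) ∧
      hopfModuleMap hρ u = I (galoisMap δ z) * (b ⊗ₜ 1) := by
    intro z
    induction z using BalancedTensor.induction with
    | zero => exact ⟨0, by simp, by simp⟩
    | add x y hx hy =>
      obtain ⟨u, hu, hu'⟩ := hx
      obtain ⟨w, hw, hw'⟩ := hy
      exact ⟨u + w, by simp only [map_add, hu, hw], by simp only [map_add, add_mul, hu', hw']⟩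
    | tmul a a' =>
      refine ⟨tmul a (CA.incl a' * b), rfl, ?_⟩
      rw [hopfModuleMap_tmul, hopfAct_incl hact,
        hopfCoaction_horizontal_mul (incl_mem_horizontal hΔ a'), hb2, hI, canonicalMap_tmul,
        map_mul, ← mul_assoc]
      simp [I]
  obtain ⟨u, hu, hu'⟩ := h1 (translation hδ h)
  obtain ⟨w, hw, hw'⟩ := h2 (translation hδ h)
  rw [translationForms, LinearMap.comp_apply, ← hu, ← hw]
  congr 1
  apply hopfModuleMap_injective hS hδ hρ
  rw [hu', hw', galoisMap_translation]
  simp [I]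

end Commutation

variable (φ : ∀ n, leftInvariant CH ΔH n →ₗ[k] ΩA)

/-- The map `ω ⊗ h ⊗ θ ↦ ω τ(h) φ(θ)`. -/
def translateSection (hδ : IsQuantumPrincipalBundle δ) (hΔ : IsDGAExtension CA CH δ Δ) (n : ℕ) :
    ΩA ⊗[k] (H ⊗[k] leftInvariant CH ΔH n) →ₗ[k] BalancedTensor (baseForms Δ) ΩA :=
  TensorProduct.lift ((lmulHom (baseForms Δ) ΩA).compl₂
    (TensorProduct.lift (((rmulHom (baseForms Δ)).flip ∘ₗ translationForms hδ hΔ).compl₂ (φ n))))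

variable {φ}

@[simp]
theorem translateSection_tmul (hδ : IsQuantumPrincipalBundle δ) (hΔ : IsDGAExtension CA CH δ Δ)
    (n : ℕ) (ω : ΩA) (h : H) (θ : leftInvariant CH ΔH n) :
    translateSection φ hδ hΔ n (ω ⊗ₜ (h ⊗ₜ θ)) =
      lmul ω (rmul (φ n θ) (translationForms hδ hΔ h)) := rfl

theorem gradedGaloisMap_translateSection (hδ : IsQuantumPrincipalBundle δ)
    (hΔ : IsDGAExtension CA CH δ Δ) (n : ℕ) (ω : ΩA) (h : H) (θ : leftInvariant CH ΔH n) :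
    gradedGaloisMap Δ (translateSection φ hδ hΔ n (ω ⊗ₜ (h ⊗ₜ θ))) =
      of k 𝒜 ℋ (horizontalMul ΩA CH (ω ⊗ₜ h) (coaction Δ (φ n θ))) := by
  rw [translateSection_tmul, canonicalMap_lmul, canonicalMap_rmul,
    gradedGaloisMap_translationForms, ← mul_assoc, ← of_horizontal_mul, of_coaction]
  congr 1
  have h1 : (GradedTensorProduct.includeLeft 𝒜 ℋ ω : 𝒜 ᵍ⊗[k] ℋ) =
    GradedTensorProduct.tmul k ω 1 := rfl
  rw [h1, tmul_mul_tmul_right_zero ω 1 _ (SetLike.one_mem_graded ℋ), mul_one, one_mul]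
  rfl

/-- The graded canonical map is injective. -/
theorem gradedGaloisMap_injective_of_section
    (hφ : ∀ n, IsVerticalSection CH Δ ΔH n (φ n))
    (hspan : ∀ ω : ΩA, ω ∈ Submodule.span k {x | ∃ m ∈ horizontal CH Δ, ∃ n θ, x = m * φ n θ})
    (hhor : ∀ m ∈ horizontal CH Δ,
      m ∈ Submodule.span k {x | ∃ (a : A) (b : ΩA), b ∈ baseForms Δ ∧ x = CA.incl a * b})
    (hδ : IsQuantumPrincipalBundle δ) (hΔ : IsDGAExtension CA CH δ Δ)
    (hcomm : ∀ b ∈ baseForms Δ, ∀ h,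
      lmul b (translationForms hδ hΔ h) = rmul b (translationForms hδ hΔ h))
    (hΔH : IsDGAExtension CH CH (Bialgebra.comulAlgHom k H) ΔH) :
    Function.Injective (gradedGaloisMap Δ) := by
  -- A surjective `Ξ` whose composite with `χ^•` is injective makes `χ^•` injective.
  let Ξ : DirectSum ℕ (fun n => ΩA ⊗[k] (H ⊗[k] leftInvariant CH ΔH n)) →ₗ[k]
      BalancedTensor (baseForms Δ) ΩA := DirectSum.toModule k ℕ _ (translateSection φ hδ hΔ)
  have hΞ : ∀ n x, Ξ (DirectSum.lof k ℕ _ n x) = translateSection φ hδ hΔ n x := fun n x =>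
    DirectSum.toModule_lof (M := fun n => ΩA ⊗[k] (H ⊗[k] leftInvariant CH ΔH n)) k n x
  have hinj : Function.Injective (gradedGaloisMap Δ ∘ₗ Ξ) := by
    have hF : ∀ n x, (gradedGaloisMap Δ ∘ₗ Ξ) (DirectSum.lof k ℕ _ n x) =
        gradedGaloisMap Δ (translateSection φ hδ hΔ n x) := fun n x => by
      rw [LinearMap.comp_apply, hΞ]
    -- Triangularity is for the degree in `Ω(H)`: a value of `φ p` has no component above `p`, and
    -- its component at `p` is `1 ⊗ θ`.
    refine injective_of_triangular _ (fun q => (GradedAlgebra.proj ℋ q).lTensor ΩA ∘ₗ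
      (of k 𝒜 ℋ).symm.toLinearMap) (fun p q hpq x => ?_) (fun p => ?_)
    · rw [hF]
      have h1 : ∀ θ, (GradedAlgebra.proj ℋ q).lTensor ΩA (coaction Δ (φ p θ)) = 0 := fun θ => by
        rw [lTensor_eq_of_truncate (g := 0) (fun r hr θ hθ => ?_)
          (lTensor_truncate_coaction hΔ ((hφ p).mem θ)), LinearMap.lTensor_zero,
          LinearMap.zero_apply]
        exact DirectSum.decompose_of_mem_ne ℋ hθ (by omega)
      induction x with
      | zero => simp
      | add x y hx hy => simp only [map_add, hx, hy, add_zero]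
      | tmul ω y =>
        induction y with
        | zero => simp
        | add x y hx hy => simp only [TensorProduct.tmul_add, map_add, hx, hy, add_zero]
        | tmul h θ =>
          rw [gradedGaloisMap_translateSection, LinearMap.comp_apply, LinearEquiv.coe_coe,
            LinearEquiv.symm_apply_apply, lTensor_horizontalMul (proj_incl_mul _), h1, map_zero]
    · have h1 : (GradedAlgebra.proj ℋ p).lTensor ΩA ∘ₗ (of k 𝒜 ℋ).symm.toLinearMap ∘ₗ
          gradedGaloisMap Δ ∘ₗ translateSection φ hδ hΔ p =
          (invariantMul CH ΔH p).lTensor ΩA := by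
        refine TensorProduct.ext' fun ω y => ?_
        induction y with
        | zero => simp
        | add x y hx hy => simp only [TensorProduct.tmul_add, map_add, hx, hy]
        | tmul h θ =>
          simp only [LinearMap.comp_apply]
          rw [gradedGaloisMap_translateSection, LinearEquiv.coe_coe,
            LinearEquiv.symm_apply_apply, lTensor_horizontalMul (proj_incl_mul _),
            (hφ p).proj_coaction, horizontalMul_tmul, mul_one]
          rfl
      have h2 := Module.Flat.lTensor_preserves_injective_linearMap (M := ΩA) _
        (invariantMul_injective hΔH p)
      rw [← h1] at h2
      convert h2 using 2 with x
      rw [hF]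
      rfl
  have hsurj : LinearMap.range Ξ = ⊤ := by
    have hmem : ∀ n ω h (θ : leftInvariant CH ΔH n),
        lmul ω (rmul (φ n θ) (translationForms hδ hΔ h)) ∈ LinearMap.range Ξ := fun n ω h θ =>
      ⟨DirectSum.lof k ℕ _ n (ω ⊗ₜ (h ⊗ₜ θ)), by rw [hΞ, translateSection_tmul]⟩
    -- `ω ⊗ a b φ(θ) = ω a₀ τ(a₁) b φ(θ) = ω a₀ b τ(a₁) φ(θ)`, the last step by commutation of `b`
    -- with the translation map.
    have hab : ∀ ω a, ∀ b ∈ baseForms Δ, ∀ n (θ : leftInvariant CH ΔH n),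
        lmul ω (rmul (φ n θ) (rmul b (tmul 1 (CA.incl a)))) ∈ LinearMap.range Ξ := by
      intro ω a b hb n θ
      rw [tmul_one_incl hδ hΔ]
      induction δ a with
      | zero => simp
      | add x y hx hy => simpa only [map_add] using add_mem hx hy
      | tmul x h =>
        have := hmem n (ω * CA.incl x * b) h θ
        simp only [TensorProduct.lift.tmul, LinearMap.compl₂_apply, LinearMap.comp_apply,
          lmulHom_apply, AlgHom.toLinearMap_apply]
        rwa [← lmul_rmul, ← hcomm b hb, ← lmul_rmul, ← lmul_rmul, ← lmul_mul, ← lmul_mul]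
    rw [eq_top_iff]
    rintro z -
    induction z using BalancedTensor.induction with
    | zero => exact zero_mem _
    | add x y hx hy => exact add_mem hx hy
    | tmul ω η =>
      have h1 : Submodule.span k {x | ∃ m ∈ horizontal CH Δ, ∃ n θ, x = m * φ n θ} ≤
          (LinearMap.range Ξ).comap (BalancedTensor.mk (baseForms Δ) ΩA ω) := by
        refine Submodule.span_le.2 ?_
        rintro _ ⟨m, hm, n, θ, rfl⟩
        have h2 : Submodule.span k {x | ∃ (a : A) (b : ΩA), b ∈ baseForms Δ ∧ x = CA.incl a * b} ≤
            (LinearMap.range Ξ).comap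
              (BalancedTensor.mk (baseForms Δ) ΩA ω ∘ₗ LinearMap.mulRight k (φ n θ)) := by
          refine Submodule.span_le.2 ?_
          rintro _ ⟨a, b, hb, rfl⟩
          have := hab ω a b hb n θ
          simpa using this
        exact h2 (hhor m hm)
      exact h1 (hspan η)
  rw [LinearMap.range_eq_top] at hsurj
  intro x y hxy
  obtain ⟨x, rfl⟩ := hsurj x
  obtain ⟨y, rfl⟩ := hsurj y
  rw [hinj hxy]

theorem gradedGaloisMap_injective
    (hS : Function.Bijective (antipode k (A := H))) (hδ : IsQuantumPrincipalBundle δ)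
    (hΔ : IsDGAExtension CA CH δ Δ)
    (hΔH : IsDGAExtension CH CH (Bialgebra.comulAlgHom k H) ΔH) :
    Function.Injective (gradedGaloisMap Δ) := by
  let _ : Module A ΩA := Module.compHom ΩA CA.incl.toRingHom
  have hact : ∀ (a : A) (ω : ΩA), a • ω = CA.incl a * ω := fun _ _ => rfl
  have _ : IsScalarTower k A ΩA := ⟨fun c a ω => by rw [hact, hact, map_smul, smul_mul_assoc]⟩
  choose φ hφ using exists_verticalSection hact hS hδ hΔ hΔH
  exact gradedGaloisMap_injective_of_section hφ
    (mem_span_horizontal_mul hδ.comoduleAlgebra hΔ hΔH hφ)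
    (fun m hm => horizontal_le_span hact hS hδ hΔ hΔH hm) hδ hΔ
    (fun b hb h => lmul_translationForms hact hS hδ hΔ hΔH hb h) hΔH

end Injectivity

/-! ### The inside-out rule, surjectivity and degrees. -/

section Translation

open GradedTensorProduct TensorProduct Coalgebra HopfAlgebra
open BalancedTensor hiding map map_tmul tmul_add mk tmul_smul

variable {k : Type u} [Field k] {A : Type v} [Ring A] [Algebra k A]
  {H : Type v} [Ring H] [HopfAlgebra k H]
  {ΩA : Type v} [Ring ΩA] [Algebra k ΩA] {𝒜 : ℕ → Submodule k ΩA} [GradedAlgebra 𝒜]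
  {ΩH : Type v} [Ring ΩH] [Algebra k ΩH] {ℋ : ℕ → Submodule k ΩH} [GradedAlgebra ℋ]
  {CA : DifferentialCalculus k A 𝒜} {CH : DifferentialCalculus k H ℋ}
  {δ : A →ₐ[k] A ⊗[k] H} {Δ : ΩA →ₐ[k] 𝒜 ᵍ⊗[k] ℋ} {ΔH : ΩH →ₐ[k] ℋ ᵍ⊗[k] ℋ}

theorem includeLeft_mul_tmul (ω η : ΩA) (θ : ΩH) :
    (GradedTensorProduct.includeLeft 𝒜 ℋ ω * GradedTensorProduct.tmul k η θ : 𝒜 ᵍ⊗[k] ℋ) =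
      GradedTensorProduct.tmul k (ω * η) θ := by
  have h := tmul_mul_tmul_right_zero (𝒜 := 𝒜) (k := k) ω η θ (SetLike.one_mem_graded ℋ)
  rw [one_mul] at h
  exact h

theorem includeLeft_mul_of (ω : ΩA) (X : ΩA ⊗[k] ΩH) :
    (GradedTensorProduct.includeLeft 𝒜 ℋ ω * of k 𝒜 ℋ X : 𝒜 ᵍ⊗[k] ℋ) =
      of k 𝒜 ℋ ((LinearMap.mulLeft k ω).rTensor ΩH X) := by
  induction X with
  | zero => simp
  | add x y hx hy => simp only [map_add, mul_add, hx, hy]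
  | tmul η θ => exact includeLeft_mul_tmul ω η θ

variable (CA CH) in
/-- The map `a ⊗ h ↦ (-1)ⁿ da ⊗ θ h + a ⊗ θ dh`. -/
def insideOut (n : ℕ) (θ : ΩH) : A ⊗[k] H →ₗ[k] ΩA ⊗[k] ΩH :=
  (-1 : k) ^ n • map (CA.d ∘ₗ CA.incl.toLinearMap) (CH.rightMul.flip θ) +
    map CA.incl.toLinearMap (CH.rightMulD.flip θ)

/-- Moving `da'₀` past `θ` produces the sign `(-1)ⁿ`, so it combines with the `da` term into `(-1)ⁿ
d(a a'₀) ⊗ θ a'₁`. Hence only `χ(a ⊗ a')` matters. -/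
theorem gradedGaloisMap_insideOut (hΔ : IsDGAExtension CA CH δ Δ) {n : ℕ} {θ : ΩH} (hθ : θ ∈ ℋ n)
    {z : BalancedTensor (baseForms Δ) ΩA}
    (hz : gradedGaloisMap Δ z = GradedTensorProduct.tmul k 1 θ) (a a' : A) :
    gradedGaloisMap Δ ((-1 : k) ^ n • lmul (CA.d (CA.incl a)) (rmul (CA.incl a') z) +
        lmul (CA.incl a) (rmul (CA.d (CA.incl a')) z)) =
      of k 𝒜 ℋ (insideOut CA CH n θ (galoisMap δ (BalancedTensor.tmul a a'))) := by
  have hz' : gradedGaloisMap Δ z = of k 𝒜 ℋ (1 ⊗ₜ θ) := hz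
  rw [map_add, map_smul, canonicalMap_lmul, canonicalMap_lmul, canonicalMap_rmul,
    canonicalMap_rmul, hz', hΔ.map_d, hΔ.map_incl, of_mul_incl, of_mul_d_incl, includeLeft_mul_of,
    includeLeft_mul_of, ← map_smul, ← map_add, canonicalMap_tmul,
    Algebra.TensorProduct.includeLeft_apply]
  congr 1
  induction δ a' with
  | zero => simp
  | add x y hx hy =>
    simp only [map_add, LinearMap.add_apply, smul_add, mul_add, ← hx, ← hy]
    abel
  | tmul x h =>
    have hl := CA.leibniz 0 (CA.incl a) (CA.incl x) (CA.incl_mem a)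
    rw [pow_zero, one_smul] at hl
    simp only [insideOut, tensorRightMul_tmul, tensorRightMulD_tmul, map_add,
      LinearMap.rTensor_tmul, LinearMap.mulLeft_apply, one_mul, LinearMap.add_apply,
      LinearMap.smul_apply, Algebra.TensorProduct.tmul_mul_tmul, map_tmul, LinearMap.comp_apply,
      AlgHom.toLinearMap_apply, map_mul, hl, LinearMap.flip_apply, add_tmul, smul_add,
      DifferentialCalculus.rightMul_apply, DifferentialCalculus.rightMulD_apply,
      gradingInvolution_apply hθ, smul_mul_assoc, tmul_smul, map_smul]
    abel

/-- After summation `χ(a ⊗ a')` becomes `1 ⊗ g`, and the signed term disappears because `d1 = 0`. -/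
theorem gradedGaloisMap_sum_insideOut (hδ : IsQuantumPrincipalBundle δ)
    (hΔ : IsDGAExtension CA CH δ Δ) {n : ℕ} {θ : ΩH} (hθ : θ ∈ ℋ n)
    {z : BalancedTensor (baseForms Δ) ΩA}
    (hz : gradedGaloisMap Δ z = GradedTensorProduct.tmul k 1 θ) {g : H} {m : ℕ} {a a' : Fin m → A}
    (hτ : translationMap hδ g = ∑ i, BalancedTensor.tmul (a i) (a' i)) :
    gradedGaloisMap Δ (∑ i,
      ((-1 : k) ^ n • lmul (CA.d (CA.incl (a i))) (rmul (CA.incl (a' i)) z) +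
        lmul (CA.incl (a i)) (rmul (CA.d (CA.incl (a' i))) z))) =
      GradedTensorProduct.tmul k 1 (θ * CH.d (CH.incl g)) := by
  simp only [map_sum, gradedGaloisMap_insideOut hΔ hθ hz]
  simp only [← map_sum, ← hτ, ← translation_apply, galoisMap_translation]
  simp [insideOut, CA.d_one, GradedTensorProduct.tmul]

theorem gradedGaloisMap_sum_incl (hδ : IsQuantumPrincipalBundle δ)
    (hΔ : IsDGAExtension CA CH δ Δ) {g : H} {m : ℕ} {a a' : Fin m → A}
    (hτ : translationMap hδ g = ∑ i, BalancedTensor.tmul (a i) (a' i)) :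
    gradedGaloisMap Δ (∑ i, BalancedTensor.tmul (CA.incl (a i)) (CA.incl (a' i))) =
      GradedTensorProduct.tmul k 1 (CH.incl g) := by
  rw [← gradedGaloisMap_translationForms hδ hΔ, translationForms, LinearMap.comp_apply,
    translation_apply, hτ, map_sum (inclBalanced hΔ)]
  rfl

/-- The graded canonical map is surjective. -/
theorem gradedGaloisMap_surjective (hδ : IsQuantumPrincipalBundle δ)
    (hΔ : IsDGAExtension CA CH δ Δ) : Function.Surjective (gradedGaloisMap Δ) := by
  have h1 : ∀ θ : ΩH, GradedTensorProduct.tmul k 1 θ ∈ LinearMap.range (gradedGaloisMap Δ) := by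
    intro θ
    let P : Submodule k ΩH := (LinearMap.range (gradedGaloisMap Δ)).comap
      ((of k 𝒜 ℋ).toLinearMap ∘ₗ TensorProduct.mk k ΩA ΩH 1)
    induction θ using graded_induction ℋ with
    | zero => simp [GradedTensorProduct.tmul]
    | add x y hx hy => exact (P.add_mem hx hy :)
    | homogeneous n θ hθ =>
      -- The inside-out rule turns a preimage of `1 ⊗ θ` into one of `1 ⊗ θ dg`.
      refine CH.induction_mem (P := fun _ => P)
        (fun h => ⟨_, gradedGaloisMap_translationForms hδ hΔ h⟩) (fun n θ g hθ hz => ?_) n hθ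
      obtain ⟨z, hz⟩ := hz
      obtain ⟨m, a, a', h⟩ := BalancedTensor.exists_sum (translationMap hδ g)
      exact ⟨_, gradedGaloisMap_sum_insideOut hδ hΔ hθ hz h⟩
  intro x
  obtain ⟨x, rfl⟩ := (of k 𝒜 ℋ).surjective x
  induction x with
  | zero => exact ⟨0, by simp⟩
  | add x y hx hy =>
    obtain ⟨x', hx⟩ := hx
    obtain ⟨y', hy⟩ := hy
    exact ⟨x' + y', by rw [map_add, map_add, hx, hy]⟩
  | tmul ω θ =>
    obtain ⟨z, hz⟩ := h1 θ
    refine ⟨lmul ω z, ?_⟩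
    rw [canonicalMap_lmul, hz, includeLeft_mul_tmul, mul_one]

theorem lmul_mem_balancedDegree {r n : ℕ} {ω : ΩA} (hω : ω ∈ 𝒜 r)
    {z : BalancedTensor (baseForms Δ) ΩA} (hz : z ∈ balancedDegree Δ n) :
    lmul ω z ∈ balancedDegree Δ (r + n) := by
  have h : balancedDegree Δ n ≤ (balancedDegree Δ (r + n)).comap (lmul ω) := by
    refine Submodule.span_le.2 ?_
    rintro _ ⟨s, t, η, η', rfl, hη, hη', rfl⟩
    exact Submodule.subset_span ⟨r + s, t, _, _, add_assoc r s t, SetLike.mul_mem_graded hω hη,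
      hη', rfl⟩
  exact h hz

theorem rmul_mem_balancedDegree {r n : ℕ} {ω : ΩA} (hω : ω ∈ 𝒜 r)
    {z : BalancedTensor (baseForms Δ) ΩA} (hz : z ∈ balancedDegree Δ n) :
    rmul ω z ∈ balancedDegree Δ (n + r) := by
  have h : balancedDegree Δ n ≤ (balancedDegree Δ (n + r)).comap (rmul ω) := by
    refine Submodule.span_le.2 ?_
    rintro _ ⟨s, t, η, η', rfl, hη, hη', rfl⟩
    exact Submodule.subset_span ⟨s, t + r, _, _, (add_assoc s t r).symm, hη,
      SetLike.mul_mem_graded hη' hω, rfl⟩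
  exact h hz

theorem map_balancedDegree_le (hΔ : IsDGAExtension CA CH δ Δ) (n : ℕ) :
    (balancedDegree Δ n).map (gradedGaloisMap Δ) ≤ tensorDegree 𝒜 ℋ n := by
  rw [Submodule.map_le_iff_le_comap]
  refine Submodule.span_le.2 ?_
  rintro _ ⟨r, s, ω, η, rfl, hω, hη, rfl⟩
  have h : tensorDegree 𝒜 ℋ s ≤ (tensorDegree 𝒜 ℋ (r + s)).comap
      (LinearMap.mulLeft k (GradedTensorProduct.includeLeft 𝒜 ℋ ω)) := by
    refine Submodule.span_le.2 ?_
    rintro _ ⟨s, t, η, θ, rfl, hη, hθ, rfl⟩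
    exact Submodule.subset_span ⟨r + s, t, ω * η, θ, add_assoc r s t,
      SetLike.mul_mem_graded hω hη, hθ, includeLeft_mul_tmul ω η θ⟩
  rw [SetLike.mem_coe, Submodule.mem_comap, canonicalMap_tmul]
  exact h (hΔ.map_degree s η hη)

/-- An extended translation map takes values in the correct degree. -/
theorem IsExtendedTranslationMap.mem_balancedDegree {hδ : IsQuantumPrincipalBundle δ}
    {τ : ΩH →ₗ[k] BalancedTensor (baseForms Δ) ΩA} (hτ : IsExtendedTranslationMap hδ CA CH Δ τ)
    {n : ℕ} {θ : ΩH} (hθ : θ ∈ ℋ n) : τ θ ∈ balancedDegree Δ n := by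
  refine CH.induction_mem (P := fun n => (balancedDegree Δ n).comap τ) (fun g => ?_)
    (fun n θ g hθ h => ?_) n hθ
  · obtain ⟨m, a, a', h⟩ := BalancedTensor.exists_sum (translationMap hδ g)
    rw [Submodule.mem_comap, hτ.zero_form g m a a' h]
    exact sum_mem fun i _ => Submodule.subset_span
      ⟨0, 0, _, _, rfl, CA.incl_mem _, CA.incl_mem _, rfl⟩
  · obtain ⟨m, a, a', ha⟩ := BalancedTensor.exists_sum (translationMap hδ g)
    rw [Submodule.mem_comap, hτ.mul_d n θ hθ g m a a' ha]
    refine sum_mem fun i _ => add_mem (Submodule.smul_mem _ _ ?_) ?_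
    · rw [add_comm]
      exact lmul_mem_balancedDegree (CA.d_incl_mem _) (rmul_mem_balancedDegree (CA.incl_mem _) h)
    · rw [← zero_add (n + 1)]
      exact lmul_mem_balancedDegree (CA.incl_mem _) (rmul_mem_balancedDegree (CA.d_incl_mem _) h)

theorem IsExtendedTranslationMap.unique {hδ : IsQuantumPrincipalBundle δ}
    {τ τ' : ΩH →ₗ[k] BalancedTensor (baseForms Δ) ΩA}
    (hτ : IsExtendedTranslationMap hδ CA CH Δ τ) (hτ' : IsExtendedTranslationMap hδ CA CH Δ τ') :
    τ = τ' := by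
  refine linearMap_ext_graded ℋ fun n θ hθ => ?_
  refine CH.induction_mem (P := fun _ => LinearMap.eqLocus τ τ') (fun g => ?_)
    (fun n θ g hθ h => ?_) n hθ
  · obtain ⟨m, a, a', ha⟩ := BalancedTensor.exists_sum (translationMap hδ g)
    exact (hτ.zero_form g m a a' ha).trans (hτ'.zero_form g m a a' ha).symm
  · obtain ⟨m, a, a', ha⟩ := BalancedTensor.exists_sum (translationMap hδ g)
    have h' : τ θ = τ' θ := h
    change τ _ = τ' _
    rw [hτ.mul_d n θ hθ g m a a' ha, hτ'.mul_d n θ hθ g m a a' ha, h']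

/-- Both sides of each rule have the same image under the injective `χ^•`, whichever representative
of `τ(g)` is used; independence of the choice needs no separate argument. -/
theorem isExtendedTranslationMap_of_rightInverse (hδ : IsQuantumPrincipalBundle δ)
    (hΔ : IsDGAExtension CA CH δ Δ) (hinj : Function.Injective (gradedGaloisMap Δ))
    {τ : ΩH →ₗ[k] BalancedTensor (baseForms Δ) ΩA}
    (hτ : ∀ θ, gradedGaloisMap Δ (τ θ) = GradedTensorProduct.tmul k 1 θ) :
    IsExtendedTranslationMap hδ CA CH Δ τ where
  zero_form g m a a' h := hinj (by rw [hτ, gradedGaloisMap_sum_incl hδ hΔ h])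
  mul_d n θ hθ g m a a' h := hinj (by
    rw [hτ, gradedGaloisMap_sum_insideOut hδ hΔ hθ (hτ θ) h])

end Translation
end QPB

end

/-! ### Assembly of the theorem. -/

open QPB in
theorem theorem5p3 {k : Type u} [Field k]
    {H : Type v} [Ring H] [HopfAlgebra k H]
    (hS : Function.Bijective (HopfAlgebra.antipode k (A := H)))
    {A : Type v} [Ring A] [Algebra k A] (δ : A →ₐ[k] A ⊗[k] H)
    (hδ : IsQuantumPrincipalBundle δ)
    {ΩH : Type v} [Ring ΩH] [Algebra k ΩH] (ℋ : ℕ → Submodule k ΩH) [GradedAlgebra ℋ]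
    (CH : DifferentialCalculus k H ℋ) (hCH : IsComplete CH)
    {ΩA : Type v} [Ring ΩA] [Algebra k ΩA] (𝒜 : ℕ → Submodule k ΩA) [GradedAlgebra 𝒜]
    (CA : DifferentialCalculus k A 𝒜)
    (Δ : ΩA →ₐ[k] 𝒜 ᵍ⊗[k] ℋ) (hΔ : IsDGAExtension CA CH δ Δ) :
    Function.Bijective (gradedGaloisMap Δ) ∧
    (∀ n : ℕ, (balancedDegree Δ n).map (gradedGaloisMap Δ) = tensorDegree 𝒜 ℋ n) ∧
    ∃ τ' : ΩH →ₗ[k] BalancedTensor (baseForms Δ) ΩA,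
      IsExtendedTranslationMap hδ CA CH Δ τ' ∧
      (∀ τ'' : ΩH →ₗ[k] BalancedTensor (baseForms Δ) ΩA,
        IsExtendedTranslationMap hδ CA CH Δ τ'' → τ'' = τ') ∧
      (∀ (n : ℕ) (θ : ΩH), θ ∈ ℋ n → τ' θ ∈ balancedDegree Δ n) ∧
      ∃ χinv : (𝒜 ᵍ⊗[k] ℋ) →ₗ[k] BalancedTensor (baseForms Δ) ΩA,
        (∀ (ω : ΩA) (θ : ΩH),
          χinv (GradedTensorProduct.tmul k ω θ) = BalancedTensor.lmul ω (τ' θ)) ∧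
        Function.LeftInverse χinv (gradedGaloisMap Δ) ∧
        Function.RightInverse χinv (gradedGaloisMap Δ) := by
  obtain ⟨ΔH, hΔH⟩ := hCH
  have hinj := gradedGaloisMap_injective hS hδ hΔ hΔH
  have hbij : Function.Bijective (gradedGaloisMap Δ) := ⟨hinj, gradedGaloisMap_surjective hδ hΔ⟩
  let e := LinearEquiv.ofBijective (gradedGaloisMap Δ) hbij
  let τ : ΩH →ₗ[k] BalancedTensor (baseForms Δ) ΩA :=
    e.symm.toLinearMap ∘ₗ (GradedTensorProduct.of k 𝒜 ℋ).toLinearMap ∘ₗ TensorProduct.mk k ΩA ΩH 1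
  have hχτ : ∀ θ, gradedGaloisMap Δ (τ θ) = GradedTensorProduct.tmul k 1 θ := fun θ =>
    e.apply_symm_apply _
  have hτ : IsExtendedTranslationMap hδ CA CH Δ τ :=
    isExtendedTranslationMap_of_rightInverse hδ hΔ hinj hχτ
  have hmul : ∀ ω θ, gradedGaloisMap Δ (BalancedTensor.lmul ω (τ θ)) =
      GradedTensorProduct.tmul k ω θ := fun ω θ => by
    rw [BalancedTensor.canonicalMap_lmul, hχτ, includeLeft_mul_tmul, mul_one]
  refine ⟨hbij, fun n => le_antisymm (map_balancedDegree_le hΔ n) ?_, τ, hτ,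
    fun τ'' h => h.unique hτ, fun n θ hθ => hτ.mem_balancedDegree hθ, e.symm.toLinearMap,
    fun ω θ => hinj ?_, e.symm_apply_apply, e.apply_symm_apply⟩
  -- The preimage `ω τ(θ)` of `ω ⊗ θ` has degree `r + s`, so each degree of the codomain is filled.
  · refine Submodule.span_le.2 ?_
    rintro _ ⟨r, s, ω, θ, rfl, hω, hθ, rfl⟩
    exact ⟨_, lmul_mem_balancedDegree hω (hτ.mem_balancedDegree hθ), hmul ω θ⟩
  · rw [hmul]
    exact e.apply_symm_apply _
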